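/- Semi-random planted independent set model. Let $V=\{1,\dots,n\}$ and let $S\subseteq V$ be any set with $|S|=k$. A random set $E'$ of edges between $S$ and $V\setminus S$ is drawn by taking each pair in $S\times(V\setminus S)$ independently with probability $1/2$. Then an adversary, who sees $E'$, adds arbitrary edges outside $S\times S$; the result is a graph $G=(V,E)$ with $E\supseteq E'$ in which $S$ is independent. The crude semidefinite program (C-SDP) of $G$ is: minimize $\sum_{u,v\in V}\|x_u-x_v\|^2$ over vectors $x_u\in\mathbb{R}^n$ $(u\in V)$ subject to $\|x_u\|=1$ for all $u$, $\langle x_u,x_v\rangle\ge 0$ for all $u,v$, and $\langle x_u,x_v\rangle=0$ for every edge $uv$ of $G$. The candidate sets of a solution $x$ are the $n$ sets, one for each vertex $u$, obtained from $\{v:\|x_v-x_u\|<1\}$ by running through the vertices in some order and adding every vertex that has no neighbour in the set built so far. Theorem. The C-SDP of every graph has an optimal solution. There are a constant $c_1>0$, two deterministic polynomial-time algorithms $\mathcal{A}$ and $\mathcal{B}$, which receive only the graph $G$, and a sequence $\delta_n\to 0$ such that the following holds. On every graph with $n$ vertices, $\mathcal{A}$ returns a list of at most $n$ independent sets and $\mathcal{B}$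 returns one independent set. For all $n$, all $k\ge c_1n^{2/3}$ and all $S$ with $|S|=k$, with probability at least $1-\delta_n$ over $E'$, every graph $G$ that the adversary may produce satisfies: 1. $S$ is one of the sets returned by $\mathcal{A}$; 2. the independent set returned by $\mathcal{B}$ has size at least $k$; 3. for every optimal solution of the C-SDP of $G$, and every order of the vertices in the greedy step, $S$ is one of the $n$ candidate sets. -/

import Mathlib

namespace PlantedIndepSet

/-! ### Deterministic algorithms on graphs: an integer RAM with logarithmic cost -/

/-- Memory of the machine: integer registers `reg r`, and integer arrays, `mem b i` being the cell
of array `b` at address `i`. -/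
structure State where
  reg : ℕ → ℤ
  mem : ℕ → ℤ → ℤ

/-- Contents `z` is put into register `r`. -/
def State.setReg (s : State) (r : ℕ) (z : ℤ) : State :=
  { s with reg := Function.update s.reg r z }

/-- Contents `z` is put into cell `i` of array `b`. -/
def State.setMem (s : State) (b : ℕ) (i z : ℤ) : State :=
  { s with mem := Function.update s.mem b (Function.update (s.mem b) i z) }

/-- The four arithmetic operations (integer division, with value `0` for the divisor `0`). -/
inductive Op
  | add
  | sub
  | mul
  | div

/-- The value of an arithmetic operation. -/
def Op.eval : Op → ℤ → ℤ → ℤ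
  | .add, a, b => a + b
  | .sub, a, b => a - b
  | .mul, a, b => a * b
  | .div, a, b => a / b

/-- Structured RAM programs. A program mentions finitely many registers and arrays; the cells of
an array are addressed indirectly, through the contents of a register. -/
inductive Prog
  /-- do nothing -/
  | skip
  /-- `reg r := c` -/
  | const (r : ℕ) (c : ℤ)
  /-- `reg r := reg a ∘ reg b` -/
  | arith (o : Op) (r a b : ℕ)
  /-- `reg r := mem b (reg a)` -/
  | load (r b a : ℕ)
  /-- `mem b (reg a) := reg r` -/
  | store (b a r : ℕ)
  /-- `p; q` -/
  | seq (p q : Prog)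
  /-- `if reg r > 0 then p else q` -/
  | ite (r : ℕ) (p q : Prog)
  /-- `while reg r > 0 do p` -/
  | loop (r : ℕ) (p : Prog)

/-- Number of binary digits of an integer. -/
def bits (z : ℤ) : ℕ := Nat.size z.natAbs

/-- `Exec p s s' t`: the program `p`, started in state `s`, halts in state `s'`, in time `t`. Each
elementary instruction and each test costs one plus the binary lengths of the integers it reads. -/
inductive Exec : Prog → State → State → ℕ → Prop
  | skip (s : State) : Exec .skip s s 1
  | const (r : ℕ) (c : ℤ) (s : State) : Exec (.const r c) s (s.setReg r c) (1 + bits c)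
  | arith (o : Op) (r a b : ℕ) (s : State) :
      Exec (.arith o r a b) s (s.setReg r (o.eval (s.reg a) (s.reg b)))
        (1 + bits (s.reg a) + bits (s.reg b))
  | load (r b a : ℕ) (s : State) :
      Exec (.load r b a) s (s.setReg r (s.mem b (s.reg a)))
        (1 + bits (s.reg a) + bits (s.mem b (s.reg a)))
  | store (b a r : ℕ) (s : State) :
      Exec (.store b a r) s (s.setMem b (s.reg a) (s.reg r))
        (1 + bits (s.reg a) + bits (s.reg r))
  | seq {p q : Prog} {s s' s'' : State} {t t' : ℕ} :
      Exec p s s' t → Exec q s' s'' t' → Exec (.seq p q) s s'' (t + t')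
  | ite_true {r : ℕ} {p q : Prog} {s s' : State} {t : ℕ} :
      0 < s.reg r → Exec p s s' t → Exec (.ite r p q) s s' (1 + bits (s.reg r) + t)
  | ite_false {r : ℕ} {p q : Prog} {s s' : State} {t : ℕ} :
      s.reg r ≤ 0 → Exec q s s' t → Exec (.ite r p q) s s' (1 + bits (s.reg r) + t)
  | loop_done {r : ℕ} {p : Prog} {s : State} :
      s.reg r ≤ 0 → Exec (.loop r p) s s (1 + bits (s.reg r))
  | loop_step {r : ℕ} {p : Prog} {s s' s'' : State} {t t' : ℕ} :
      0 < s.reg r → Exec p s s' t → Exec (.loop r p) s' s'' t' →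
        Exec (.loop r p) s s'' (1 + bits (s.reg r) + t + t')

/-- The machine is deterministic: final state and running time are functions of the initial
state. -/
theorem Exec.deterministic {p : Prog} {s s₁ s₂ : State} {t₁ t₂ : ℕ}
    (h₁ : Exec p s s₁ t₁) (h₂ : Exec p s s₂ t₂) : s₁ = s₂ ∧ t₁ = t₂ := by
  induction h₁ generalizing s₂ t₂ with
  | skip | const | arith | load | store => cases h₂; exact ⟨rfl, rfl⟩
  | seq _ _ ih ih' =>
    cases h₂ with
    | seq h h' =>
      obtain ⟨rfl, rfl⟩ := ih h
      obtain ⟨rfl, rfl⟩ := ih' h'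
      exact ⟨rfl, rfl⟩
  | ite_true hr _ ih =>
    cases h₂ with
    | ite_true _ h =>
      obtain ⟨rfl, rfl⟩ := ih h
      exact ⟨rfl, rfl⟩
    | ite_false hr' _ => omega
  | ite_false hr _ ih =>
    cases h₂ with
    | ite_true hr' _ => omega
    | ite_false _ h =>
      obtain ⟨rfl, rfl⟩ := ih h
      exact ⟨rfl, rfl⟩
  | loop_done hr =>
    cases h₂ with
    | loop_done _ => exact ⟨rfl, rfl⟩
    | loop_step hr' _ _ => omega
  | loop_step hr _ _ ih ih' =>
    cases h₂ with
    | loop_done hr' => omega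
    | loop_step _ h h' =>
      obtain ⟨rfl, rfl⟩ := ih h
      obtain ⟨rfl, rfl⟩ := ih' h'
      exact ⟨rfl, rfl⟩

open Classical in
/-- The input: `n` in register `0`, the adjacency matrix of the graph, row by row, in array `0`,
and zeros everywhere else. -/
noncomputable def inputState {n : ℕ} (G : SimpleGraph (Fin n)) : State where
  reg := fun r => if r = 0 then (n : ℤ) else 0
  mem := fun b i =>
    if b = 0 ∧ ∃ u v : Fin n, i = (u : ℤ) * (n : ℤ) + (v : ℤ) ∧ G.Adj u v then 1 else 0

/-- The output is the list `L` of vertex sets: its length is in register `0`, and the 0-1 indicator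
vectors of its members, one after the other, are in array `1`. -/
def Outputs {n : ℕ} (s : State) (L : List (Finset (Fin n))) : Prop :=
  s.reg 0 = (L.length : ℤ) ∧
    ∀ (i : Fin L.length) (v : Fin n),
      s.mem 1 ((i : ℤ) * (n : ℤ) + (v : ℤ)) = if v ∈ L.get i then 1 else 0

/-- The map `f`, taking a graph on `n` vertices to a list of vertex sets, is computed by one
deterministic program whose running time is at most a polynomial in `n`. -/
def PolyTimeComputable (f : (n : ℕ) → SimpleGraph (Fin n) → List (Finset (Fin n))) : Prop :=
  ∃ (p : Prog) (q : Polynomial ℕ), ∀ (n : ℕ) (G : SimpleGraph (Fin n)),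
    ∃ (s : State) (t : ℕ), Exec p (inputState G) s t ∧ t ≤ q.eval n ∧ Outputs s (f n G)

/-! ### The semi-random model -/

/-- The law of the random set `E'` of edges between `S` and its complement: each pair in `S × Sᶜ`
is taken independently with probability `1/2`, and no other pair is ever taken. -/
noncomputable def boundaryLaw {n : ℕ} (S : Finset (Fin n)) :
    MeasureTheory.Measure (Set (Fin n × Fin n)) :=
  ProbabilityTheory.setBernoulli ((S : Set (Fin n)) ×ˢ (S : Set (Fin n))ᶜ)
    ⟨1 / 2, by norm_num, by norm_num⟩

/-- The (undirected) graph whose edges are the pairs in `E`. -/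
def graphOf {n : ℕ} (E : Set (Fin n × Fin n)) : SimpleGraph (Fin n) :=
  SimpleGraph.fromRel fun u v => (u, v) ∈ E

/-- `G` is a graph that the adversary may produce from the random edges `E`: edges may be added,
but not removed, and none may be added inside `S`. -/
def Admissible {n : ℕ} (S : Finset (Fin n)) (E : Set (Fin n × Fin n))
    (G : SimpleGraph (Fin n)) : Prop :=
  graphOf E ≤ G ∧ G.IsIndepSet (S : Set (Fin n))

/-! ### The crude semidefinite program and its candidate sets -/

/-- Feasible solutions of the crude semidefinite program of `G`. -/
structure IsFeasible {n : ℕ} (G : SimpleGraph (Fin n))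
    (x : Fin n → EuclideanSpace ℝ (Fin n)) : Prop where
  norm_eq_one : ∀ u, ‖x u‖ = 1
  inner_nonneg : ∀ u v, 0 ≤ inner ℝ (x u) (x v)
  inner_eq_zero : ∀ u v, G.Adj u v → inner ℝ (x u) (x v) = 0

/-- The objective of the crude semidefinite program, to be minimized. -/
noncomputable def cost {n : ℕ} (x : Fin n → EuclideanSpace ℝ (Fin n)) : ℝ :=
  ∑ u, ∑ v, ‖x u - x v‖ ^ 2

/-- Optimal solutions of the crude semidefinite program of `G`. -/
def IsOptimal {n : ℕ} (G : SimpleGraph (Fin n)) (x : Fin n → EuclideanSpace ℝ (Fin n)) : Prop :=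
  IsFeasible G x ∧ ∀ y, IsFeasible G y → cost x ≤ cost y

open Classical in
/-- The vertices whose vectors are at distance less than `1` from that of `u`. -/
noncomputable def unitBall {n : ℕ} (x : Fin n → EuclideanSpace ℝ (Fin n)) (u : Fin n) :
    Finset (Fin n) :=
  Finset.univ.filter fun v => ‖x v - x u‖ < 1

open Classical in
/-- The vertices of the list `l` are visited in turn, and each is added to the set if it has no
neighbour in the set built so far, which is `A` at the beginning. -/
noncomputable def greedyExtend {n : ℕ} (G : SimpleGraph (Fin n)) (l : List (Fin n))
    (A : Finset (Fin n)) : Finset (Fin n) :=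
  l.foldl (fun B v => if ∀ w ∈ B, ¬ G.Adj w v then insert v B else B) A

/-- The `n` candidate sets of the solution `x`, one for each vertex: the greedy extensions of the
unit balls. -/
noncomputable def candidates {n : ℕ} (G : SimpleGraph (Fin n)) (l : List (Fin n))
    (x : Fin n → EuclideanSpace ℝ (Fin n)) : List (Finset (Fin n)) :=
  (List.finRange n).map fun u => greedyExtend G l (unitBall x u)

end PlantedIndepSet

namespace PlantedIndepSet

/-! ### A language of bounded loops, compiled to RAM programs -/

/-! Only two properties of E' matter (`GoodEdges`): every vertex outside S has more than |S|/4
neighbours in S, and the S × Sᶜ matrix with entry -1 on E' and 1 off it has norm at most 26√n. An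
exponential Markov bound gives the first with high probability. Hoeffding's inequality with a union
bound over lattice points gives the second (`goodEdges_prob`). All later arguments are deterministic
and hold for every admissible graph at once, since additional edges only add constraints and S stays
independent.

Let k = |S| and let x be an optimal solution of the C-SDP. Replacing all vectors of S by one unit
vector orthogonal to the vectors outside S keeps feasibility, so k² - Σ_{S×S}⟨x_u,x_v⟩ ≤ 2
Σ_{S×Sᶜ}⟨x_u,x_v⟩ (`IsOptimal.sum_le`). The inner products vanish on E', so they may be multiplied
by the signs at no cost, and the norm bound makes the right side O(√n·√(kn)) = O(n√k)
(`sum_inner_boundary_le`). For k ≥ 10⁴n^{2/3} this is a small fraction of k², hence the vectors of S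
are clustered (`sum_norm_sub_sq_le`). Some u ∈ S is then close to at least four fifths of S. Each
vertex outside S has a neighbour among these close vertices, so its vector is nearly orthogonal to
x_u. Thus the ball around x_u lies in S and dominates the complement of S (`exists_center`), and the
greedy step completes it to S in any order (`greedyExtend_eq`).

The algorithms do not solve the C-SDP itself. Over positive semidefinite matrices of trace n they
maximize the sum of the entries minus n⁴ times the squared violations of the diagonal and edge
constraints; nonnegativity of the entries is dropped. The Frank-Wolfe method does this in integers,
with a fixed denominator, and with a normalized high power of the shifted gradient in place of its
top eigenvector (`fwStep_spec`, `fwIter_optimal`). A solution within 1 of the optimum violates each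
constraint by at most 1/n (`sq_violation_le`), and merging S is still an admissible comparison
(`exists_merged`, `IsDensity.sum_le`), so the same clustering argument recovers S
(`exists_outSet_eq`).

For the running time, a small language of bounded loops is compiled to the machine (`Expr.exec`,
`Cmd.exec`). The cost is polynomial in the loop lengths and in the word length, and the word length
is polynomial because a power M^N of an n × n matrix with entries at most β has entries at most
(nβ)^N. -/

@[simp] theorem State.setReg_mem (s : State) (r : ℕ) (z : ℤ) : (s.setReg r z).mem = s.mem := rfl

@[simp] theorem State.setReg_reg (s : State) (r : ℕ) (z : ℤ) :
    (s.setReg r z).reg = Function.update s.reg r z := rfl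

@[simp] theorem State.setMem_reg (s : State) (b : ℕ) (i z : ℤ) : (s.setMem b i z).reg = s.reg := rfl

@[simp] theorem State.setMem_mem (s : State) (b : ℕ) (i z : ℤ) :
    (s.setMem b i z).mem = Function.update s.mem b (Function.update (s.mem b) i z) := rfl

theorem bits_le {z : ℤ} {k : ℕ} (h : |z| ≤ 2 ^ k) : bits z ≤ k + 1 := by
  unfold bits
  rw [Nat.size_le]
  have : (z.natAbs : ℤ) ≤ 2 ^ k := by rwa [Int.natCast_natAbs]
  have h2 : z.natAbs ≤ 2 ^ k := by exact_mod_cast this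
  have h3 : 2 ^ k < 2 ^ (k + 1) := Nat.pow_lt_pow_right (by norm_num) (by omega)
  omega

/-- Integer expressions: loop variables, array cells, arithmetic, conditionals (on positivity) and
sums over an initial segment of the naturals whose length is the value of a variable. -/
inductive Expr
  | const (c : ℤ)
  | var (x : ℕ)
  | load (b : ℕ) (e : Expr)
  | op (o : Op) (e₁ e₂ : Expr)
  | cond (e e₁ e₂ : Expr)
  | sum (x y : ℕ) (e : Expr)

namespace Expr

/-- The value of an expression. -/
def eval : Expr → (ℕ → ℤ) → (ℕ → ℤ → ℤ) → ℤ
  | const c, _, _ => c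
  | var x, v, _ => v x
  | load b e, v, m => m b (e.eval v m)
  | op o e₁ e₂, v, m => o.eval (e₁.eval v m) (e₂.eval v m)
  | cond e e₁ e₂, v, m => if 0 < e.eval v m then e₁.eval v m else e₂.eval v m
  | sum x y e, v, m => ∑ l ∈ Finset.range (v y).toNat, e.eval (Function.update v x l) m

/-- All variables of the expression are less than `d`. -/
def Below : Expr → ℕ → Prop
  | const _, _ => True
  | var x, d => x < d
  | load _ e, d => e.Below d
  | op _ e₁ e₂, d => e₁.Below d ∧ e₂.Below d
  | cond e e₁ e₂, d => e.Below d ∧ e₁.Below d ∧ e₂.Below d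
  | sum x y e, d => x < d ∧ y < d ∧ e.Below d

/-- Degree of growth of the values of an expression. -/
def deg : Expr → ℕ
  | const c => bits c + 1
  | var _ => 1
  | load _ e => e.deg
  | op _ e₁ e₂ => e₁.deg + e₂.deg
  | cond e e₁ e₂ => e.deg + e₁.deg + e₂.deg
  | sum _ _ e => e.deg + 1

/-- The program that puts the value of the expression into register `d`, using the registers from
`d` on as scratch space. -/
def code : Expr → ℕ → Prog
  | const c, d => .const d c
  | var x, d => .seq (.const d 0) (.arith .add d x d)
  | load b e, d => .seq (e.code d) (.load d b d)
  | op o e₁ e₂, d => .seq (e₁.code d) (.seq (e₂.code (d + 1)) (.arith o d d (d + 1)))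
  | cond e e₁ e₂, d => .seq (e.code d) (.ite d (e₁.code d) (e₂.code d))
  -- Register d accumulates the sum, d + 1 counts the remaining rounds down, and d + 2 keeps the old
  -- value of the variable x. Register x itself serves as the summation index and is restored at the
  -- end.
  | sum x y e, d =>
    .seq (.seq (.const d 0) (.seq (.const (d + 1) 0) (.seq (.arith .add (d + 2) x d)
        (.seq (.arith .add (d + 1) y d) (.const x 0)))))
      (.seq
        (.loop (d + 1)
          (.seq (e.code (d + 3)) (.seq (.arith .add d d (d + 3)) (.seq (.const (d + 3) 1)
            (.seq (.arith .add x x (d + 3)) (.arith .sub (d + 1) (d + 1) (d + 3)))))))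
        (.seq (.const (d + 3) 0) (.arith .add x (d + 2) (d + 3))))

/-- A bound for the running time of `code`, when the variables are at most `R` and the array
entries have at most `L` bits. -/
def time : Expr → ℕ → ℕ → ℕ
  | const c, _, _ => 1 + bits c
  | var _, _, L => L + 3
  | load _ e, R, L => e.time R L + L * e.deg + L + 3
  | op _ e₁ e₂, R, L => e₁.time R L + e₂.time R L + L * e₁.deg + L * e₂.deg + 3
  | cond e e₁ e₂, R, L => e.time R L + e₁.time R L + e₂.time R L + L * e.deg + 2
  | sum _ _ e, R, L => (R + 2) * (e.time R L + 20 * (L * (e.deg + 1) + 2))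

/-- Compiled code overwrites scratch registers; this shows that the values of later subexpressions
do not notice. -/
theorem eval_congr (e : Expr) {d : ℕ} (hd : e.Below d) {v v' : ℕ → ℤ}
    (h : ∀ r < d, v r = v' r) (m : ℕ → ℤ → ℤ) : e.eval v m = e.eval v' m := by
  induction e generalizing v v' with
  | const c => rfl
  | var x => exact h x hd
  | load b e ih => simp only [eval, ih hd h]
  | op o e₁ e₂ ih₁ ih₂ => simp only [eval, ih₁ hd.1 h, ih₂ hd.2 h]
  | cond e e₁ e₂ ih ih₁ ih₂ => simp only [eval, ih hd.1 h, ih₁ hd.2.1 h, ih₂ hd.2.2 h]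
  | sum x y e ih =>
    simp only [eval, h y hd.2.1]
    refine Finset.sum_congr rfl fun l _ => ih hd.2.2 fun r hr => ?_
    by_cases hx : r = x
    · simp [hx]
    · simp [hx, h r hr]

theorem one_le_deg (e : Expr) : 1 ≤ e.deg := by
  induction e <;> simp only [deg] <;> omega

end Expr

/-- Both bounds are at least 2, so their sum is at most their product; hence degrees add for every
operation, and a quotient is no larger than its numerator. -/
theorem Op.abs_eval_le (o : Op) {a b : ℤ} {L i j : ℕ} (hL : 1 ≤ L) (hi : 1 ≤ i) (hj : 1 ≤ j)
    (ha : |a| ≤ 2 ^ (L * i)) (hb : |b| ≤ 2 ^ (L * j)) : |o.eval a b| ≤ 2 ^ (L * (i + j)) := by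
  have h1 : (2 : ℤ) ≤ 2 ^ (L * i) :=
    le_self_pow₀ (by norm_num) (Nat.mul_ne_zero (by omega) (by omega))
  have h2 : (2 : ℤ) ≤ 2 ^ (L * j) :=
    le_self_pow₀ (by norm_num) (Nat.mul_ne_zero (by omega) (by omega))
  rw [Nat.mul_add, pow_add]
  have ha0 := abs_nonneg a
  have hb0 := abs_nonneg b
  cases o with
  | add => exact (abs_add_le a b).trans (by nlinarith)
  | sub => exact (abs_sub a b).trans (by nlinarith)
  | mul =>
    simp only [Op.eval, abs_mul]
    exact mul_le_mul ha hb hb0 (by positivity)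
  | div =>
    have : |a / b| ≤ |a| := Int.abs_ediv_le_abs a b
    exact this.trans (by nlinarith)

/-- The variables less than `d` lie between `0` and `R`. -/
def RegBound (d R : ℕ) (v : ℕ → ℤ) : Prop := ∀ r < d, 0 ≤ v r ∧ v r ≤ R

/-- All array entries have at most `L` binary digits, roughly. -/
def MemBound (L : ℕ) (m : ℕ → ℤ → ℤ) : Prop := ∀ b i, |m b i| ≤ 2 ^ L

theorem RegBound.update {d R : ℕ} {v : ℕ → ℤ} (h : RegBound d R v) (x : ℕ) {l : ℕ} (hl : l ≤ R) :
    RegBound d R (Function.update v x l) := by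
  intro r hr
  by_cases hx : r = x
  · subst hx; simp [hl]
  · simpa [hx] using h r hr

theorem RegBound.congr {d R : ℕ} {v v' : ℕ → ℤ} (h : RegBound d R v) (hv : ∀ r < d, v' r = v r) :
    RegBound d R v' := fun r hr => by rw [hv r hr]; exact h r hr

theorem RegBound.toNat_le {d R : ℕ} {v : ℕ → ℤ} (h : RegBound d R v) {y : ℕ} (hy : y < d) :
    (v y).toNat ≤ R := by have := h y hy; omega

/-- A sum has at most R ≤ 2 ^ L terms, so it costs one extra degree. Values therefore have O(L)
digits for a fixed expression, which bounds the cost of each instruction. -/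
theorem Expr.abs_eval_le (e : Expr) {d R L : ℕ} (hL : 1 ≤ L) (hR : R ≤ 2 ^ L) (hd : e.Below d)
    {v : ℕ → ℤ} {m : ℕ → ℤ → ℤ} (hv : RegBound d R v) (hm : MemBound L m) :
    |e.eval v m| ≤ 2 ^ (L * e.deg) := by
  have hR' : (R : ℤ) ≤ 2 ^ L := by exact_mod_cast hR
  induction e generalizing v with
  | const c =>
    have h1 : c.natAbs < 2 ^ bits c := Nat.lt_size_self _
    have h2 : |c| ≤ 2 ^ bits c := by
      rw [← Int.natCast_natAbs]; exact_mod_cast h1.le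
    refine h2.trans (pow_le_pow_right₀ (by norm_num) ?_)
    simp only [deg]; nlinarith
  | var x =>
    have := hv x hd
    simp only [eval, deg, mul_one]
    rw [abs_of_nonneg this.1]; omega
  | load b e ih =>
    refine (hm b _).trans (pow_le_pow_right₀ (by norm_num) ?_)
    have := e.one_le_deg
    simp only [deg]; nlinarith
  | op o e₁ e₂ ih₁ ih₂ =>
    exact o.abs_eval_le hL e₁.one_le_deg e₂.one_le_deg (ih₁ hd.1 hv) (ih₂ hd.2 hv)
  | cond e e₁ e₂ ih ih₁ ih₂ =>
    simp only [eval]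
    split_ifs
    · refine (ih₁ hd.2.1 hv).trans (pow_le_pow_right₀ (by norm_num) (Nat.mul_le_mul_left _ ?_))
      simp only [deg]; omega
    · refine (ih₂ hd.2.2 hv).trans (pow_le_pow_right₀ (by norm_num) (Nat.mul_le_mul_left _ ?_))
      simp only [deg]; omega
  | sum x y e ih =>
    have hy := hv.toNat_le hd.2.1
    simp only [eval]
    calc |∑ l ∈ Finset.range (v y).toNat, e.eval (Function.update v x l) m|
        ≤ ∑ l ∈ Finset.range (v y).toNat, |e.eval (Function.update v x l) m| :=
          Finset.abs_sum_le_sum_abs _ _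
      _ ≤ ∑ _l ∈ Finset.range (v y).toNat, (2 : ℤ) ^ (L * e.deg) := by
          refine Finset.sum_le_sum fun l hl => ih hd.2.2 (hv.update x ?_)
          have := Finset.mem_range.1 hl
          omega
      _ = (v y).toNat * 2 ^ (L * e.deg) := by simp
      _ ≤ 2 ^ L * 2 ^ (L * e.deg) := by
          gcongr
          have : ((v y).toNat : ℤ) ≤ R := by exact_mod_cast hy
          omega
      _ = 2 ^ (L * (e.deg + 1)) := by ring

/-- A counting loop. `I l` is the invariant after `l` rounds out of `m`. -/
theorem Exec.loop_count {r : ℕ} {p : Prog} {I : ℕ → State → Prop} {m τ κ : ℕ}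
    (hr : ∀ l s, l ≤ m → I l s → s.reg r = (m : ℤ) - l) (hκ : ∀ l : ℕ, l ≤ m → bits l ≤ κ)
    (hp : ∀ l s, l < m → I l s → ∃ s' t, Exec p s s' t ∧ t ≤ τ ∧ I (l + 1) s')
    {s : State} (hs : I 0 s) :
    ∃ s' t, Exec (.loop r p) s s' t ∧ t ≤ m * (τ + 1 + κ) + (1 + κ) ∧ I m s' := by
  have key : ∀ j l s, l + j = m → I l s →
      ∃ s' t, Exec (.loop r p) s s' t ∧ t ≤ j * (τ + 1 + κ) + (1 + κ) ∧ I m s' := by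
    intro j
    induction j with
    | zero =>
      intro l s hl hI
      obtain rfl : l = m := by omega
      have h0 := hr l s le_rfl hI
      refine ⟨s, _, Exec.loop_done (by omega), ?_, hI⟩
      have : s.reg r = ((0 : ℕ) : ℤ) := by push_cast; omega
      rw [this]
      have := hκ 0 (by omega)
      omega
    | succ j ih =>
      intro l s hl hI
      have h0 := hr l s (by omega) hI
      obtain ⟨s', t, h1, h2, h3⟩ := hp l s (by omega) hI
      obtain ⟨s'', t', h4, h5, h6⟩ := ih (l + 1) s' (by omega) h3
      refine ⟨s'', _, Exec.loop_step (by omega) h1 h4, ?_, h6⟩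
      have : s.reg r = ((j + 1 : ℕ) : ℤ) := by push_cast; omega
      rw [this]
      have := hκ (j + 1) (by omega)
      have e : (j + 1) * (τ + 1 + κ) = j * (τ + 1 + κ) + (τ + 1 + κ) := by ring
      omega
  exact key m 0 s (by omega) hs

theorem bits_natCast_le {l R L : ℕ} (hl : l ≤ R) (hR : R ≤ 2 ^ L) : bits (l : ℤ) ≤ L + 1 := by
  apply bits_le
  rw [abs_of_nonneg (by positivity)]
  exact_mod_cast hl.trans hR

@[simp] theorem bits_zero : bits 0 = 0 := rfl

@[simp] theorem bits_one : bits 1 = 1 := rfl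

/-- The machine pays for the accumulator in every round, so the partial sums must be bounded as well
as the final one. -/
theorem Expr.abs_sum_le (e : Expr) {d R L : ℕ} (hL : 1 ≤ L) (hR : R ≤ 2 ^ L) (hd : e.Below d)
    {v : ℕ → ℤ} {m : ℕ → ℤ → ℤ} (hv : RegBound d R v) (hm : MemBound L m) (x : ℕ) {j : ℕ}
    (hj : j ≤ R) :
    |∑ l ∈ Finset.range j, e.eval (Function.update v x l) m| ≤ 2 ^ (L * (e.deg + 1)) := by
  calc |∑ l ∈ Finset.range j, e.eval (Function.update v x l) m|
      ≤ ∑ l ∈ Finset.range j, |e.eval (Function.update v x l) m| := Finset.abs_sum_le_sum_abs _ _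
    _ ≤ ∑ _l ∈ Finset.range j, (2 : ℤ) ^ (L * e.deg) := by
        refine Finset.sum_le_sum fun l hl => e.abs_eval_le hL hR hd (hv.update x ?_) hm
        have := Finset.mem_range.1 hl
        omega
    _ = j * 2 ^ (L * e.deg) := by simp
    _ ≤ 2 ^ L * 2 ^ (L * e.deg) := by
        gcongr
        exact_mod_cast hj.trans hR
    _ = 2 ^ (L * (e.deg + 1)) := by ring

/-- Structural induction with the scratch base d free above the variables: a second operand or a
loop body is compiled with a larger base and so cannot destroy the partial results stored below it.
-/
theorem Expr.exec (e : Expr) {d₀ d R L : ℕ} (hL : 1 ≤ L) (hR : R ≤ 2 ^ L) (hd : e.Below d₀)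
    (hdd : d₀ ≤ d) {s : State} (hv : RegBound d₀ R s.reg) (hm : MemBound L s.mem) :
    ∃ s' t, Exec (e.code d) s s' t ∧ t ≤ e.time R L ∧ s'.mem = s.mem ∧
      (∀ r < d, s'.reg r = s.reg r) ∧ s'.reg d = e.eval s.reg s.mem := by
  induction e generalizing d s with
  | const c =>
    refine ⟨_, _, Exec.const d c s, le_rfl, rfl, fun r hr => ?_, by simp [eval]⟩
    simp [hr.ne]
  | var x =>
    have hx : x < d₀ := hd
    have hxd : x ≠ d := by omega
    refine ⟨_, _, (Exec.const d 0 s).seq (Exec.arith .add d x d _), ?_, rfl, fun r hr => ?_, ?_⟩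
    · have h1 := hv x hx
      have h2 : |s.reg x| ≤ 2 ^ L := by
        rw [abs_of_nonneg h1.1]; exact h1.2.trans (by exact_mod_cast hR)
      have := bits_le h2
      simp only [State.setReg_reg, Function.update_self, Function.update_of_ne hxd, bits_zero, time]
      omega
    · simp [hr.ne]
    · simp [eval, Op.eval, Function.update_of_ne hxd]
  | load b e ih =>
    obtain ⟨s', t, h1, h2, h3, h4, h5⟩ := ih hd hdd hv hm
    refine ⟨_, _, h1.seq (Exec.load d b d s'), ?_, h3, fun r hr => ?_, ?_⟩
    · have hb1 := bits_le (e.abs_eval_le hL hR hd hv hm)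
      have hb2 := bits_le (hm b (e.eval s.reg s.mem))
      rw [h5, h3]
      simp only [time]
      omega
    · simp [hr.ne, h4 r hr]
    · simp [eval, h3, h5]
  | op o e₁ e₂ ih₁ ih₂ =>
    obtain ⟨s', t, h1, h2, h3, h4, h5⟩ := ih₁ hd.1 hdd hv hm
    have hv' : RegBound d₀ R s'.reg := hv.congr fun r hr => h4 r (by omega)
    obtain ⟨s'', t', k1, k2, k3, k4, k5⟩ :=
      ih₂ (d := d + 1) hd.2 (by omega) hv' (by rwa [h3])
    have e2 : e₂.eval s'.reg s'.mem = e₂.eval s.reg s.mem := by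
      rw [h3]; exact e₂.eval_congr hd.2 (fun r hr => h4 r (by omega)) _
    refine ⟨_, _, h1.seq (k1.seq (Exec.arith o d d (d + 1) s'')), ?_, by simp [k3, h3],
      fun r hr => ?_, ?_⟩
    · have hb1 := bits_le (e₁.abs_eval_le hL hR hd.1 hv hm)
      have hb2 := bits_le (e₂.abs_eval_le hL hR hd.2 hv hm)
      rw [k5, e2, k4 d (by omega), h5]
      simp only [time]
      omega
    · simp [hr.ne, k4 r (by omega), h4 r hr]
    · simp [eval, k5, e2, k4 d (by omega), h5]
  | cond e e₁ e₂ ih ih₁ ih₂ =>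
    obtain ⟨s', t, h1, h2, h3, h4, h5⟩ := ih hd.1 hdd hv hm
    have hv' : RegBound d₀ R s'.reg := hv.congr fun r hr => h4 r (by omega)
    have hb := bits_le (e.abs_eval_le hL hR hd.1 hv hm)
    rw [← h5] at hb
    by_cases hc : 0 < e.eval s.reg s.mem
    · obtain ⟨s'', t', k1, k2, k3, k4, k5⟩ := ih₁ hd.2.1 hdd hv' (by rwa [h3])
      refine ⟨_, _, h1.seq (Exec.ite_true (by omega) k1), ?_, by simp [k3, h3], fun r hr => ?_, ?_⟩
      · simp only [time]; omega
      · rw [k4 r hr, h4 r hr]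
      · rw [k5, h3, eval, if_pos hc]
        exact e₁.eval_congr hd.2.1 (fun r hr => h4 r (by omega)) _
    · obtain ⟨s'', t', k1, k2, k3, k4, k5⟩ := ih₂ hd.2.2 hdd hv' (by rwa [h3])
      refine ⟨_, _, h1.seq (Exec.ite_false (by omega) k1), ?_, by simp [k3, h3], fun r hr => ?_, ?_⟩
      · simp only [time]; omega
      · rw [k4 r hr, h4 r hr]
      · rw [k5, h3, eval, if_neg hc]
        exact e₂.eval_congr hd.2.2 (fun r hr => h4 r (by omega)) _
  | sum x y e ih =>
    obtain ⟨hx, hy, he⟩ := hd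
    set m := (s.reg y).toNat with hmdef
    have hmR : m ≤ R := hv.toNat_le hy
    have hym : s.reg y = m := by have := hv y hy; omega
    set f : ℕ → ℤ := fun l => e.eval (Function.update s.reg x l) s.mem with hf
    set κ := L * (e.deg + 1) + 1 with hκ
    have hLκ : L + 1 ≤ κ := by rw [hκ]; nlinarith
    -- The invariant fixes every register below d except x, which holds the round number; hence
    -- inside the body the registers agree with the updated valuation.
    let I : ℕ → State → Prop := fun l s' => s'.mem = s.mem ∧
      s'.reg d = ∑ i ∈ Finset.range l, f i ∧ s'.reg (d + 1) = (m : ℤ) - l ∧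
      s'.reg (d + 2) = s.reg x ∧ s'.reg x = l ∧ ∀ r < d, r ≠ x → s'.reg r = s.reg r
    let s₀ : State := (((((s.setReg d 0).setReg (d + 1) 0).setReg (d + 2) (s.reg x)).setReg (d + 1)
      (s.reg y)).setReg x 0)
    have hxd : x < d := by omega
    have hyd : y < d := by omega
    have hinit : ∃ t, Exec (.seq (.const d 0) (.seq (.const (d + 1) 0)
        (.seq (.arith .add (d + 2) x d) (.seq (.arith .add (d + 1) y d) (.const x 0))))) s s₀ t ∧
        t ≤ 5 + κ + κ := by
      have e1 := Exec.arith .add (d + 2) x d ((s.setReg d 0).setReg (d + 1) 0)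
      have e2 := Exec.arith .add (d + 1) y d
        (((s.setReg d 0).setReg (d + 1) 0).setReg (d + 2) (s.reg x))
      simp only [State.setReg_reg, Op.eval, Function.update_self,
        Function.update_of_ne (show x ≠ d + 1 by omega), Function.update_of_ne hxd.ne,
        Function.update_of_ne (show d ≠ d + 1 by omega), add_zero, bits_zero] at e1
      simp only [State.setReg_reg, Op.eval, Function.update_self,
        Function.update_of_ne (show y ≠ d + 1 by omega), Function.update_of_ne hyd.ne,
        Function.update_of_ne (show y ≠ d + 2 by omega),
        Function.update_of_ne (show d ≠ d + 2 by omega),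
        Function.update_of_ne (show d ≠ d + 1 by omega), add_zero, bits_zero] at e2
      refine ⟨_, (Exec.const d 0 s).seq ((Exec.const (d + 1) 0 _).seq (e1.seq (e2.seq
        (Exec.const x 0 _)))), ?_⟩
      have hbx : bits (s.reg x) ≤ κ := by
        refine (bits_le (k := L) ?_).trans hLκ
        rw [abs_of_nonneg (hv x hx).1]; exact (hv x hx).2.trans (by exact_mod_cast hR)
      have hby : bits (s.reg y) ≤ κ := by
        refine (bits_le (k := L) ?_).trans hLκ
        rw [abs_of_nonneg (hv y hy).1]; exact (hv y hy).2.trans (by exact_mod_cast hR)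
      simp only [bits_zero]
      omega
    obtain ⟨t₀, ht₀, ht₀'⟩ := hinit
    have hI0 : I 0 s₀ := by
      refine ⟨rfl, ?_, ?_, ?_, ?_, fun r hr hrx => ?_⟩
      · simp [s₀, Function.update_of_ne hxd.ne']
      · have : d + 1 ≠ x := by omega
        simp [s₀, this, hym]
      · have : d + 2 ≠ x := by omega
        simp [s₀, this]
      · simp [s₀]
      · have h1 : r ≠ d := by omega
        have h2 : r ≠ d + 1 := by omega
        have h3 : r ≠ d + 2 := by omega
        simp [s₀, hrx, h1, h2, h3]
    have hbody : ∀ l s₁, l < m → I l s₁ → ∃ s₂ t, Exec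
        (.seq (e.code (d + 3)) (.seq (.arith .add d d (d + 3)) (.seq (.const (d + 3) 1)
            (.seq (.arith .add x x (d + 3)) (.arith .sub (d + 1) (d + 1) (d + 3)))))) s₁ s₂ t ∧
        t ≤ e.time R L + (7 + 4 * κ) ∧ I (l + 1) s₂ := by
      rintro l s₁ hl ⟨i1, i2, i3, i4, i5, i6⟩
      have hag : ∀ r < d, s₁.reg r = Function.update s.reg x l r := by
        intro r hr
        by_cases hrx : r = x
        · subst hrx; simp [i5]
        · simp [hrx, i6 r hr hrx]
      have hv₁ : RegBound d₀ R s₁.reg :=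
        (hv.update x (l := l) (by omega)).congr fun r hr => hag r (by omega)
      obtain ⟨s', t, h1, h2, h3, h4, h5⟩ :=
        ih (d := d + 3) he (by omega) hv₁ (by rwa [i1])
      have h5' : s'.reg (d + 3) = f l := by
        rw [h5, i1]; exact e.eval_congr he (fun r hr => hag r (by omega)) _
      have e1 := Exec.arith .add d d (d + 3) s'
      have e2 := Exec.const (d + 3) 1 (s'.setReg d (Op.add.eval (s'.reg d) (s'.reg (d + 3))))
      have e3 := Exec.arith .add x x (d + 3)
        ((s'.setReg d (Op.add.eval (s'.reg d) (s'.reg (d + 3)))).setReg (d + 3) 1)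
      have hx3 : x ≠ d + 3 := by omega
      have h13 : d + 1 ≠ d + 3 := by omega
      have h1d : d + 1 ≠ d := by omega
      have h1x : d + 1 ≠ x := by omega
      have h3x : d + 3 ≠ x := by omega
      have hdx : d ≠ x := by omega
      have h2x : d + 2 ≠ x := by omega
      have h21 : d + 2 ≠ d + 1 := by omega
      have h23 : d + 2 ≠ d + 3 := by omega
      have h2d : d + 2 ≠ d := by omega
      have hd1 : d ≠ d + 1 := by omega
      have hd3 : d ≠ d + 3 := by omega
      have rd : s'.reg d = ∑ i ∈ Finset.range l, f i := by rw [h4 d (by omega), i2]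
      have rd1 : s'.reg (d + 1) = (m : ℤ) - l := by rw [h4 (d + 1) (by omega), i3]
      have rd2 : s'.reg (d + 2) = s.reg x := by rw [h4 (d + 2) (by omega), i4]
      have rx : s'.reg x = l := by rw [h4 x (by omega), i5]
      refine ⟨_, _, h1.seq (e1.seq (e2.seq (e3.seq (Exec.arith .sub (d + 1) (d + 1) (d + 3) _)))),
        ?_, ?_, ?_, ?_, ?_, ?_, ?_⟩
      · have b1 : bits (∑ i ∈ Finset.range l, f i) ≤ κ :=
          bits_le (e.abs_sum_le hL hR he hv hm x (by omega))
        have b2 : bits (f l) ≤ κ := by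
          refine (bits_le (e.abs_eval_le hL hR he (hv.update x (l := l) (by omega)) hm)).trans ?_
          rw [hκ]; nlinarith
        have b3 : bits (l : ℤ) ≤ κ := (bits_natCast_le (show l ≤ R by omega) hR).trans hLκ
        have b4 : bits ((m : ℤ) - l) ≤ κ := by
          rw [← Nat.cast_sub hl.le]
          exact (bits_natCast_le (show m - l ≤ R by omega) hR).trans hLκ
        simp only [State.setReg_reg, Function.update_self, Function.update_of_ne hx3,
          Function.update_of_ne hxd.ne, Function.update_of_ne h13, Function.update_of_ne h1d,
          Function.update_of_ne h1x, Function.update_of_ne h3x, rd, h5', rx, rd1, bits_one]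
        omega
      · simp [h3, i1]
      · simp [Function.update_of_ne hdx, rd, h5', Op.eval, Finset.sum_range_succ]
      · simp [Function.update_of_ne h1x, rd1, Function.update_of_ne h3x, Op.eval]
        ring
      · simp [Function.update_of_ne h2x, rd2]
      · simp [Function.update_of_ne h1x.symm, Function.update_of_ne hx3, rx,
          Function.update_of_ne hxd.ne, Op.eval]
      · intro r hr hrx
        have a1 : r ≠ d := by omega
        have a2 : r ≠ d + 1 := by omega
        have a3 : r ≠ d + 3 := by omega
        simp [a1, a2, a3, hrx, h4 r (by omega), i6 r hr hrx]
    obtain ⟨s₃, t₃, l1, l2, i1, i2, i3, i4, i5, i6⟩ := Exec.loop_count (r := d + 1) (κ := κ)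
      (fun l s' _ h => h.2.2.1)
      (fun l hl => (bits_natCast_le (hl.trans hmR) hR).trans hLκ) hbody hI0
    have e4 := Exec.arith .add x (d + 2) (d + 3) (s₃.setReg (d + 3) 0)
    have h23 : d + 2 ≠ d + 3 := by omega
    simp only [State.setReg_reg, Op.eval, Function.update_self, Function.update_of_ne h23, i4,
      add_zero, bits_zero] at e4
    refine ⟨_, _, ht₀.seq (l1.seq ((Exec.const (d + 3) 0 s₃).seq e4)), ?_, ?_, ?_, ?_⟩
    · have hbx : bits (s.reg x) ≤ κ := by
        refine (bits_le (k := L) ?_).trans hLκ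
        rw [abs_of_nonneg (hv x hx).1]; exact (hv x hx).2.trans (by exact_mod_cast hR)
      simp only [bits_zero, time]
      have h1 : m * (e.time R L + (7 + 4 * κ) + 1 + κ) ≤
          R * (e.time R L + 20 * (L * (e.deg + 1) + 2)) := by
        refine Nat.mul_le_mul hmR ?_
        omega
      have h2 : (R + 2) * (e.time R L + 20 * (L * (e.deg + 1) + 2)) =
          R * (e.time R L + 20 * (L * (e.deg + 1) + 2)) +
          2 * (e.time R L + 20 * (L * (e.deg + 1) + 2)) := by ring
      omega
    · simp [i1]
    · intro r hr
      have a3 : r ≠ d + 3 := by omega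
      by_cases hrx : r = x
      · simp [hrx]
      · simp [hrx, a3, i6 r hr hrx]
    · have a1 : d ≠ x := by omega
      have a2 : d ≠ d + 3 := by omega
      simp [a1, i2, eval, hf, hmdef]

end PlantedIndepSet

/-! ### Commands with bounded loops, and their compilation -/

namespace PlantedIndepSet

/-- Commands: assignment to an array cell, sequencing, and loops whose number of rounds is the
value of a variable. -/
inductive Cmd
  | store (b : ℕ) (a e : Expr)
  | seq (c₁ c₂ : Cmd)
  | loop (x y : ℕ) (c : Cmd)

/-- The state after `l` rounds of a counting loop. -/
def rounds {α : Type*} (f : ℕ → α → α) : ℕ → α → α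
  | 0, m => m
  | l + 1, m => f l (rounds f l m)

namespace Cmd

/-- The effect of a command on the memory. -/
def run : Cmd → (ℕ → ℤ) → (ℕ → ℤ → ℤ) → (ℕ → ℤ → ℤ)
  | store b a e, v, m => Function.update m b (Function.update (m b) (a.eval v m) (e.eval v m))
  | seq c₁ c₂, v, m => c₂.run v (c₁.run v m)
  | loop x y c, v, m => rounds (fun l => c.run (Function.update v x l)) (v y).toNat m

/-- All values stored by the command have at most `L` binary digits, roughly. -/
def Safe (L : ℕ) : Cmd → (ℕ → ℤ) → (ℕ → ℤ → ℤ) → Prop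
  | store _ _ e, v, m => |e.eval v m| ≤ 2 ^ L
  | seq c₁ c₂, v, m => c₁.Safe L v m ∧ c₂.Safe L v (c₁.run v m)
  | loop x y c, v, m => ∀ l < (v y).toNat,
      c.Safe L (Function.update v x l) (rounds (fun l => c.run (Function.update v x l)) l m)

/-- All variables of the command are less than `d`. -/
def Below : Cmd → ℕ → Prop
  | store _ a e, d => a.Below d ∧ e.Below d
  | seq c₁ c₂, d => c₁.Below d ∧ c₂.Below d
  | loop x y c, d => x < d ∧ y < d ∧ c.Below d

/-- The program of a command, using the registers from `d` on as scratch space. -/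
def code : Cmd → ℕ → Prog
  | store b a e, d => .seq (a.code d) (.seq (e.code (d + 1)) (.store b d (d + 1)))
  | seq c₁ c₂, d => .seq (c₁.code d) (c₂.code d)
  | loop x y c, d =>
    .seq (.seq (.const d 0) (.seq (.arith .add (d + 1) x d)
        (.seq (.arith .add d y d) (.const x 0))))
      (.seq
        (.loop d
          (.seq (c.code (d + 2)) (.seq (.const (d + 2) 1)
            (.seq (.arith .add x x (d + 2)) (.arith .sub d d (d + 2))))))
        (.seq (.const (d + 2) 0) (.arith .add x (d + 1) (d + 2))))

/-- A bound for the running time of `code`, when the variables are at most `R` and the array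
entries have at most `L` bits. -/
def time : Cmd → ℕ → ℕ → ℕ
  | store _ a e, R, L => a.time R L + e.time R L + L * a.deg + L * e.deg + 3
  | seq c₁ c₂, R, L => c₁.time R L + c₂.time R L
  | loop _ _ c, R, L => (R + 2) * (c.time R L + 20 * (L + 2))

theorem run_congr (c : Cmd) {d : ℕ} (hd : c.Below d) {v v' : ℕ → ℤ}
    (h : ∀ r < d, v r = v' r) (m : ℕ → ℤ → ℤ) : c.run v m = c.run v' m := by
  induction c generalizing v v' m with
  | store b a e => simp only [run, a.eval_congr hd.1 h, e.eval_congr hd.2 h]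
  | seq c₁ c₂ ih₁ ih₂ => simp only [run, ih₁ hd.1 h, ih₂ hd.2 h]
  | loop x y c ih =>
    simp only [run, h y hd.2.1]
    congr 1
    funext l m
    refine ih hd.2.2 (fun r hr => ?_) m
    by_cases hx : r = x
    · simp [hx]
    · simp [hx, h r hr]

theorem safe_congr (c : Cmd) {d L : ℕ} (hd : c.Below d) {v v' : ℕ → ℤ}
    (h : ∀ r < d, v r = v' r) {m : ℕ → ℤ → ℤ} (hc : c.Safe L v m) : c.Safe L v' m := by
  induction c generalizing v v' m with
  | store b a e => simpa only [Safe, ← e.eval_congr hd.2 h] using hc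
  | seq c₁ c₂ ih₁ ih₂ =>
    refine ⟨ih₁ hd.1 h hc.1, ?_⟩
    rw [← c₁.run_congr hd.1 h]
    exact ih₂ hd.2 h hc.2
  | loop x y c ih =>
    have key : ∀ l : ℕ, ∀ r < d, Function.update v x l r = Function.update v' x l r := by
      intro l r hr
      by_cases hx : r = x
      · simp [hx]
      · simp [hx, h r hr]
    intro l hl
    rw [← h y hd.2.1] at hl
    have e1 : (fun (l : ℕ) => c.run (Function.update v' x l)) =
        fun (l : ℕ) => c.run (Function.update v x l) := by
      funext l m
      exact (c.run_congr hd.2.2 (key l) m).symm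
    rw [e1]
    exact ih hd.2.2 (key l) (hc l hl)

/-- A loop of stores can square a cell in each round, so no bound on the word length follows from
the syntax alone. The hypothesis `Safe` carries that bound through the induction; it is established
separately for each concrete algorithm from the mathematical meaning of the stored numbers. -/
theorem exec (c : Cmd) {d₀ d R L : ℕ} (hL : 1 ≤ L) (hR : R ≤ 2 ^ L) (hd : c.Below d₀)
    (hdd : d₀ ≤ d) {s : State} (hv : RegBound d₀ R s.reg) (hm : MemBound L s.mem)
    (hc : c.Safe L s.reg s.mem) :
    ∃ s' t, Exec (c.code d) s s' t ∧ t ≤ c.time R L ∧ s'.mem = c.run s.reg s.mem ∧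
      MemBound L s'.mem ∧ ∀ r < d, s'.reg r = s.reg r := by
  induction c generalizing d s with
  | store b a e =>
    obtain ⟨s', t, h1, h2, h3, h4, h5⟩ := a.exec hL hR hd.1 hdd hv hm
    have hv' : RegBound d₀ R s'.reg := hv.congr fun r hr => h4 r (by omega)
    obtain ⟨s'', t', k1, k2, k3, k4, k5⟩ :=
      e.exec (d := d + 1) hL hR hd.2 (by omega) hv' (by rwa [h3])
    have e2 : e.eval s'.reg s'.mem = e.eval s.reg s.mem := by
      rw [h3]; exact e.eval_congr hd.2 (fun r hr => h4 r (by omega)) _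
    rw [e2] at k5
    have e3 : s''.reg d = a.eval s.reg s.mem := by rw [k4 d (by omega), h5]
    refine ⟨_, _, h1.seq (k1.seq (Exec.store b d (d + 1) s'')), ?_, ?_, ?_, fun r hr => ?_⟩
    · have hb1 := bits_le (a.abs_eval_le hL hR hd.1 hv hm)
      have hb2 := bits_le (e.abs_eval_le hL hR hd.2 hv hm)
      rw [k5, e3]
      simp only [time]
      omega
    · simp [run, k5, e3, k3, h3]
    · intro b' i
      simp only [State.setMem_mem, k3, h3, k5, e3]
      by_cases hb : b' = b
      · subst hb
        by_cases hi : i = a.eval s.reg s.mem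
        · simpa [hi, Safe] using hc
        · simpa [hi] using hm b' i
      · simpa [hb] using hm b' i
    · simp [k4 r (by omega), h4 r hr]
  | seq c₁ c₂ ih₁ ih₂ =>
    obtain ⟨s', t, h1, h2, h3, h4, h5⟩ := ih₁ hd.1 hdd hv hm hc.1
    have hv' : RegBound d₀ R s'.reg := hv.congr fun r hr => h5 r (by omega)
    have hc' : c₂.Safe L s'.reg s'.mem := by
      rw [h3]; exact c₂.safe_congr hd.2 (fun r hr => (h5 r (by omega)).symm) hc.2
    obtain ⟨s'', t', k1, k2, k3, k4, k5⟩ := ih₂ hd.2 hdd hv' h4 hc'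
    refine ⟨_, _, h1.seq k1, ?_, ?_, k4, fun r hr => ?_⟩
    · simp only [time]; omega
    · rw [k3, h3]; exact c₂.run_congr hd.2 (fun r hr => h5 r (by omega)) _
    · rw [k5 r hr, h5 r hr]
  | loop x y c ih =>
    obtain ⟨hx, hy, hcd⟩ := hd
    set m := (s.reg y).toNat with hmdef
    have hmR : m ≤ R := hv.toNat_le hy
    have hym : s.reg y = m := by have := hv y hy; omega
    set f : ℕ → (ℕ → ℤ → ℤ) → ℕ → ℤ → ℤ := fun l => c.run (Function.update s.reg x l) with hf
    let I : ℕ → State → Prop := fun l s' => s'.mem = rounds f l s.mem ∧ MemBound L s'.mem ∧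
      s'.reg d = (m : ℤ) - l ∧
      s'.reg (d + 1) = s.reg x ∧ s'.reg x = l ∧ ∀ r < d, r ≠ x → s'.reg r = s.reg r
    let s₀ : State := ((((s.setReg d 0).setReg (d + 1) (s.reg x)).setReg d (s.reg y)).setReg x 0)
    have hxd : x < d := by omega
    have hyd : y < d := by omega
    have hbx : bits (s.reg x) ≤ L + 1 := by
      refine bits_le ?_
      rw [abs_of_nonneg (hv x hx).1]; exact (hv x hx).2.trans (by exact_mod_cast hR)
    have hby : bits (s.reg y) ≤ L + 1 := by
      refine bits_le ?_
      rw [abs_of_nonneg (hv y hy).1]; exact (hv y hy).2.trans (by exact_mod_cast hR)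
    have hinit : ∃ t, Exec (.seq (.const d 0) (.seq (.arith .add (d + 1) x d)
        (.seq (.arith .add d y d) (.const x 0)))) s s₀ t ∧ t ≤ 4 + (L + 1) + (L + 1) := by
      have e1 := Exec.arith .add (d + 1) x d (s.setReg d 0)
      have e2 := Exec.arith .add d y d ((s.setReg d 0).setReg (d + 1) (s.reg x))
      simp only [State.setReg_reg, Op.eval, Function.update_self,
        Function.update_of_ne hxd.ne, add_zero, bits_zero] at e1
      simp only [State.setReg_reg, Op.eval, Function.update_self,
        Function.update_of_ne (show y ≠ d + 1 by omega), Function.update_of_ne hyd.ne,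
        Function.update_of_ne (show d ≠ d + 1 by omega), add_zero, bits_zero] at e2
      refine ⟨_, (Exec.const d 0 s).seq (e1.seq (e2.seq (Exec.const x 0 _))), ?_⟩
      simp only [bits_zero]
      omega
    obtain ⟨t₀, ht₀, ht₀'⟩ := hinit
    have h1x : d + 1 ≠ x := by omega
    have hdx : d ≠ x := by omega
    have h1d : d + 1 ≠ d := by omega
    have h12 : d + 1 ≠ d + 2 := by omega
    have hd2 : d ≠ d + 2 := by omega
    have hx2 : x ≠ d + 2 := by omega
    have h2x : d + 2 ≠ x := by omega
    have hI0 : I 0 s₀ := by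
      refine ⟨rfl, hm, ?_, ?_, ?_, fun r hr hrx => ?_⟩
      · simp [s₀, hdx, hym]
      · simp [s₀, h1x]
      · simp [s₀]
      · have h1 : r ≠ d := by omega
        have h2 : r ≠ d + 1 := by omega
        simp [s₀, hrx, h1, h2]
    have hbody : ∀ l s₁, l < m → I l s₁ → ∃ s₂ t, Exec
        (.seq (c.code (d + 2)) (.seq (.const (d + 2) 1)
            (.seq (.arith .add x x (d + 2)) (.arith .sub d d (d + 2))))) s₁ s₂ t ∧
        t ≤ c.time R L + (6 + 2 * (L + 1)) ∧ I (l + 1) s₂ := by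
      rintro l s₁ hl ⟨i1, i2, i3, i4, i5, i6⟩
      have hag : ∀ r < d, s₁.reg r = Function.update s.reg x l r := by
        intro r hr
        by_cases hrx : r = x
        · subst hrx; simp [i5]
        · simp [hrx, i6 r hr hrx]
      have hv₁ : RegBound d₀ R s₁.reg :=
        (hv.update x (l := l) (by omega)).congr fun r hr => hag r (by omega)
      have hc₁ : c.Safe L s₁.reg s₁.mem := by
        rw [i1]
        exact c.safe_congr hcd (fun r hr => (hag r (by omega)).symm) (hc l hl)
      obtain ⟨s', t, h1, h2, h3, h4, h5⟩ :=
        ih (d := d + 2) hcd (by omega) hv₁ i2 hc₁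
      have h3' : s'.mem = rounds f (l + 1) s.mem := by
        rw [h3, i1]; exact c.run_congr hcd (fun r hr => hag r (by omega)) _
      have e1 := Exec.const (d + 2) 1 s'
      have e2 := Exec.arith .add x x (d + 2) (s'.setReg (d + 2) 1)
      have rd : s'.reg d = (m : ℤ) - l := by rw [h5 d (by omega), i3]
      have rd1 : s'.reg (d + 1) = s.reg x := by rw [h5 (d + 1) (by omega), i4]
      have rx : s'.reg x = l := by rw [h5 x (by omega), i5]
      refine ⟨_, _, h1.seq (e1.seq (e2.seq (Exec.arith .sub d d (d + 2) _))),
        ?_, ?_, ?_, ?_, ?_, ?_, ?_⟩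
      · have b3 : bits (l : ℤ) ≤ L + 1 := bits_natCast_le (show l ≤ R by omega) hR
        have b4 : bits ((m : ℤ) - l) ≤ L + 1 := by
          rw [← Nat.cast_sub hl.le]
          exact bits_natCast_le (show m - l ≤ R by omega) hR
        simp only [State.setReg_reg, Function.update_self, Function.update_of_ne hx2,
          Function.update_of_ne hdx, Function.update_of_ne hd2, Function.update_of_ne h2x,
          rx, rd, bits_one]
        omega
      · simp [h3']
      · simpa using h4
      · simp [Function.update_of_ne hdx, Function.update_of_ne h2x, rd, Op.eval]
        ring
      · simp [Function.update_of_ne h1x, rd1]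
      · simp [Function.update_of_ne hdx.symm, Function.update_of_ne hx2, rx, Op.eval]
      · intro r hr hrx
        have a1 : r ≠ d := by omega
        have a3 : r ≠ d + 2 := by omega
        simp [a1, a3, hrx, h5 r (by omega), i6 r hr hrx]
    obtain ⟨s₃, t₃, l1, l2, i1, i2, i3, i4, i5, i6⟩ := Exec.loop_count (r := d) (κ := L + 1)
      (fun l s' _ h => h.2.2.1) (fun l hl => bits_natCast_le (hl.trans hmR) hR) hbody hI0
    have e4 := Exec.arith .add x (d + 1) (d + 2) (s₃.setReg (d + 2) 0)
    simp only [State.setReg_reg, Op.eval, Function.update_self, Function.update_of_ne h12, i4,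
      add_zero, bits_zero] at e4
    refine ⟨_, _, ht₀.seq (l1.seq ((Exec.const (d + 2) 0 s₃).seq e4)), ?_, ?_, ?_, ?_⟩
    · simp only [bits_zero, time]
      have h1 : m * (c.time R L + (6 + 2 * (L + 1)) + 1 + (L + 1)) ≤
          R * (c.time R L + 20 * (L + 2)) := by
        refine Nat.mul_le_mul hmR ?_
        omega
      have h2 : (R + 2) * (c.time R L + 20 * (L + 2)) =
          R * (c.time R L + 20 * (L + 2)) + 2 * (c.time R L + 20 * (L + 2)) := by ring
      omega
    · simp [i1, run, hf, hmdef]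
    · simpa using i2
    · intro r hr
      have a3 : r ≠ d + 2 := by omega
      by_cases hrx : r = x
      · simp [hrx]
      · simp [hrx, a3, i6 r hr hrx]

end Cmd

/-! ### Polynomially bounded functions -/

/-- `f` is bounded by a polynomial. -/
def PolyBounded (f : ℕ → ℕ) : Prop := ∃ q : Polynomial ℕ, ∀ n, f n ≤ q.eval n

namespace PolyBounded

theorem const (c : ℕ) : PolyBounded fun _ => c := ⟨.C c, by simp⟩

theorem id : PolyBounded fun n => n := ⟨.X, by simp⟩

theorem add {f g : ℕ → ℕ} (hf : PolyBounded f) (hg : PolyBounded g) :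
    PolyBounded fun n => f n + g n := by
  obtain ⟨p, hp⟩ := hf
  obtain ⟨q, hq⟩ := hg
  exact ⟨p + q, fun n => by simpa using Nat.add_le_add (hp n) (hq n)⟩

theorem mul {f g : ℕ → ℕ} (hf : PolyBounded f) (hg : PolyBounded g) :
    PolyBounded fun n => f n * g n := by
  obtain ⟨p, hp⟩ := hf
  obtain ⟨q, hq⟩ := hg
  exact ⟨p * q, fun n => by simpa using Nat.mul_le_mul (hp n) (hq n)⟩

theorem pow {f : ℕ → ℕ} (hf : PolyBounded f) (k : ℕ) : PolyBounded fun n => f n ^ k := by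
  induction k with
  | zero => simpa using const 1
  | succ k ih => simpa only [pow_succ] using ih.mul hf

theorem exprTime (e : Expr) {R L : ℕ → ℕ} (hR : PolyBounded R) (hL : PolyBounded L) :
    PolyBounded fun n => e.time (R n) (L n) := by
  induction e with
  | const c => exact const _
  | var x => exact hL.add (const 3)
  | load b e ih => exact ((ih.add (hL.mul (const _))).add hL).add (const _)
  | op o e₁ e₂ ih₁ ih₂ =>
    exact (((ih₁.add ih₂).add (hL.mul (const _))).add (hL.mul (const _))).add (const _)
  | cond e e₁ e₂ ih ih₁ ih₂ =>
    exact (((ih.add ih₁).add ih₂).add (hL.mul (const _))).add (const _)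
  | sum x y e ih =>
    exact (hR.add (const _)).mul (ih.add ((const _).mul ((hL.mul (const _)).add (const _))))

theorem cmdTime (c : Cmd) {R L : ℕ → ℕ} (hR : PolyBounded R) (hL : PolyBounded L) :
    PolyBounded fun n => c.time (R n) (L n) := by
  induction c with
  | store b a e =>
    exact ((((exprTime a hR hL).add (exprTime e hR hL)).add (hL.mul (const _))).add
      (hL.mul (const _))).add (const _)
  | seq c₁ c₂ ih₁ ih₂ => exact ih₁.add ih₂
  | loop x y c ih => exact (hR.add (const _)).mul (ih.add ((const _).mul (hL.add (const _))))

end PolyBounded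

end PlantedIndepSet

namespace PlantedIndepSet

/-! ### Positive semidefinite matrices -/

open Matrix

open scoped MatrixOrder in
-- The vectors are the columns of a factor B with X = Bᴴ B.
theorem exists_gram {n : ℕ} {X : Matrix (Fin n) (Fin n) ℝ} (hX : X.PosSemidef) :
    ∃ x : Fin n → EuclideanSpace ℝ (Fin n), ∀ u v, X u v = inner ℝ (x u) (x v) := by
  obtain ⟨B, hB⟩ : ∃ B : Matrix (Fin n) (Fin n) ℝ, X = Bᴴ * B := by
    simpa [Matrix.star_eq_conjTranspose] using
      CStarAlgebra.nonneg_iff_eq_star_mul_self.1 (Matrix.nonneg_iff_posSemidef.2 hX)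
  refine ⟨fun u => WithLp.toLp 2 fun j => B j u, fun u v => ?_⟩
  simp [hB, Matrix.mul_apply, PiLp.inner_apply, mul_comm]

/-- Cauchy-Schwarz for the Gram vectors, whose squared norms are diagonal entries and hence at most
the trace. This bounds the diameter of the feasible set and the size of the iterates. -/
theorem abs_entry_le_trace {n : ℕ} {X : Matrix (Fin n) (Fin n) ℝ} (hX : X.PosSemidef)
    (u v : Fin n) : |X u v| ≤ X.trace := by
  have hd : ∀ w, X w w ≤ X.trace := fun w =>
    Finset.single_le_sum (f := fun i => X i i) (fun i _ => hX.diag_nonneg) (Finset.mem_univ w)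
  obtain ⟨x, hx⟩ := exists_gram hX
  have h1 := abs_real_inner_le_norm (x u) (x v)
  have hu := hd u
  have hv := hd v
  rw [hx u u, real_inner_self_eq_norm_sq] at hu
  rw [hx v v, real_inner_self_eq_norm_sq] at hv
  rw [hx u v]
  nlinarith [sq_nonneg (‖x u‖ - ‖x v‖)]

theorem trace_mul_eq_sum {n : ℕ} (A B : Matrix (Fin n) (Fin n) ℝ) (hB : B.IsHermitian) :
    (A * B).trace = ∑ u, ∑ v, A u v * B u v := by
  simp only [Matrix.trace, Matrix.diag, Matrix.mul_apply]
  refine Finset.sum_congr rfl fun u _ => Finset.sum_congr rfl fun v _ => ?_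
  have := hB.apply u v
  simp only [star_trivial] at this
  rw [this]

/-- A symmetric matrix with small entries is dominated by a multiple of the identity. -/
theorem posSemidef_add_smul_one {n : ℕ} {A : Matrix (Fin n) (Fin n) ℝ} (hA : A.IsHermitian)
    {g c : ℝ} (hg : ∀ u v, |A u v| ≤ g) (hc : n * g ≤ c) :
    (A + c • (1 : Matrix (Fin n) (Fin n) ℝ)).PosSemidef := by
  refine Matrix.PosSemidef.of_dotProduct_mulVec_nonneg ?_ fun x => ?_
  · exact hA.add (by simp [Matrix.IsHermitian])
  · have h1 : star x ⬝ᵥ ((A + c • (1 : Matrix (Fin n) (Fin n) ℝ)) *ᵥ x) =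
        ∑ u, ∑ v, A u v * (x u * x v) + c * ∑ u, x u ^ 2 := by
      simp only [Matrix.add_mulVec, Matrix.smul_mulVec, Matrix.one_mulVec, dotProduct_add,
        dotProduct_smul, smul_eq_mul]
      congr 1
      · simp only [dotProduct, Matrix.mulVec, Finset.mul_sum]
        refine Finset.sum_congr rfl fun u _ => Finset.sum_congr rfl fun v _ => ?_
        simp; ring
      · congr 1
        simp [dotProduct, sq]
    rw [h1]
    have h2 : -(∑ u, ∑ v, A u v * (x u * x v)) ≤ ∑ u, ∑ v, g * ((x u ^ 2 + x v ^ 2) / 2) := by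
      rw [← Finset.sum_neg_distrib]
      refine Finset.sum_le_sum fun u _ => ?_
      rw [← Finset.sum_neg_distrib]
      refine Finset.sum_le_sum fun v _ => ?_
      calc -(A u v * (x u * x v)) ≤ |A u v * (x u * x v)| := neg_le_abs _
        _ = |A u v| * |x u * x v| := abs_mul _ _
        _ ≤ g * ((x u ^ 2 + x v ^ 2) / 2) := by
          refine mul_le_mul (hg u v) ?_ (abs_nonneg _) ((abs_nonneg _).trans (hg u v))
          rw [abs_le]
          constructor <;> nlinarith [sq_nonneg (x u - x v), sq_nonneg (x u + x v)]
    have h3 : ∑ u, ∑ v, g * ((x u ^ 2 + x v ^ 2) / 2) = n * g * ∑ u : Fin n, x u ^ 2 := by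
      simp only [← Finset.mul_sum, add_div, Finset.sum_add_distrib, Finset.sum_const,
        Finset.card_univ, Fintype.card_fin, nsmul_eq_mul, ← Finset.sum_div]
      ring
    have h4 : 0 ≤ ∑ u, x u ^ 2 := Finset.sum_nonneg fun u _ => sq_nonneg _
    nlinarith

/-- Factor Λ^(N+1) - x^(N+1) as (Λ - x) Σ Λ^i x^(N-i); each of the N + 1 summands is at least x^N.
Applied to eigenvalues, it says that those far below the top contribute little to the trace of a
high power. -/
theorem pow_mul_sub_le {x Λ : ℝ} (hx : 0 ≤ x) (hxΛ : x ≤ Λ) (N : ℕ) :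
    (N + 1) * (x ^ N * (Λ - x)) ≤ Λ ^ (N + 1) := by
  have h1 : (N + 1) * x ^ N ≤ ∑ i ∈ Finset.range (N + 1), Λ ^ i * x ^ (N - i) := by
    calc (N + 1) * x ^ N = ∑ _i ∈ Finset.range (N + 1), x ^ N := by simp
      _ ≤ _ := by
        refine Finset.sum_le_sum fun i hi => ?_
        have : N = i + (N - i) := by have := Finset.mem_range.1 hi; omega
        calc x ^ N = x ^ i * x ^ (N - i) := by rw [← pow_add, ← this]
          _ ≤ _ := by gcongr
  have h2 := (Commute.all Λ x).geom_sum₂_mul (N + 1)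
  simp only [Nat.add_sub_cancel] at h2
  have h3 : 0 ≤ x ^ (N + 1) := by positivity
  nlinarith [mul_le_mul_of_nonneg_right h1 (sub_nonneg.2 hxΛ)]

/-- High powers of a positive semidefinite matrix nearly maximize the Rayleigh quotient. -/
theorem exists_trace_pow_le {n : ℕ} (hn : 0 < n) {B : Matrix (Fin n) (Fin n) ℝ}
    (hB : B.PosSemidef) (N : ℕ) :
    ∃ Λ, 0 ≤ Λ ∧ Λ ≤ B.trace ∧
      (∀ Z : Matrix (Fin n) (Fin n) ℝ, Z.PosSemidef → (B * Z).trace ≤ Λ * Z.trace) ∧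
      (N + 1) * (Λ * (B ^ N).trace - (B ^ (N + 1)).trace) ≤ n * Λ * (B ^ N).trace := by
  have hH := hB.isHermitian
  set ev := hH.eigenvalues with hev
  set U := hH.eigenvectorUnitary with hU
  have h0 : ∀ i, 0 ≤ ev i := hB.eigenvalues_nonneg
  have hspec : B = (U : Matrix (Fin n) (Fin n) ℝ) * diagonal ev *
      star (U : Matrix (Fin n) (Fin n) ℝ) := by
    have := hH.spectral_theorem
    rw [Unitary.conjStarAlgAut_apply] at this
    simpa using this
  have hUU : star (U : Matrix (Fin n) (Fin n) ℝ) * (U : Matrix (Fin n) (Fin n) ℝ) = 1 := by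
    simp
  have hpow : ∀ k, B ^ k = (U : Matrix (Fin n) (Fin n) ℝ) * diagonal (fun i => ev i ^ k) *
      star (U : Matrix (Fin n) (Fin n) ℝ) := by
    intro k
    have := hH.spectral_theorem
    conv_lhs => rw [this]
    rw [← map_pow, Unitary.conjStarAlgAut_apply, Matrix.diagonal_pow]
    congr 3
  have htr : ∀ k, (B ^ k).trace = ∑ i, ev i ^ k := by
    intro k
    rw [hpow k, Matrix.trace_mul_cycle, hUU, one_mul, Matrix.trace_diagonal]
  have : Nonempty (Fin n) := ⟨⟨0, hn⟩⟩
  obtain ⟨j, hj⟩ := Finite.exists_max ev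
  refine ⟨ev j, h0 j, ?_, fun Z hZ => ?_, ?_⟩
  · have := htr 1
    simp only [pow_one] at this
    rw [this]
    exact Finset.single_le_sum (fun i _ => h0 i) (Finset.mem_univ j)
  · set V := star (U : Matrix (Fin n) (Fin n) ℝ) * Z * (U : Matrix (Fin n) (Fin n) ℝ) with hV
    have hVp : V.PosSemidef := by
      have := hZ.conjTranspose_mul_mul_same (U : Matrix (Fin n) (Fin n) ℝ)
      rwa [← Matrix.star_eq_conjTranspose] at this
    have h1 : (B * Z).trace = (diagonal ev * V).trace := by
      rw [hV, hspec, mul_assoc, mul_assoc, Matrix.trace_mul_comm]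
      simp only [mul_assoc]
    have h2 : V.trace = Z.trace := by
      rw [hV, Matrix.trace_mul_cycle]
      simp
    rw [h1, ← h2, Matrix.trace, Matrix.trace, Finset.mul_sum]
    refine Finset.sum_le_sum fun i _ => ?_
    simp only [Matrix.diag_apply, Matrix.diagonal_mul]
    exact mul_le_mul_of_nonneg_right (hj i) hVp.diag_nonneg
  · rw [htr, htr]
    have h1 : ∀ i, (N + 1) * (ev i ^ N * (ev j - ev i)) ≤ ev j ^ (N + 1) :=
      fun i => pow_mul_sub_le (h0 i) (hj i) N
    calc (N + 1) * (ev j * ∑ i, ev i ^ N - ∑ i, ev i ^ (N + 1))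
        = ∑ i, (N + 1) * (ev i ^ N * (ev j - ev i)) := by
          rw [Finset.mul_sum, ← Finset.sum_sub_distrib, Finset.mul_sum]
          refine Finset.sum_congr rfl fun i _ => ?_
          ring
      _ ≤ ∑ _i : Fin n, ev j ^ (N + 1) := Finset.sum_le_sum fun i _ => h1 i
      _ = n * ev j * ev j ^ N := by simp; ring
      -- The top eigenvalue's own power is one of the nonnegative terms of the trace.
      _ ≤ n * ev j * ∑ i, ev i ^ N := by
          have := Finset.single_le_sum (f := fun i => ev i ^ N)
            (fun i _ => pow_nonneg (h0 i) N) (Finset.mem_univ j)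
          have h3 := h0 j
          gcongr

end PlantedIndepSet

namespace PlantedIndepSet

open Matrix

/-! ### A penalized semidefinite program, solved by the Frank-Wolfe method in integers -/

/-- Weight of the penalties. -/
def penWeight (n : ℕ) : ℤ := (n : ℤ) ^ 4

/-- Multiple of the identity that makes the gradients positive definite. -/
def shiftWeight (n : ℕ) : ℤ := 8 * (n : ℤ) ^ 6

/-- Inverse of the step size. -/
def stepInv (n : ℕ) : ℤ := 64 * (n : ℤ) ^ 8

/-- Number of steps, and exponent of the matrix powers. -/
def numIter (n : ℕ) : ℕ := 1024 * n ^ 11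

/-- Common denominator of the entries of the iterates. -/
def denom (n : ℕ) : ℤ := 4096 * (n : ℤ) ^ 15

open Classical in
/-- Indicator of the diagonal and of the edges, where the solution is constrained. -/
noncomputable def mask {n : ℕ} (G : SimpleGraph (Fin n)) (u v : Fin n) : ℤ :=
  if u = v ∨ G.Adj u v then 1 else 0

theorem mask_comm {n : ℕ} (G : SimpleGraph (Fin n)) (u v : Fin n) : mask G u v = mask G v u := by
  have h : u = v ∨ G.Adj u v ↔ v = u ∨ G.Adj v u := or_congr eq_comm (G.adj_comm u v)
  unfold mask
  by_cases hc : u = v ∨ G.Adj u v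
  · rw [if_pos hc, if_pos (h.1 hc)]
  · rw [if_neg hc, if_neg (mt h.2 hc)]

theorem mask_nonneg {n : ℕ} (G : SimpleGraph (Fin n)) (u v : Fin n) : (0 : ℝ) ≤ mask G u v := by
  unfold mask; split_ifs <;> simp

theorem mask_le_one {n : ℕ} (G : SimpleGraph (Fin n)) (u v : Fin n) : (mask G u v : ℝ) ≤ 1 := by
  unfold mask; split_ifs <;> simp

theorem abs_penalty_le {n : ℕ} (G : SimpleGraph (Fin n)) (u v : Fin n) {x y : ℝ} (h : |x| ≤ y) :
    |2 * (penWeight n : ℝ) * (mask G u v * x)| ≤ 2 * (n : ℝ) ^ 4 * y := by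
  have hlam : (penWeight n : ℝ) = (n : ℝ) ^ 4 := by simp [penWeight]
  rw [hlam, abs_mul, abs_of_nonneg (by positivity : (0 : ℝ) ≤ 2 * (n : ℝ) ^ 4), abs_mul,
    abs_of_nonneg (mask_nonneg G u v)]
  refine mul_le_mul_of_nonneg_left ?_ (by positivity)
  calc (mask G u v : ℝ) * |x| ≤ 1 * y :=
        mul_le_mul (mask_le_one G u v) h (abs_nonneg _) zero_le_one
    _ = y := one_mul _

/-- The scaled and shifted gradient. -/
noncomputable def gradMat {n : ℕ} (G : SimpleGraph (Fin n)) (W : Matrix (Fin n) (Fin n) ℤ) :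
    Matrix (Fin n) (Fin n) ℤ :=
  .of fun u v => denom n + shiftWeight n * denom n * (if u = v then 1 else 0) -
    2 * penWeight n * (mask G u v * (W u v - denom n * (if u = v then 1 else 0)))

/-- One step of the method. -/
noncomputable def fwStep {n : ℕ} (G : SimpleGraph (Fin n)) (W : Matrix (Fin n) (Fin n) ℤ) :
    Matrix (Fin n) (Fin n) ℤ :=
  .of fun u v =>
    ((stepInv n - 1) * W u v * (gradMat G W ^ numIter n).trace +
      n * denom n * (gradMat G W ^ numIter n) u v) /
    (stepInv n * (gradMat G W ^ numIter n).trace)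

/-- The iterates, scaled by the common denominator. -/
noncomputable def fwIter {n : ℕ} (G : SimpleGraph (Fin n)) (t : ℕ) : Matrix (Fin n) (Fin n) ℤ :=
  (fwStep G)^[t] (.of fun u v => denom n * (if u = v then 1 else 0))

/-- The penalized objective. -/
noncomputable def objective {n : ℕ} (G : SimpleGraph (Fin n)) (X : Matrix (Fin n) (Fin n) ℝ) : ℝ :=
  ∑ u, ∑ v, (X u v - penWeight n * (mask G u v * (X u v - if u = v then 1 else 0) ^ 2))

/-- The gradient of the penalized objective. -/
noncomputable def gradient {n : ℕ} (G : SimpleGraph (Fin n)) (X : Matrix (Fin n) (Fin n) ℝ)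
    (u v : Fin n) : ℝ :=
  1 - 2 * penWeight n * (mask G u v * (X u v - if u = v then 1 else 0))

/-- Positive semidefinite matrices of trace `n`. -/
structure IsDensity {n : ℕ} (X : Matrix (Fin n) (Fin n) ℝ) : Prop where
  posSemidef : X.PosSemidef
  trace_eq : X.trace = n

theorem IsDensity.abs_le {n : ℕ} {X : Matrix (Fin n) (Fin n) ℝ} (hX : IsDensity X)
    (u v : Fin n) : |X u v| ≤ n := hX.trace_eq ▸ abs_entry_le_trace hX.posSemidef u v

theorem IsDensity.symm {n : ℕ} {X : Matrix (Fin n) (Fin n) ℝ} (hX : IsDensity X)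
    (u v : Fin n) : X u v = X v u := by
  simpa using (hX.posSemidef.isHermitian.apply u v).symm

theorem penWeight_nonneg (n : ℕ) : (0 : ℝ) ≤ penWeight n := by
  simp [penWeight]

/-- Concavity: the tangent exceeds the function by exactly the penalty weight times a masked sum of
squares. -/
theorem objective_sub_le {n : ℕ} (G : SimpleGraph (Fin n)) (X Z : Matrix (Fin n) (Fin n) ℝ) :
    objective G Z - objective G X ≤ ∑ u, ∑ v, gradient G X u v * (Z u v - X u v) := by
  unfold objective
  simp only [← Finset.sum_sub_distrib]
  refine Finset.sum_le_sum fun u _ => Finset.sum_le_sum fun v _ => ?_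
  have h := mul_nonneg (penWeight_nonneg n) (mul_nonneg (mask_nonneg G u v)
    (sq_nonneg (Z u v - X u v)))
  unfold gradient
  nlinarith

/-- The second order expansion is exact because the objective is quadratic. -/
theorem objective_step {n : ℕ} (G : SimpleGraph (Fin n)) (X Y : Matrix (Fin n) (Fin n) ℝ) (γ : ℝ) :
    objective G ((1 - γ) • X + γ • Y) = objective G X +
      γ * ∑ u, ∑ v, gradient G X u v * (Y u v - X u v) -
      γ ^ 2 * ∑ u, ∑ v, penWeight n * (mask G u v * (Y u v - X u v) ^ 2) := by
  unfold objective
  simp only [Finset.mul_sum, ← Finset.sum_sub_distrib, ← Finset.sum_add_distrib]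
  refine Finset.sum_congr rfl fun u _ => Finset.sum_congr rfl fun v _ => ?_
  simp only [gradient, Matrix.add_apply, Matrix.smul_apply, smul_eq_mul]
  ring

/-! ### Convergence of the Frank-Wolfe iteration with rounding -/

section Step

variable {n : ℕ} (hn : 1 ≤ n) (G : SimpleGraph (Fin n)) {W : Matrix (Fin n) (Fin n) ℤ}
  {X : Matrix (Fin n) (Fin n) ℝ}

include hn

theorem cast_params : (1 : ℝ) ≤ n ∧ (0 : ℝ) < (denom n : ℝ) ∧ (64 : ℝ) ≤ (stepInv n : ℝ) := by
  have h1 : (1 : ℝ) ≤ n := by exact_mod_cast hn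
  have h8 : (1 : ℝ) ≤ (n : ℝ) ^ 8 := one_le_pow₀ h1
  refine ⟨h1, ?_, ?_⟩
  · simp only [denom]; push_cast; positivity
  · simp only [stepInv]; push_cast; linarith

/-- Without its shift the scaled gradient has entries at most D(1 + 2n⁴(n + 2)), where D is the
denominator, so its norm is at most n times that, which is below (8n⁶ - 1)D. The shift 8n⁶D leaves a
spare D times the identity, which makes the matrix positive definite. The trace bound later controls
the top eigenvalue. -/
theorem gradMat_posSemidef (hX : IsDensity X)
    (hW : ∀ u v, |(W u v : ℝ) - denom n * X u v| ≤ stepInv n) (hs : ∀ u v, W u v = W v u) :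
    ((gradMat G W).map (Int.cast : ℤ → ℝ) - (denom n : ℝ) • 1).PosSemidef ∧
    ((gradMat G W).map (Int.cast : ℤ → ℝ)).trace ≤ 13 * (n : ℝ) ^ 7 * denom n := by
  obtain ⟨h1, hD, hq⟩ := cast_params hn
  have hqD : (stepInv n : ℝ) ≤ denom n := by
    simp only [stepInv, denom]; push_cast
    have : (n : ℝ) ^ 8 ≤ (n : ℝ) ^ 15 := pow_le_pow_right₀ h1 (by norm_num)
    nlinarith [pow_nonneg (by linarith : (0 : ℝ) ≤ n) 8]
  have hlam : (penWeight n : ℝ) = (n : ℝ) ^ 4 := by simp [penWeight]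
  have hsh : (shiftWeight n : ℝ) = 8 * (n : ℝ) ^ 6 := by simp [shiftWeight]
  have hn4 : (0 : ℝ) ≤ (n : ℝ) ^ 4 := by positivity
  set D : ℝ := Int.cast (denom n) with hDdef
  constructor
  · set A : Matrix (Fin n) (Fin n) ℝ := .of fun u v =>
      D - 2 * penWeight n * (mask G u v * (W u v - D * (if u = v then 1 else 0))) with hA
    have hAH : A.IsHermitian := by
      ext u v
      simp [hA, mask_comm G u v, hs u v, eq_comm]
    have hAb : ∀ u v, |A u v| ≤ D * (1 + 2 * (n : ℝ) ^ 4 * (n + 2)) := by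
      intro u v
      have e1 : |(W u v : ℝ) - D * (if u = v then 1 else 0)| ≤ D * (n + 2) := by
        have a1 := hX.abs_le u v
        have a2 := hW u v
        have a3 : |(if u = v then (1 : ℝ) else 0)| ≤ 1 := by split_ifs <;> simp
        rw [abs_le] at a1 a2 a3 ⊢
        constructor <;> nlinarith
      have e2 : |2 * (penWeight n : ℝ) * (mask G u v * (W u v - D * (if u = v then 1 else 0)))| ≤
          2 * (n : ℝ) ^ 4 * (D * (n + 2)) := abs_penalty_le G u v e1
      simp only [hA, Matrix.of_apply]
      refine (abs_sub _ _).trans ?_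
      rw [abs_of_pos hD]
      linarith
    have hc : n * (D * (1 + 2 * (n : ℝ) ^ 4 * (n + 2))) ≤ (8 * (n : ℝ) ^ 6 - 1) * D := by
      have p5 : (n : ℝ) ^ 5 ≤ (n : ℝ) ^ 6 := pow_le_pow_right₀ h1 (by norm_num)
      have p1 : (n : ℝ) ≤ (n : ℝ) ^ 6 := le_self_pow₀ h1 (by norm_num)
      have p0 : (1 : ℝ) ≤ (n : ℝ) ^ 6 := one_le_pow₀ h1
      have : (n : ℝ) * (1 + 2 * (n : ℝ) ^ 4 * (n + 2)) ≤ 8 * (n : ℝ) ^ 6 - 1 := by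
        have : (n : ℝ) * (1 + 2 * (n : ℝ) ^ 4 * (n + 2)) =
          n + 2 * (n : ℝ) ^ 6 + 4 * (n : ℝ) ^ 5 := by ring
        nlinarith
      nlinarith
    have key := posSemidef_add_smul_one hAH hAb hc
    convert key using 1
    ext u v
    simp only [Matrix.sub_apply, Matrix.map_apply, gradMat, Matrix.of_apply, Matrix.smul_apply,
      Matrix.add_apply, Matrix.one_apply, smul_eq_mul, hA]
    push_cast
    rw [hsh]
    split_ifs <;> ring
  · have hdiag : ∀ u, (gradMat G W u u : ℝ) ≤ 13 * (n : ℝ) ^ 6 * D := by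
      intro u
      have a1 : 0 ≤ X u u := hX.posSemidef.diag_nonneg
      have a2 := (abs_le.1 (hW u u)).1
      have a4 : -(2 * D) ≤ (W u u : ℝ) - D := by nlinarith
      have a5 : mask G u u = 1 := by simp [mask]
      simp only [gradMat, Matrix.of_apply, a5, if_true]
      push_cast
      rw [hsh, hlam]
      have p4 : (n : ℝ) ^ 4 ≤ (n : ℝ) ^ 6 := pow_le_pow_right₀ h1 (by norm_num)
      have p0 : (1 : ℝ) ≤ (n : ℝ) ^ 6 := one_le_pow₀ h1
      have := mul_le_mul_of_nonneg_left a4 hn4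
      have := mul_le_mul_of_nonneg_right p4 hD.le
      have := mul_le_mul_of_nonneg_right p0 hD.le
      nlinarith
    calc ((gradMat G W).map (Int.cast : ℤ → ℝ)).trace = ∑ u, (gradMat G W u u : ℝ) := rfl
      _ ≤ ∑ _u : Fin n, 13 * (n : ℝ) ^ 6 * D := Finset.sum_le_sum fun u _ => hdiag u
      _ = _ := by simp; ring

-- The gap to any competitor Z shrinks by the factor 1 - γ, where γ = 1/q and q = 64n⁸, up to an
-- error of γ/4. Three errors are each at most 1/16 after division by γ: the curvature, at most
-- γ·4n⁸; the use of a matrix power for the top eigenvector, controlled by N = 1024n¹¹; and the use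
-- of the rounded gradient, at most 4n⁷q/D with D = 4096n¹⁵. The matrix X' is the exact step from X
-- in the computed direction, and the integer iterate only shadows it.
set_option maxHeartbeats 1000000 in
theorem fwStep_spec (hX : IsDensity X)
    (hW : ∀ u v, |(W u v : ℝ) - denom n * X u v| ≤ stepInv n) (hs : ∀ u v, W u v = W v u) :
    (∀ u v, fwStep G W u v = fwStep G W v u) ∧
    ∃ X', IsDensity X' ∧ (∀ u v, |(fwStep G W u v : ℝ) - denom n * X' u v| ≤ stepInv n) ∧
      ∀ Z, IsDensity Z → objective G Z - objective G X' ≤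
        (1 - 1 / (stepInv n : ℝ)) * (objective G Z - objective G X) +
          1 / (stepInv n : ℝ) * (1 / 4) := by
  obtain ⟨h1, hD, hq⟩ := cast_params hn
  obtain ⟨hB0, hBt⟩ := gradMat_posSemidef hn G hX hW hs
  set D : ℝ := Int.cast (denom n) with hDdef
  set q : ℝ := Int.cast (stepInv n) with hqdef
  set B : Matrix (Fin n) (Fin n) ℝ := (gradMat G W).map (Int.cast : ℤ → ℝ) with hBdef
  have hBpd : B.PosDef := by
    have : (D • (1 : Matrix (Fin n) (Fin n) ℝ)).PosDef := Matrix.PosDef.one.smul hD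
    simpa using this.add_posSemidef hB0
  have hBps := hBpd.posSemidef
  have hM : (gradMat G W ^ numIter n).map (Int.cast : ℤ → ℝ) = B ^ numIter n :=
    map_pow (Int.castRingHom ℝ).mapMatrix (gradMat G W) (numIter n)
  set N := numIter n with hN
  have hMps : (B ^ N).PosSemidef := hBps.pow N
  have hnonempty : Nonempty (Fin n) := ⟨⟨0, hn⟩⟩
  have htr0 : 0 < (B ^ N).trace := by
    -- A positive semidefinite matrix of trace zero vanishes, whereas a power of a positive definite
    -- matrix is invertible.
    refine lt_of_le_of_ne hMps.trace_nonneg fun h => ?_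
    have h2 := hMps.trace_eq_zero_iff.1 h.symm
    have h3 : IsUnit (B ^ N) := hBpd.isUnit.pow N
    rw [h2] at h3
    exact not_isUnit_zero h3
  have htrc : ((gradMat G W ^ N).trace : ℝ) = (B ^ N).trace := by
    rw [← hM]; simp [Matrix.trace]
  have hMuv : ∀ u v, ((gradMat G W ^ N) u v : ℝ) = (B ^ N) u v := fun u v => by
    rw [← hM]; rfl
  set tr := (B ^ N).trace with htr
  have hMs : ∀ u v, (gradMat G W ^ N) u v = (gradMat G W ^ N) v u := by
    intro u v
    have : (B ^ N) u v = (B ^ N) v u := by simpa using (hMps.isHermitian.apply u v).symm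
    rw [← hMuv, ← hMuv] at this
    exact_mod_cast this
  have hq0 : 0 < q := by linarith
  -- The direction of the step: a density matrix concentrated near the top eigenspace, available by
  -- integer matrix multiplication alone.
  set Y : Matrix (Fin n) (Fin n) ℝ := ((n : ℝ) / tr) • B ^ N with hY
  have hYd : IsDensity Y := by
    refine ⟨hMps.smul (by positivity), ?_⟩
    rw [hY, Matrix.trace_smul, smul_eq_mul, ← htr]
    field_simp
  have hγ : 1 / q ≤ 1 := by rw [div_le_one hq0]; linarith
  set γ := 1 / q with hγdef
  have hγ0 : 0 < γ := by positivity
  have hγq : γ * q = 1 := by rw [hγdef]; field_simp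
  refine ⟨fun u v => ?_, (1 - γ) • X + γ • Y, ⟨?_, ?_⟩, fun u v => ?_, fun Z hZ => ?_⟩
  · simp only [fwStep, Matrix.of_apply, hs u v, ← hN, hMs u v]
  · exact (hX.posSemidef.smul (by linarith)).add (hYd.posSemidef.smul hγ0.le)
  · simp only [Matrix.trace_add, Matrix.trace_smul, hX.trace_eq, hYd.trace_eq, smul_eq_mul]
    ring
  · set a : ℤ := (stepInv n - 1) * W u v * (gradMat G W ^ N).trace +
      n * denom n * (gradMat G W ^ N) u v with ha
    set b : ℤ := stepInv n * (gradMat G W ^ N).trace with hb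
    have hbR : (b : ℝ) = q * tr := by rw [hb]; push_cast; rw [htrc]
    have hb0 : (0 : ℝ) < b := by rw [hbR]; positivity
    have hbZ : 0 < b := by exact_mod_cast hb0
    have haR : (a : ℝ) = (q - 1) * W u v * tr + n * D * (B ^ N) u v := by
      rw [ha]; push_cast; rw [htrc, hMuv]
    have hdiv : (a : ℝ) / b = (1 - γ) * W u v + D * (γ * Y u v) := by
      rw [haR, hbR, hY, hγdef]
      simp only [Matrix.smul_apply, smul_eq_mul]
      field_simp
    have e1 : fwStep G W u v = a / b := rfl
    have l1 : ((a / b : ℤ) : ℝ) ≤ (a : ℝ) / b := by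
      rw [le_div_iff₀ hb0]; exact_mod_cast Int.ediv_mul_le a hbZ.ne'
    have l2 : (a : ℝ) / b ≤ ((a / b : ℤ) : ℝ) + 1 := by
      rw [div_le_iff₀ hb0]
      have := (Int.lt_ediv_add_one_mul_self a hbZ).le
      exact_mod_cast this
    rw [hdiv] at l1 l2
    rw [e1]
    simp only [Matrix.add_apply, Matrix.smul_apply, smul_eq_mul]
    have l3 := abs_le.1 (hW u v)
    rw [abs_le]
    have m1 := mul_le_mul_of_nonneg_left l3.1 (by linarith : 0 ≤ 1 - γ)
    have m2 := mul_le_mul_of_nonneg_left l3.2 (by linarith : 0 ≤ 1 - γ)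
    -- The old error q contracts to q - 1 and the integer division adds at most 1, so the rounding
    -- error never exceeds q, whatever the number of steps.
    have e2 : (1 - γ) * q = q - 1 := by linarith
    constructor <;> nlinarith
  · have hstep := objective_step G X Y γ
    have hconc := objective_sub_le G X Z
    have hqv : q = 64 * (n : ℝ) ^ 8 := by rw [hqdef, stepInv]; push_cast; ring
    have hDv : D = 4096 * (n : ℝ) ^ 15 := by rw [hDdef, denom]; push_cast; ring
    have hlam : (penWeight n : ℝ) = (n : ℝ) ^ 4 := by simp [penWeight]
    -- the curvature term
    have hcurv : γ * ∑ u, ∑ v, (penWeight n : ℝ) * (mask G u v * (Y u v - X u v) ^ 2) ≤ 1 / 16 := by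
      have : ∑ u, ∑ v, (penWeight n : ℝ) * (mask G u v * (Y u v - X u v) ^ 2) ≤
          ∑ _u : Fin n, ∑ _v : Fin n, (n : ℝ) ^ 4 * (1 * (2 * (n : ℝ)) ^ 2) := by
        refine Finset.sum_le_sum fun u _ => Finset.sum_le_sum fun v _ => ?_
        rw [hlam]
        refine mul_le_mul_of_nonneg_left ?_ (by positivity)
        refine mul_le_mul (mask_le_one G u v) ?_ (sq_nonneg _) zero_le_one
        have a1 := abs_le.1 (hX.abs_le u v)
        have a2 := abs_le.1 (hYd.abs_le u v)
        apply sq_le_sq'  <;> linarith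
      have e : ∑ _u : Fin n, ∑ _v : Fin n, (n : ℝ) ^ 4 * (1 * (2 * (n : ℝ)) ^ 2) =
          4 * (n : ℝ) ^ 8 := by simp; ring
      rw [e] at this
      calc _ ≤ γ * (4 * (n : ℝ) ^ 8) := mul_le_mul_of_nonneg_left this hγ0.le
        _ = 1 / 16 := by rw [hγdef, hqv]; field_simp; norm_num
    -- the linear subproblem
    obtain ⟨Λ, hΛ0, hΛt, hΛ, hpow⟩ := exists_trace_pow_le hn hBps N
    have hlin : ∑ u, ∑ v, B u v * (Z u v - Y u v) ≤ D * (1 / 16) := by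
      have t1 : ∑ u, ∑ v, B u v * Z u v ≤ Λ * n := by
        rw [← trace_mul_eq_sum B Z hZ.posSemidef.isHermitian, ← hZ.trace_eq]
        exact hΛ Z hZ.posSemidef
      have t2 : ∑ u, ∑ v, B u v * Y u v = n / tr * (B ^ (N + 1)).trace := by
        rw [← trace_mul_eq_sum B Y hYd.posSemidef.isHermitian, hY, Matrix.mul_smul,
          Matrix.trace_smul, smul_eq_mul, pow_succ']
      have t3 : Λ * n - n / tr * (B ^ (N + 1)).trace ≤ n * (n * Λ) / (N + 1) := by
        rw [le_div_iff₀ (by positivity)]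
        have : (Λ * n - n / tr * (B ^ (N + 1)).trace) * (N + 1) =
            n / tr * ((N + 1) * (Λ * tr - (B ^ (N + 1)).trace)) := by
          field_simp
        rw [this]
        calc n / tr * ((N + 1) * (Λ * tr - (B ^ (N + 1)).trace)) ≤ n / tr * (n * Λ * tr) :=
              mul_le_mul_of_nonneg_left hpow (by positivity)
          _ = n * (n * Λ) := by field_simp
      have hNv : ((N : ℕ) : ℝ) = 1024 * (n : ℝ) ^ 11 := by rw [hN, numIter]; push_cast; ring
      have t4 : n * (n * Λ) / (N + 1) ≤ D * (1 / 16) := by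
        rw [div_le_iff₀ (by positivity), hNv]
        have := hΛt.trans hBt
        have p : (n : ℝ) ^ 9 ≤ (n : ℝ) ^ 11 := pow_le_pow_right₀ h1 (by norm_num)
        calc (n : ℝ) * (n * Λ) ≤ n * (n * (13 * (n : ℝ) ^ 7 * D)) := by gcongr
          _ = 13 * D * (n : ℝ) ^ 9 := by ring
          _ ≤ 13 * D * (n : ℝ) ^ 11 := by gcongr
          _ ≤ D * (1 / 16) * (1024 * (n : ℝ) ^ 11 + 1) := by
            have : 0 ≤ D * (n : ℝ) ^ 11 := by positivity
            nlinarith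
      simp only [mul_sub, Finset.sum_sub_distrib]
      rw [t2]
      linarith
    -- the rounding error in the gradient
    have hgrad : ∑ u, ∑ v, gradient G X u v * (Z u v - Y u v) ≤ 1 / 8 := by
      have hpt : ∀ u v, gradient G X u v * (Z u v - Y u v) ≤
          1 / D * (B u v * (Z u v - Y u v)) -
            shiftWeight n * ((if u = v then 1 else 0) * (Z u v - Y u v)) +
          2 * (n : ℝ) ^ 4 * (q / D) * (2 * n) := by
        intro u v
        have hBuv : B u v = D + shiftWeight n * D * (if u = v then 1 else 0) -
            2 * penWeight n * (mask G u v * (W u v - D * (if u = v then 1 else 0))) := by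
          simp [hBdef, gradMat, hDdef]
        have e : gradient G X u v = 1 / D * B u v - shiftWeight n * (if u = v then 1 else 0) +
            2 * penWeight n * (mask G u v * ((W u v - D * X u v) / D)) := by
          rw [hBuv, gradient]
          field_simp
          ring
        have r1 : |2 * (penWeight n : ℝ) * (mask G u v * ((W u v - D * X u v) / D)) *
            (Z u v - Y u v)| ≤ 2 * (n : ℝ) ^ 4 * (q / D) * (2 * n) := by
          have a1 := abs_le.1 (hZ.abs_le u v)
          have a2 := abs_le.1 (hYd.abs_le u v)
          have a3 : |((W u v : ℝ) - D * X u v) / D| ≤ q / D := by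
            rw [abs_div, abs_of_pos hD]
            exact div_le_div_of_nonneg_right (hW u v) hD.le
          rw [abs_mul]
          refine mul_le_mul (abs_penalty_le G u v a3) ?_ (abs_nonneg _) (by positivity)
          rw [abs_le]; constructor <;> linarith
        have r2 := (abs_le.1 r1).2
        rw [e, add_mul, sub_mul, mul_assoc (1 / D), mul_assoc (shiftWeight n : ℝ)]
        linarith
      calc ∑ u, ∑ v, gradient G X u v * (Z u v - Y u v)
          ≤ ∑ u, ∑ v, (1 / D * (B u v * (Z u v - Y u v)) -
            shiftWeight n * ((if u = v then 1 else 0) * (Z u v - Y u v)) +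
            2 * (n : ℝ) ^ 4 * (q / D) * (2 * n)) :=
            Finset.sum_le_sum fun u _ => Finset.sum_le_sum fun v _ => hpt u v
        _ = 1 / D * ∑ u, ∑ v, B u v * (Z u v - Y u v) - shiftWeight n * (Z.trace - Y.trace) +
            n * (n * (2 * (n : ℝ) ^ 4 * (q / D) * (2 * n))) := by
            generalize 2 * (n : ℝ) ^ 4 * (q / D) * (2 * n) = C
            simp only [Finset.sum_add_distrib, Finset.sum_sub_distrib, ← Finset.mul_sum,
              Finset.sum_const, Finset.card_univ, Fintype.card_fin, nsmul_eq_mul]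
            congr 3
            simp [Matrix.trace, Finset.sum_sub_distrib]
        _ ≤ 1 / D * (D * (1 / 16)) - shiftWeight n * (Z.trace - Y.trace) +
            n * (n * (2 * (n : ℝ) ^ 4 * (q / D) * (2 * n))) := by gcongr
        -- The shift contributes only through the difference of the traces, and both traces are n.
        _ = 1 / 8 := by
            rw [hZ.trace_eq, hYd.trace_eq, hDv, hqv]
            field_simp
            norm_num
    have hsplit : ∑ u, ∑ v, gradient G X u v * (Z u v - X u v) =
        ∑ u, ∑ v, gradient G X u v * (Z u v - Y u v) +
        ∑ u, ∑ v, gradient G X u v * (Y u v - X u v) := by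
      simp only [← Finset.sum_add_distrib]
      refine Finset.sum_congr rfl fun u _ => Finset.sum_congr rfl fun v _ => ?_
      ring
    rw [hstep]
    set lin := ∑ u, ∑ v, gradient G X u v * (Y u v - X u v)
    have : γ ^ 2 * ∑ u, ∑ v, (penWeight n : ℝ) * (mask G u v * (Y u v - X u v) ^ 2) ≤
        γ * (1 / 16) := by
      rw [sq, mul_assoc]
      exact mul_le_mul_of_nonneg_left hcurv hγ0.le
    have h6 : γ * (objective G Z - objective G X - 1 / 8) ≤ γ * lin :=
      mul_le_mul_of_nonneg_left (by linarith) hγ0.le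
    nlinarith

omit hn in
theorem isDensity_one : IsDensity (1 : Matrix (Fin n) (Fin n) ℝ) :=
  ⟨Matrix.PosSemidef.one, by simp⟩

/-- The invariant of the iteration. -/
theorem fwIter_spec (t : ℕ) :
    (∀ u v, fwIter G t u v = fwIter G t v u) ∧
    ∃ X, IsDensity X ∧ (∀ u v, |(fwIter G t u v : ℝ) - denom n * X u v| ≤ stepInv n) ∧
      ∀ Z, IsDensity Z → objective G Z - objective G X ≤
        (1 - 1 / (stepInv n : ℝ)) ^ t * (objective G Z - objective G 1) + 1 / 4 := by
  obtain ⟨h1, hD, hq⟩ := cast_params hn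
  induction t with
  | zero =>
    refine ⟨fun u v => by simp [fwIter, eq_comm], 1, isDensity_one, fun u v => ?_, fun Z _ => ?_⟩
    · simp only [fwIter, Function.iterate_zero, id, Matrix.of_apply, Matrix.one_apply]
      push_cast
      rw [sub_self, abs_zero]
      linarith
    · simp
  | succ t ih =>
    obtain ⟨hs, X, hX, hW, hZ⟩ := ih
    obtain ⟨hs', X', hX', hW', hZ'⟩ := fwStep_spec hn G hX hW hs
    have e : fwIter G (t + 1) = fwStep G (fwIter G t) := Function.iterate_succ_apply' _ _ _
    rw [e]
    refine ⟨hs', X', hX', hW', fun Z hd => (hZ' Z hd).trans ?_⟩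
    have hγ : 1 / (stepInv n : ℝ) ≤ 1 := by rw [div_le_one (by linarith)]; linarith
    have := mul_le_mul_of_nonneg_left (hZ Z hd) (by linarith : 0 ≤ 1 - 1 / (stepInv n : ℝ))
    rw [pow_succ]
    nlinarith

theorem abs_fwIter_le (t : ℕ) (u v : Fin n) : |fwIter G t u v| ≤ denom n * n + stepInv n := by
  obtain ⟨h1, hD, hq⟩ := cast_params hn
  obtain ⟨-, X, hX, hW, -⟩ := fwIter_spec hn G t
  have a1 := abs_le.1 (hX.abs_le u v)
  have a2 := abs_le.1 (hW u v)
  have : |(fwIter G t u v : ℝ)| ≤ denom n * n + stepInv n := by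
    rw [abs_le]
    constructor <;> nlinarith
  exact_mod_cast this

/-- The last iterate is nearly optimal. -/
theorem fwIter_optimal :
    ∃ X, IsDensity X ∧
      (∀ u v, |(fwIter G (numIter n) u v : ℝ) - denom n * X u v| ≤ stepInv n) ∧
      ∀ Z, IsDensity Z → objective G Z - objective G X ≤ 1 := by
  obtain ⟨h1, hD, hq⟩ := cast_params hn
  obtain ⟨-, X, hX, hW, hZ⟩ := fwIter_spec hn G (numIter n)
  refine ⟨X, hX, hW, fun Z hd => (hZ Z hd).trans ?_⟩
  have b1 : objective G Z ≤ (n : ℝ) ^ 3 := by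
    calc objective G Z ≤ ∑ _u : Fin n, ∑ _v : Fin n, (n : ℝ) := by
          refine Finset.sum_le_sum fun u _ => Finset.sum_le_sum fun v _ => ?_
          have a1 := (abs_le.1 (hd.abs_le u v)).2
          have := mul_nonneg (penWeight_nonneg n) (mul_nonneg (mask_nonneg G u v)
            (sq_nonneg (Z u v - if u = v then 1 else 0)))
          linarith
      _ = _ := by simp; ring
  have b2 : 0 ≤ objective G (1 : Matrix (Fin n) (Fin n) ℝ) := by
    refine Finset.sum_nonneg fun u _ => Finset.sum_nonneg fun v _ => ?_
    simp only [Matrix.one_apply]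
    split_ifs <;> simp
  have hqv : (stepInv n : ℝ) = 64 * (n : ℝ) ^ 8 := by rw [stepInv]; push_cast; ring
  have hNv : (numIter n : ℝ) = 1024 * (n : ℝ) ^ 11 := by rw [numIter]; push_cast; ring
  have hγ : 1 / (stepInv n : ℝ) ≤ 1 := by rw [div_le_one (by linarith)]; linarith
  have hγ0 : 0 < 1 / (stepInv n : ℝ) := by positivity
  set γ := 1 / (stepInv n : ℝ) with hγdef
  -- Bernoulli's inequality, with (1 - γ)(1 + γ) ≤ 1. The number of steps times γ is 16n³, while the
  -- initial gap is at most n³, so at most 1/16 of a unit of it remains.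
  have b3 : (1 - γ) ^ numIter n * (1 + numIter n * γ) ≤ 1 := by
    have c1 : 1 + (numIter n : ℝ) * γ ≤ (1 + γ) ^ numIter n :=
      one_add_mul_le_pow (by linarith) _
    calc (1 - γ) ^ numIter n * (1 + numIter n * γ)
        ≤ (1 - γ) ^ numIter n * (1 + γ) ^ numIter n :=
          mul_le_mul_of_nonneg_left c1 (pow_nonneg (by linarith) _)
      _ = (1 - γ ^ 2) ^ numIter n := by rw [← mul_pow]; ring
      _ ≤ 1 := pow_le_one₀ (by nlinarith) (by nlinarith)
  have b4 : (numIter n : ℝ) * γ = 16 * (n : ℝ) ^ 3 := by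
    rw [hNv, hγdef, hqv]; field_simp; norm_num
  rw [b4] at b3
  have b5 : 0 ≤ (1 - γ) ^ numIter n := pow_nonneg (by linarith) _
  have b6 : (1 - γ) ^ numIter n * (objective G Z - objective G 1) ≤
      (1 - γ) ^ numIter n * (n : ℝ) ^ 3 := mul_le_mul_of_nonneg_left (by linarith) b5
  nlinarith

end Step

end PlantedIndepSet

namespace PlantedIndepSet

open MeasureTheory ProbabilityTheory

/-! ### Uniformly random subsets -/

section Bernoulli

variable {ι : Type*} [Countable ι] (U : Finset ι)

/-- Each element of `U` is taken independently with probability `1/2`. -/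
noncomputable abbrev halfLaw : Measure (Set ι) :=
  setBernoulli (U : Set ι) ⟨1 / 2, by norm_num, by norm_num⟩

/-- Markov's inequality for a uniformly random subset. -/
theorem halfLaw_real_le (A : Set (Set ι)) (f : Finset ι → ℝ) (hf : ∀ s, 0 ≤ f s)
    (hA : ∀ s ⊆ U, (s : Set ι) ∈ A → 1 ≤ f s) :
    (halfLaw U).real A ≤ (∑ s ∈ U.powerset, f s) / 2 ^ U.card := by
  classical
  have h1 : (halfLaw U).real A = (halfLaw U).real {s ∈ A | s ⊆ (U : Set ι)} := by
    rw [measureReal_def, measureReal_def, setBernoulli_apply_eq_apply_subsets]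
  have h2 : {s ∈ A | s ⊆ (U : Set ι)} ⊆
      ⋃ s ∈ U.powerset.filter (fun s : Finset ι => (s : Set ι) ∈ A), {(s : Set ι)} := by
    rintro s ⟨hs, hsU⟩
    obtain ⟨t, rfl⟩ := (U.finite_toSet.subset hsU).exists_finset_coe
    simp only [Set.mem_iUnion]
    exact ⟨t, by simpa [hs] using hsU, rfl⟩
  have h3 : ∀ s ∈ U.powerset, (halfLaw U).real {(s : Set ι)} = 1 / 2 ^ U.card := by
    intro s hs
    have hs' : (s : Set ι) ⊆ U := by simpa using hs
    rw [setBernoulli_real_singleton _ hs' U.finite_toSet, ← Finset.coe_sdiff,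
      Set.ncard_coe_finset, Set.ncard_coe_finset]
    have : U.card = s.card + (U \ s).card := by
      rw [Finset.card_sdiff_of_subset (by simpa using hs)]
      have := Finset.card_le_card (Finset.mem_powerset.1 hs)
      omega
    rw [this, pow_add]
    norm_num
    rw [one_div, inv_pow, inv_pow, mul_comm]
  calc (halfLaw U).real A = (halfLaw U).real {s ∈ A | s ⊆ (U : Set ι)} := h1
    _ ≤ (halfLaw U).real (⋃ s ∈ U.powerset.filter (fun s : Finset ι => (s : Set ι) ∈ A), {(s : Set ι)}) :=
      measureReal_mono h2 (measure_ne_top _ _)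
    _ ≤ ∑ s ∈ U.powerset.filter (fun s : Finset ι => (s : Set ι) ∈ A), (halfLaw U).real {(s : Set ι)} :=
      measureReal_biUnion_finset_le _ _
    _ = ∑ s ∈ U.powerset.filter (fun s : Finset ι => (s : Set ι) ∈ A), 1 / 2 ^ U.card :=
      Finset.sum_congr rfl fun s hs => h3 s (Finset.mem_filter.1 hs).1
    _ ≤ ∑ s ∈ U.powerset.filter (fun s : Finset ι => (s : Set ι) ∈ A), f s / 2 ^ U.card := by
      refine Finset.sum_le_sum fun s hs => ?_
      obtain ⟨k1, k2⟩ := Finset.mem_filter.1 hs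
      gcongr
      exact hA s (Finset.mem_powerset.1 k1) k2
    _ ≤ ∑ s ∈ U.powerset, f s / 2 ^ U.card :=
      Finset.sum_le_sum_of_subset_of_nonneg (Finset.filter_subset _ _)
        fun s _ _ => div_nonneg (hf s) (by positivity)
    _ = _ := (Finset.sum_div _ _ _).symm

/-- Markov's inequality for a function of product form. -/
theorem halfLaw_real_le_prod [DecidableEq ι] (A : Set (Set ι)) (a b : ι → ℝ) (ha : ∀ i, 0 ≤ a i)
    (hb : ∀ i, 0 ≤ b i) {c : ℝ} (hc : 0 ≤ c)
    (hA : ∀ s ⊆ U, (s : Set ι) ∈ A → 1 ≤ c * ((∏ i ∈ s, a i) * ∏ i ∈ U \ s, b i)) :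
    (halfLaw U).real A ≤ c * ∏ i ∈ U, ((a i + b i) / 2) := by
  refine (halfLaw_real_le U A (fun s => c * ((∏ i ∈ s, a i) * ∏ i ∈ U \ s, b i))
    (fun s => mul_nonneg hc (mul_nonneg (Finset.prod_nonneg fun i _ => ha i)
      (Finset.prod_nonneg fun i _ => hb i))) hA).trans_eq ?_
  rw [← Finset.mul_sum, ← Finset.prod_add, Finset.prod_div_distrib, Finset.prod_const, mul_div_assoc]

open Classical in
/-- `-1` on the set `E`, and `1` off it. -/
noncomputable def sgn (E : Set ι) (i : ι) : ℝ := if i ∈ E then -1 else 1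

/-- Hoeffding's inequality. -/
theorem halfLaw_real_sum_ge_le (t : ι → ℝ) (T : ℝ) :
    (halfLaw U).real {E | T ≤ ∑ i ∈ U, sgn E i * t i} ≤ Real.exp ((∑ i ∈ U, t i ^ 2) / 2 - T) := by
  classical
  -- Exponential moments: a chosen element carries the sign -1 and the weight exp(-t), any other
  -- exp(t), so the averages are cosh t ≤ exp(t²/2).
  refine (halfLaw_real_le_prod U _ (fun i => Real.exp (-t i)) (fun i => Real.exp (t i))
    (fun i => (Real.exp_pos _).le) (fun i => (Real.exp_pos _).le) (Real.exp_pos (-T)).le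
    fun s hs hT => ?_).trans ?_
  · rw [← Real.exp_sum, ← Real.exp_sum, ← Real.exp_add, ← Real.exp_add, Real.one_le_exp_iff]
    have h : ∑ i ∈ U, sgn (s : Set ι) i * t i = ∑ i ∈ s, -t i + ∑ i ∈ U \ s, t i := by
      rw [← Finset.sum_sdiff hs, add_comm]
      congr 1
      · exact Finset.sum_congr rfl fun i hi => by simp [sgn, hi]
      · exact Finset.sum_congr rfl fun i hi => by simp [sgn, (Finset.mem_sdiff.1 hi).2]
    have hT' : T ≤ _ := hT
    rw [h] at hT'
    linarith
  · have h : ∏ i ∈ U, ((Real.exp (-t i) + Real.exp (t i)) / 2) ≤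
        Real.exp ((∑ i ∈ U, t i ^ 2) / 2) := by
      rw [Finset.sum_div, Real.exp_sum]
      refine Finset.prod_le_prod (fun i _ => by positivity) fun i _ => ?_
      have := Real.cosh_le_exp_half_sq (t i)
      rwa [Real.cosh_eq, add_comm] at this
    calc _ ≤ Real.exp (-T) * Real.exp ((∑ i ∈ U, t i ^ 2) / 2) :=
          mul_le_mul_of_nonneg_left h (Real.exp_pos _).le
      _ = _ := by rw [← Real.exp_add]; congr 1; ring

end Bernoulli

/-! ### A net of lattice points -/

/-- Lattice points in a ball. -/
noncomputable def latticeBall (n : ℕ) : Finset (Fin n → ℤ) :=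
  (Fintype.piFinset fun _ => Finset.Icc (-(7 * n : ℤ)) (7 * n)).filter fun z => ∑ i, z i ^ 2 ≤ 7 * n

/-- The box in the definition only serves finiteness: an integer with square at most 7n has absolute
value at most 7n. -/
theorem mem_latticeBall {n : ℕ} {z : Fin n → ℤ} : z ∈ latticeBall n ↔ ∑ i, z i ^ 2 ≤ 7 * n := by
  simp only [latticeBall, Finset.mem_filter, Fintype.mem_piFinset, Finset.mem_Icc, and_iff_right_iff_imp]
  intro h i
  have h1 : z i ^ 2 ≤ ∑ i, z i ^ 2 :=
    Finset.single_le_sum (f := fun i => z i ^ 2) (fun i _ => sq_nonneg _) (Finset.mem_univ i)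
  constructor <;> nlinarith [sq_nonneg (z i - 1), sq_nonneg (z i + 1), Int.le_self_sq (z i),
    Int.le_self_sq (-z i)]

/-- Since j² ≥ |j| and 1/e ≤ 1/2, the sum is at most two geometric series, that is 4, and 4 ≤ e². -/
theorem sum_exp_neg_sq_le (B : ℤ) :
    ∑ j ∈ Finset.Icc (-B) B, Real.exp (-(j : ℝ) ^ 2) ≤ Real.exp 2 := by
  have h1 : ∀ j : ℤ, Real.exp (-(j : ℝ) ^ 2) ≤ (1 / 2 : ℝ) ^ j.natAbs := by
    intro j
    have h2 : (1 / 2 : ℝ) ^ j.natAbs ≥ Real.exp (-1) ^ j.natAbs := by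
      gcongr
      rw [Real.exp_neg, one_div]
      gcongr
      linarith [Real.add_one_le_exp (1 : ℝ)]
    refine le_trans ?_ h2
    rw [← Real.exp_nat_mul]
    gcongr
    have h3 : (j.natAbs : ℝ) ≤ (j : ℝ) ^ 2 := by
      have : |j| ≤ j ^ 2 := by
        rw [← sq_abs]
        exact Int.le_self_sq _
      rw [Nat.cast_natAbs]
      exact_mod_cast this
    linarith
  have hmaps : ∀ j ∈ Finset.Icc (-B) B, j.natAbs ∈ Finset.range (B.natAbs + 1) := by
    intro j hj
    rw [Finset.mem_Icc] at hj
    rw [Finset.mem_range]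
    omega
  calc ∑ j ∈ Finset.Icc (-B) B, Real.exp (-(j : ℝ) ^ 2)
      ≤ ∑ j ∈ Finset.Icc (-B) B, (1 / 2 : ℝ) ^ j.natAbs := Finset.sum_le_sum fun j _ => h1 j
    _ = ∑ m ∈ Finset.range (B.natAbs + 1),
        ∑ j ∈ Finset.Icc (-B) B with j.natAbs = m, (1 / 2 : ℝ) ^ j.natAbs :=
        (Finset.sum_fiberwise_of_maps_to hmaps _).symm
    _ ≤ ∑ m ∈ Finset.range (B.natAbs + 1), 2 * (1 / 2 : ℝ) ^ m := by
        refine Finset.sum_le_sum fun m _ => ?_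
        rw [Finset.sum_congr rfl (g := fun _ => (1 / 2 : ℝ) ^ m)
          fun j hj => by rw [(Finset.mem_filter.1 hj).2], Finset.sum_const, nsmul_eq_mul]
        gcongr
        have hsub : (Finset.Icc (-B) B).filter (fun j => j.natAbs = m) ⊆ {(m : ℤ), -(m : ℤ)} := by
          intro j hj
          have := (Finset.mem_filter.1 hj).2
          simp only [Finset.mem_insert, Finset.mem_singleton]
          omega
        exact_mod_cast (Finset.card_le_card hsub).trans Finset.card_le_two
    _ ≤ 2 * 2 := by
        rw [← Finset.mul_sum]
        have := sum_geometric_two_le (B.natAbs + 1)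
        gcongr
    _ ≤ Real.exp 2 := by
        have h := Real.add_one_le_exp (1 : ℝ)
        have : Real.exp 2 = Real.exp 1 * Real.exp 1 := by rw [← Real.exp_add]; norm_num
        rw [this]
        nlinarith

/-- Each lattice point of the ball has exp(7n - Σ z_i²) ≥ 1; summed over the whole box this weight
factorizes over the coordinates into n theta sums, each at most e². -/
theorem card_latticeBall_le (n : ℕ) : ((latticeBall n).card : ℝ) ≤ Real.exp (9 * n) := by
  calc ((latticeBall n).card : ℝ) = ∑ _z ∈ latticeBall n, (1 : ℝ) := by simp
    _ ≤ ∑ z ∈ latticeBall n, Real.exp (7 * n) * ∏ i, Real.exp (-(z i : ℝ) ^ 2) := by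
        refine Finset.sum_le_sum fun z hz => ?_
        rw [← Real.exp_sum, ← Real.exp_add, Real.one_le_exp_iff, Finset.sum_neg_distrib]
        have : ((∑ i, z i ^ 2 : ℤ) : ℝ) ≤ ((7 * n : ℤ) : ℝ) := by
          exact_mod_cast mem_latticeBall.1 hz
        push_cast at this
        linarith
    _ ≤ ∑ z ∈ Fintype.piFinset fun _ : Fin n => Finset.Icc (-(7 * n : ℤ)) (7 * n),
        Real.exp (7 * n) * ∏ i, Real.exp (-(z i : ℝ) ^ 2) :=
        Finset.sum_le_sum_of_subset_of_nonneg (Finset.filter_subset _ _) fun z _ _ => by positivity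
    _ = Real.exp (7 * n) * ∏ _i : Fin n,
        ∑ j ∈ Finset.Icc (-(7 * n : ℤ)) (7 * n), Real.exp (-(j : ℝ) ^ 2) := by
        rw [← Finset.mul_sum, Finset.prod_univ_sum]
    _ ≤ Real.exp (7 * n) * ∏ _i : Fin n, Real.exp 2 := by
        gcongr
        exact sum_exp_neg_sq_le _
    _ = Real.exp (9 * n) := by
        rw [Finset.prod_const, ← Real.exp_nat_mul, ← Real.exp_add]
        congr 1
        simp
        ring

/-- A bilinear form that is bounded on lattice points is bounded. -/
theorem bilin_le_of_latticeBall {n : ℕ} (hn : 1 ≤ n) (m : Fin n → Fin n → ℝ) {T : ℝ}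
    (hT : ∀ z ∈ latticeBall n, ∀ w ∈ latticeBall n, ∑ u, ∑ v, m u v * (z u * w v) ≤ T)
    {x y : Fin n → ℝ} (hx : ∑ i, x i ^ 2 ≤ 4 * n) (hy : ∑ i, y i ^ 2 ≤ 4 * n) :
    ∑ u, ∑ v, m u v * (x u * y v) ≤ 16 / 7 * T := by
  have h1 : (1 : ℝ) ≤ n := by exact_mod_cast hn
  set Q : (Fin n → ℝ) → (Fin n → ℝ) → ℝ := fun x y => ∑ u, ∑ v, m u v * (x u * y v) with hQ
  set K : Set (Fin n → ℝ) := {x | ∑ i, x i ^ 2 ≤ 4 * n} with hK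
  have hKc : IsCompact K := by
    refine (isCompact_Icc (a := fun _ : Fin n => -(4 * n : ℝ)) (b := fun _ => 4 * n)).of_isClosed_subset
      (isClosed_le (by fun_prop) continuous_const) fun x hx => ?_
    have h2 : ∀ i, x i ^ 2 ≤ 4 * n := fun i =>
      (Finset.single_le_sum (f := fun i => x i ^ 2) (fun i _ => sq_nonneg _)
        (Finset.mem_univ i)).trans hx
    exact ⟨fun i => by have := h2 i; nlinarith, fun i => by have := h2 i; nlinarith⟩
  -- Rounding the coordinates leaves a remainder of squared norm at most n/4, so four times the
  -- remainder is in K again. The rounded point has squared norm at most 25n/4, so it lies in the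
  -- lattice ball, and 4/5 of it lies in K.
  have hround : ∀ x ∈ K, ∃ z ∈ latticeBall n,
      (fun i => 4 / 5 * (z i : ℝ)) ∈ K ∧ (fun i => 4 * (x i - z i)) ∈ K := by
    intro x hx
    have hx' : ∑ i, x i ^ 2 ≤ 4 * n := hx
    have hr : ∀ i, (x i - round (x i)) ^ 2 ≤ 1 / 4 := fun i => by
      have := abs_le.1 (abs_sub_round (x i))
      nlinarith
    have hz : ∀ i, (round (x i) : ℝ) ^ 2 ≤ 5 / 4 * x i ^ 2 + 5 / 4 := fun i => by
      have := hr i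
      nlinarith [sq_nonneg (x i / 2 + 2 * (x i - round (x i)))]
    have hzs : ∑ i, (round (x i) : ℝ) ^ 2 ≤ 25 / 4 * n := by
      calc ∑ i, (round (x i) : ℝ) ^ 2 ≤ ∑ i, (5 / 4 * x i ^ 2 + 5 / 4) :=
            Finset.sum_le_sum fun i _ => hz i
        _ = 5 / 4 * ∑ i, x i ^ 2 + n * (5 / 4) := by
            rw [Finset.sum_add_distrib, ← Finset.mul_sum]; simp
        _ ≤ _ := by linarith
    refine ⟨fun i => round (x i), ?_, ?_, ?_⟩
    · rw [mem_latticeBall]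
      have : ((∑ i, round (x i) ^ 2 : ℤ) : ℝ) ≤ ((7 * n : ℤ) : ℝ) := by
        push_cast
        linarith
      exact_mod_cast this
    · simp only [hK, Set.mem_ofPred_eq, mul_pow, ← Finset.mul_sum]
      linarith
    · simp only [hK, Set.mem_ofPred_eq, mul_pow, ← Finset.mul_sum]
      have : ∑ i, (x i - round (x i)) ^ 2 ≤ ∑ _i : Fin n, (1 / 4 : ℝ) :=
        Finset.sum_le_sum fun i _ => hr i
      simp at this
      linarith
  have hcont : Continuous fun p : (Fin n → ℝ) × (Fin n → ℝ) => Q p.1 p.2 := by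
    simp only [hQ]
    fun_prop
  obtain ⟨⟨a, b⟩, ⟨ha, hb⟩, hmax⟩ :=
    (hKc.prod hKc).exists_isMaxOn ⟨(x, y), hx, hy⟩ hcont.continuousOn
  have hmax' : ∀ x ∈ K, ∀ y ∈ K, Q x y ≤ Q a b := fun x hx y hy => hmax (a := (x, y)) ⟨hx, hy⟩
  obtain ⟨z, hz, hz1, hz2⟩ := hround a ha
  obtain ⟨w, hw, hw1, hw2⟩ := hround b hb
  -- At a maximizing pair, Q(a,b) = Q(z,w) + Q(z, b - w) + Q(a - z, b). After scaling the last two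
  -- terms back into K, the maximum M satisfies M ≤ T + (5/16 + 1/4)M, that is M ≤ 16T/7.
  have e : Q a b = ∑ u, ∑ v, m u v * (z u * w v) +
      5 / 16 * Q (fun i => 4 / 5 * (z i : ℝ)) (fun i => 4 * (b i - w i)) +
      1 / 4 * Q (fun i => 4 * (a i - z i)) b := by
    simp only [hQ, Finset.mul_sum, ← Finset.sum_add_distrib]
    refine Finset.sum_congr rfl fun u _ => Finset.sum_congr rfl fun v _ => ?_
    ring
  have i1 := hT z hz w hw
  have i2 := hmax' _ hz1 _ hw2
  have i3 := hmax' _ hz2 b hb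
  have i4 := hmax' x hx y hy
  linarith

end PlantedIndepSet

namespace PlantedIndepSet

open MeasureTheory ProbabilityTheory

/-! ### Typical boundary edges -/

open Classical in
/-- The properties of the random boundary edges that are used: no vertex outside `S` has few
neighbours in `S`, and the signed adjacency matrix has small norm. -/
structure GoodEdges {n : ℕ} (S : Finset (Fin n)) (E : Set (Fin n × Fin n)) : Prop where
  deg : ∀ w ∉ S, S.card < 4 * (S.filter fun u => (u, w) ∈ E).card
  spectral : ∀ x y : Fin n → ℝ, ∑ u ∈ S, ∑ v ∈ Sᶜ, sgn E (u, v) * (x u * y v) ≤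
    26 * √n * (√(∑ u ∈ S, x u ^ 2) * √(∑ v ∈ Sᶜ, y v ^ 2))

theorem boundaryLaw_eq {n : ℕ} (S : Finset (Fin n)) : boundaryLaw S = halfLaw (S ×ˢ Sᶜ) := by
  simp [boundaryLaw, halfLaw]

-- Exponential Markov inequality with the factor 6/5 for each vertex of S and 1/2 for each edge to
-- w: if at most a quarter of the edges are present, the product is at least 1, because (6/5)⁴/2 >
-- 1. Its mean per vertex of S is (6/5)(3/4) = 9/10.
open Classical in
theorem boundaryLaw_deg_le {n : ℕ} (S : Finset (Fin n)) {w : Fin n} (hw : w ∉ S) :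
    (boundaryLaw S).real {E | 4 * (S.filter fun u => (u, w) ∈ E).card ≤ S.card} ≤
      (9 / 10 : ℝ) ^ S.card := by
  rw [boundaryLaw_eq]
  refine (halfLaw_real_le_prod _ _ (fun i => if i.2 = w then 1 / 2 else 1) (fun _ => 1)
    (fun i => by split_ifs <;> norm_num) (fun _ => zero_le_one)
    (by positivity : (0 : ℝ) ≤ (6 / 5) ^ S.card) fun s hs hA => ?_).trans_eq ?_
  · have hA' : 4 * (S.filter fun u => (u, w) ∈ s).card ≤ S.card := by
      simpa using hA
    have h1 : (s.filter fun i => i.2 = w).card = (S.filter fun u => (u, w) ∈ s).card := by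
      symm
      refine Finset.card_bij (fun u _ => (u, w)) ?_ ?_ ?_
      · intro u hu; simpa using (Finset.mem_filter.1 hu).2
      · intro u _ u' _ h; simpa using h
      · rintro ⟨u, v⟩ h
        obtain ⟨h2, rfl⟩ := Finset.mem_filter.1 h
        have h3 := (Finset.mem_product.1 (hs h2)).1
        exact ⟨u, Finset.mem_filter.2 ⟨h3, h2⟩, rfl⟩
    rw [Finset.prod_const_one, mul_one, Finset.prod_ite, Finset.prod_const, Finset.prod_const_one,
      mul_one, h1]
    set d := (S.filter fun u => (u, w) ∈ s).card
    calc (1 : ℝ) ≤ ((6 / 5 : ℝ) ^ 4 * (1 / 2)) ^ d := one_le_pow₀ (by norm_num)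
      _ = (6 / 5 : ℝ) ^ (4 * d) * (1 / 2) ^ d := by rw [mul_pow, ← pow_mul]
      _ ≤ _ := by gcongr; norm_num
  · rw [Finset.prod_product]
    have h : ∀ u ∈ S, ∏ v ∈ Sᶜ, ((if (u, v).2 = w then (1 / 2 : ℝ) else 1) + 1) / 2 = 3 / 4 := by
      intro u _
      have : ∀ v ∈ Sᶜ, ((if (u, v).2 = w then (1 / 2 : ℝ) else 1) + 1) / 2 =
          if v = w then 3 / 4 else 1 := by
        intro v _
        split_ifs <;> norm_num
      rw [Finset.prod_congr rfl this, Finset.prod_ite_eq', if_pos (by simpa using hw)]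
    rw [Finset.prod_congr rfl h, Finset.prod_const, ← mul_pow]
    norm_num

/-- Hoeffding's inequality with the optimal scaling σ = 45/(49√n): the variance term is at most half
of σ·45n√n = (2025/49)n, leaving the exponent -(2025/98)n ≤ -20n. This beats the e^{18n} pairs of
lattice points in the union bound. -/
theorem boundaryLaw_bilin_le {n : ℕ} (hn : 1 ≤ n) (S : Finset (Fin n)) {z w : Fin n → ℤ}
    (hz : z ∈ latticeBall n) (hw : w ∈ latticeBall n) :
    (boundaryLaw S).real
      {E | 45 * n * √n ≤ ∑ u ∈ S, ∑ v ∈ Sᶜ, sgn E (u, v) * ((z u : ℝ) * w v)} ≤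
      Real.exp (-(20 * n)) := by
  have hn0 : (0 : ℝ) < n := by exact_mod_cast hn
  set r := √(n : ℝ) with hr
  have hr0 : 0 < r := Real.sqrt_pos.2 hn0
  have hrr : r * r = n := Real.mul_self_sqrt hn0.le
  set σ : ℝ := 45 / (49 * r) with hσ
  have hσ0 : 0 < σ := by positivity
  rw [boundaryLaw_eq]
  have hset : {E | 45 * n * r ≤ ∑ u ∈ S, ∑ v ∈ Sᶜ, sgn E (u, v) * ((z u : ℝ) * w v)} ⊆
      {E | 2025 / 49 * (n : ℝ) ≤ ∑ i ∈ S ×ˢ Sᶜ, sgn E i * (σ * ((z i.1 : ℝ) * w i.2))} := by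
    intro E hE
    have hE' : 45 * n * r ≤ ∑ u ∈ S, ∑ v ∈ Sᶜ, sgn E (u, v) * ((z u : ℝ) * w v) := hE
    have e1 : ∑ i ∈ S ×ˢ Sᶜ, sgn E i * (σ * ((z i.1 : ℝ) * w i.2)) =
        σ * ∑ u ∈ S, ∑ v ∈ Sᶜ, sgn E (u, v) * ((z u : ℝ) * w v) := by
      rw [Finset.sum_product, Finset.mul_sum]
      refine Finset.sum_congr rfl fun u _ => ?_
      rw [Finset.mul_sum]
      refine Finset.sum_congr rfl fun v _ => ?_
      ring
    have e2 : σ * (45 * n * r) = 2025 / 49 * n := by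
      rw [hσ]; field_simp; norm_num
    change 2025 / 49 * (n : ℝ) ≤ _
    rw [e1, ← e2]
    exact mul_le_mul_of_nonneg_left hE' hσ0.le
  refine (measureReal_mono hset (measure_ne_top _ _)).trans
    ((halfLaw_real_sum_ge_le _ _ _).trans (Real.exp_le_exp.2 ?_))
  have hsq : ∀ {z : Fin n → ℤ}, z ∈ latticeBall n → ∀ A : Finset (Fin n),
      ∑ u ∈ A, (z u : ℝ) ^ 2 ≤ 7 * n := by
    intro z hz A
    have : ((∑ i, z i ^ 2 : ℤ) : ℝ) ≤ ((7 * n : ℤ) : ℝ) := by exact_mod_cast mem_latticeBall.1 hz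
    push_cast at this
    exact (Finset.sum_le_sum_of_subset_of_nonneg (Finset.subset_univ A)
      fun i _ _ => sq_nonneg _).trans this
  have e3 : ∑ i ∈ S ×ˢ Sᶜ, (σ * ((z i.1 : ℝ) * w i.2)) ^ 2 =
      σ ^ 2 * ((∑ u ∈ S, (z u : ℝ) ^ 2) * ∑ v ∈ Sᶜ, (w v : ℝ) ^ 2) := by
    rw [Finset.sum_product, Finset.sum_mul_sum, Finset.mul_sum]
    refine Finset.sum_congr rfl fun u _ => ?_
    rw [Finset.mul_sum]
    refine Finset.sum_congr rfl fun v _ => ?_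
    ring
  have e4 : (∑ u ∈ S, (z u : ℝ) ^ 2) * ∑ v ∈ Sᶜ, (w v : ℝ) ^ 2 ≤ (7 * n) * (7 * n) :=
    mul_le_mul (hsq hz S) (hsq hw Sᶜ) (Finset.sum_nonneg fun i _ => sq_nonneg _) (by positivity)
  have e5 : σ ^ 2 * ((7 * n) * (7 * n)) = 2025 / 49 * n := by
    rw [hσ, ← hrr]; field_simp; norm_num
  have e6 := mul_le_mul_of_nonneg_left e4 (sq_nonneg σ)
  rw [e3]
  linarith

/-- By homogeneity both vectors may be scaled to norm 2√n, where the bound from lattice points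
applies; the constant is (16/7)·45/4 < 26. -/
theorem spectral_of_latticeBall {n : ℕ} (hn : 1 ≤ n) (S : Finset (Fin n))
    (E : Set (Fin n × Fin n))
    (h : ∀ z ∈ latticeBall n, ∀ w ∈ latticeBall n,
      ∑ u ∈ S, ∑ v ∈ Sᶜ, sgn E (u, v) * ((z u : ℝ) * w v) ≤ 45 * n * √n) (x y : Fin n → ℝ) :
    ∑ u ∈ S, ∑ v ∈ Sᶜ, sgn E (u, v) * (x u * y v) ≤
      26 * √n * (√(∑ u ∈ S, x u ^ 2) * √(∑ v ∈ Sᶜ, y v ^ 2)) := by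
  classical
  have hn0 : (0 : ℝ) < n := by exact_mod_cast hn
  set m : Fin n → Fin n → ℝ := fun u v => if u ∈ S then (if v ∈ Sᶜ then sgn E (u, v) else 0) else 0
    with hm
  have hsum : ∀ x y : Fin n → ℝ, ∑ u, ∑ v, m u v * (x u * y v) =
      ∑ u ∈ S, ∑ v ∈ Sᶜ, sgn E (u, v) * (x u * y v) := by
    intro x y
    rw [← Finset.sum_subset (Finset.subset_univ S)]
    · refine Finset.sum_congr rfl fun u hu => ?_
      rw [← Finset.sum_subset (Finset.subset_univ Sᶜ)]
      · refine Finset.sum_congr rfl fun v hv => ?_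
        simp only [hm, if_pos hu, if_pos hv]
      · intro v _ hv
        simp only [hm, if_neg hv, ite_self, zero_mul]
    · intro u _ hu
      simp only [hm, if_neg hu, zero_mul, Finset.sum_const_zero]
  set a := √(∑ u ∈ S, x u ^ 2) with ha
  set b := √(∑ v ∈ Sᶜ, y v ^ 2) with hb
  have ha2 : a ^ 2 = ∑ u ∈ S, x u ^ 2 := Real.sq_sqrt (Finset.sum_nonneg fun i _ => sq_nonneg _)
  have hb2 : b ^ 2 = ∑ v ∈ Sᶜ, y v ^ 2 := Real.sq_sqrt (Finset.sum_nonneg fun i _ => sq_nonneg _)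
  have ha0 : 0 ≤ a := Real.sqrt_nonneg _
  have hb0 : 0 ≤ b := Real.sqrt_nonneg _
  -- A vector that vanishes on its side cannot be normalized, but then the form is zero.
  rcases ha0.eq_or_lt with h0 | ha0
  · rw [← h0] at ha2
    have hx : ∀ u ∈ S, x u = 0 := by
      intro u hu
      have := (Finset.sum_eq_zero_iff_of_nonneg fun i _ => sq_nonneg (x i)).1 (by simpa using ha2.symm) u hu
      simpa using this
    rw [Finset.sum_eq_zero fun u hu => Finset.sum_eq_zero fun v _ => by rw [hx u hu]; ring, ← h0]
    simp
  rcases hb0.eq_or_lt with h0 | hb0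
  · rw [← h0] at hb2
    have hy : ∀ v ∈ Sᶜ, y v = 0 := by
      intro v hv
      have := (Finset.sum_eq_zero_iff_of_nonneg fun i _ => sq_nonneg (y i)).1 (by simpa using hb2.symm) v hv
      simpa using this
    rw [Finset.sum_eq_zero fun u hu => Finset.sum_eq_zero fun v hv => by rw [hy v hv]; ring, ← h0]
    simp
  set r := √(n : ℝ) with hr
  have hr0 : 0 < r := Real.sqrt_pos.2 hn0
  have hrr : r ^ 2 = n := Real.sq_sqrt hn0.le
  set x' : Fin n → ℝ := fun u => if u ∈ S then 2 * r / a * x u else 0 with hx'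
  set y' : Fin n → ℝ := fun v => if v ∈ Sᶜ then 2 * r / b * y v else 0 with hy'
  have hx4 : ∑ u, x' u ^ 2 ≤ 4 * n := by
    have : ∑ u, x' u ^ 2 = (2 * r / a) ^ 2 * ∑ u ∈ S, x u ^ 2 := by
      rw [← Finset.sum_subset (Finset.subset_univ S) fun u _ hu => by simp [hx', hu], Finset.mul_sum]
      exact Finset.sum_congr rfl fun u hu => by simp only [hx', if_pos hu]; ring
    rw [this, ← ha2, ← hrr]
    apply le_of_eq
    field_simp
    norm_num
  have hy4 : ∑ v, y' v ^ 2 ≤ 4 * n := by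
    have : ∑ v, y' v ^ 2 = (2 * r / b) ^ 2 * ∑ v ∈ Sᶜ, y v ^ 2 := by
      rw [← Finset.sum_subset (Finset.subset_univ Sᶜ) fun v _ hv => by simp only [hy', if_neg hv]; simp,
        Finset.mul_sum]
      exact Finset.sum_congr rfl fun v hv => by simp only [hy', if_pos hv]; ring
    rw [this, ← hb2, ← hrr]
    apply le_of_eq
    field_simp
    norm_num
  have key := bilin_le_of_latticeBall hn m (T := 45 * n * r)
    (fun z hz w hw => by rw [hsum]; exact h z hz w hw) hx4 hy4
  rw [hsum] at key
  have e : ∑ u ∈ S, ∑ v ∈ Sᶜ, sgn E (u, v) * (x' u * y' v) =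
      4 * n / (a * b) * ∑ u ∈ S, ∑ v ∈ Sᶜ, sgn E (u, v) * (x u * y v) := by
    rw [Finset.mul_sum]
    refine Finset.sum_congr rfl fun u hu => ?_
    rw [Finset.mul_sum]
    refine Finset.sum_congr rfl fun v hv => ?_
    simp only [hx', hy', if_pos hu, if_pos hv]
    rw [← hrr]
    field_simp
    ring
  rw [e, div_mul_eq_mul_div, div_le_iff₀ (by positivity)] at key
  have h3 : 0 ≤ r * (a * b) := by positivity
  have h4 : (n : ℝ) * (∑ u ∈ S, ∑ v ∈ Sᶜ, sgn E (u, v) * (x u * y v)) ≤ n * (26 * r * (a * b)) := by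
    have : 0 ≤ (n : ℝ) * (r * (a * b)) := by positivity
    nlinarith
  exact le_of_mul_le_mul_left h4 hn0

/-- Typical boundary edges are good. -/
theorem goodEdges_prob {n : ℕ} (hn : 1 ≤ n) (S : Finset (Fin n)) :
    1 - (Real.exp (-n) + n * (9 / 10 : ℝ) ^ S.card) ≤ (boundaryLaw S).real {E | GoodEdges S E} := by
  classical
  have hprob : IsProbabilityMeasure (boundaryLaw S) := by
    unfold boundaryLaw; infer_instance
  set A : Fin n → Set (Set (Fin n × Fin n)) := fun w =>
    {E | 4 * (S.filter fun u => (u, w) ∈ E).card ≤ S.card} with hA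
  set B : (Fin n → ℤ) × (Fin n → ℤ) → Set (Set (Fin n × Fin n)) := fun p =>
    {E | 45 * n * √n ≤ ∑ u ∈ S, ∑ v ∈ Sᶜ, sgn E (u, v) * ((p.1 u : ℝ) * p.2 v)} with hB
  have hcover : (Set.univ : Set (Set (Fin n × Fin n))) ⊆ {E | GoodEdges S E} ∪
      ((⋃ w ∈ Sᶜ, A w) ∪ ⋃ p ∈ latticeBall n ×ˢ latticeBall n, B p) := by
    intro E _
    by_contra hE
    simp only [Set.mem_union, Set.mem_iUnion, not_or, not_exists] at hE
    obtain ⟨h1, h2, h3⟩ := hE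
    refine h1 ⟨fun w hw => ?_, spectral_of_latticeBall hn S E fun z hz w hw => ?_⟩
    · have := h2 w (by simpa using hw)
      simpa [hA] using this
    · have := h3 (z, w) (Finset.mem_product.2 ⟨hz, hw⟩)
      exact (not_le.1 this).le
  have hbadA : (boundaryLaw S).real (⋃ w ∈ Sᶜ, A w) ≤ n * (9 / 10 : ℝ) ^ S.card := by
    refine (measureReal_biUnion_finset_le _ _).trans ?_
    calc ∑ w ∈ Sᶜ, (boundaryLaw S).real (A w) ≤ ∑ _w ∈ Sᶜ, (9 / 10 : ℝ) ^ S.card :=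
          Finset.sum_le_sum fun w hw => boundaryLaw_deg_le S (by simpa using hw)
      _ = Sᶜ.card * (9 / 10 : ℝ) ^ S.card := by simp
      _ ≤ _ := by
        gcongr
        simpa using Finset.card_le_univ Sᶜ
  have hbadB : (boundaryLaw S).real (⋃ p ∈ latticeBall n ×ˢ latticeBall n, B p) ≤
      Real.exp (-n) := by
    refine (measureReal_biUnion_finset_le _ _).trans ?_
    calc ∑ p ∈ latticeBall n ×ˢ latticeBall n, (boundaryLaw S).real (B p)
        ≤ ∑ _p ∈ latticeBall n ×ˢ latticeBall n, Real.exp (-(20 * n)) := by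
          refine Finset.sum_le_sum fun p hp => ?_
          obtain ⟨h1, h2⟩ := Finset.mem_product.1 hp
          exact boundaryLaw_bilin_le hn S h1 h2
      _ = (latticeBall n).card * (latticeBall n).card * Real.exp (-(20 * n)) := by
          simp [Finset.card_product]
      _ ≤ Real.exp (9 * n) * Real.exp (9 * n) * Real.exp (-(20 * n)) := by
          have := card_latticeBall_le n
          gcongr
      _ = Real.exp (-2 * n) := by rw [← Real.exp_add, ← Real.exp_add]; congr 1; ring
      _ ≤ Real.exp (-n) := by
          apply Real.exp_le_exp.2
          have : (0 : ℝ) ≤ n := by positivity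
          linarith
  have h1 : (boundaryLaw S).real Set.univ = 1 := by simp
  have h2 := measureReal_mono hcover (measure_ne_top (boundaryLaw S) _)
  have h3 := measureReal_union_le (μ := boundaryLaw S) {E | GoodEdges S E}
    ((⋃ w ∈ Sᶜ, A w) ∪ ⋃ p ∈ latticeBall n ×ˢ latticeBall n, B p)
  have h4 := measureReal_union_le (μ := boundaryLaw S) (⋃ w ∈ Sᶜ, A w)
    (⋃ p ∈ latticeBall n ×ˢ latticeBall n, B p)
  linarith

end PlantedIndepSet

namespace PlantedIndepSet

/-! ### Recovery of the independent set from nearly optimal vectors -/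

section Recovery

variable {n : ℕ} {F : Type*} [NormedAddCommGroup F] [InnerProductSpace ℝ F]

theorem sum_norm_sub_sq (S : Finset (Fin n)) (x : Fin n → F) :
    ∑ u ∈ S, ∑ v ∈ S, ‖x u - x v‖ ^ 2 =
      2 * (S.card * ∑ u ∈ S, ‖x u‖ ^ 2 - ∑ u ∈ S, ∑ v ∈ S, inner ℝ (x u) (x v)) := by
  simp only [norm_sub_sq_real, Finset.sum_add_distrib, Finset.sum_sub_distrib, Finset.sum_const,
    nsmul_eq_mul, ← Finset.mul_sum]
  ring

/-- If the vectors of `S` are clustered, then one of them is a good centre. -/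
theorem exists_center {G : SimpleGraph (Fin n)} {S : Finset (Fin n)} (hS : S.Nonempty)
    (hdeg : ∀ w ∉ S, ∃ N ⊆ S, S.card < 4 * N.card ∧ ∀ v ∈ N, G.Adj v w) {x : Fin n → F}
    (hnorm : ∀ u, |‖x u‖ ^ 2 - 1| ≤ 1 / 100)
    (hedge : ∀ u v, G.Adj u v → |(inner ℝ (x u) (x v) : ℝ)| ≤ 1 / 100)
    (hsum : ∑ u ∈ S, ∑ v ∈ S, ‖x u - x v‖ ^ 2 ≤ (S.card : ℝ) ^ 2 / 500) :
    ∃ u ∈ S, ∀ A : Finset (Fin n), (∀ v, 6 / 10 ≤ (inner ℝ (x u) (x v) : ℝ) → v ∈ A) →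
      (∀ v ∈ A, 4 / 10 ≤ (inner ℝ (x u) (x v) : ℝ)) →
      A ⊆ S ∧ ∀ w ∉ S, ∃ v ∈ A, G.Adj v w := by
  classical
  have hk : (0 : ℝ) < S.card := by exact_mod_cast hS.card_pos
  -- The centre is a vertex of S whose sum of squared distances is at most the average. By Markov's
  -- inequality at most a fifth of S is farther than 1/10 from it; this is less than the quarter
  -- guaranteed to be adjacent to any outside vertex.
  obtain ⟨u, hu, hu'⟩ : ∃ u ∈ S, ∑ v ∈ S, ‖x u - x v‖ ^ 2 ≤ (S.card : ℝ) / 500 := by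
    refine Finset.exists_le_of_sum_le hS (hsum.trans_eq ?_)
    simp
    ring
  have hfar : ((S.filter fun v => 1 / 100 < ‖x u - x v‖ ^ 2).card : ℝ) ≤ S.card / 5 := by
    have h1 : ((S.filter fun v => 1 / 100 < ‖x u - x v‖ ^ 2).card : ℝ) * (1 / 100) ≤
        ∑ v ∈ S, ‖x u - x v‖ ^ 2 := by
      calc _ = ∑ _v ∈ S.filter fun v => 1 / 100 < ‖x u - x v‖ ^ 2, (1 / 100 : ℝ) := by simp
        _ ≤ ∑ v ∈ S.filter fun v => 1 / 100 < ‖x u - x v‖ ^ 2, ‖x u - x v‖ ^ 2 :=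
          Finset.sum_le_sum fun v hv => (Finset.mem_filter.1 hv).2.le
        _ ≤ _ := Finset.sum_le_sum_of_subset_of_nonneg (Finset.filter_subset _ _)
          fun _ _ _ => sq_nonneg _
    linarith
  have hnear : ∀ w ∉ S, ∃ v, G.Adj v w ∧ ‖x u - x v‖ ^ 2 ≤ 1 / 100 := by
    intro w hw
    obtain ⟨N, hN, hc, hadj⟩ := hdeg w hw
    by_contra! hcon
    have hsub : N ⊆ S.filter fun v => 1 / 100 < ‖x u - x v‖ ^ 2 := fun v hv =>
      Finset.mem_filter.2 ⟨hN hv, hcon v (hadj v hv)⟩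
    have h1 : (N.card : ℝ) ≤ _ := (Nat.cast_le.2 (Finset.card_le_card hsub)).trans hfar
    have h2 : (S.card : ℝ) < 4 * N.card := by exact_mod_cast hc
    linarith
  -- The set A is only pinned down between the thresholds 4/10 and 6/10, so that exact unit balls
  -- and sets read off from rounded entries are covered together.
  refine ⟨u, hu, fun A h1 h2 => ⟨fun w hw => ?_, fun w hw => ?_⟩⟩
  · by_contra hwS
    obtain ⟨v, hvw, hd⟩ := hnear w hwS
    have e1 := hedge v w hvw
    have e2 := h2 w hw
    -- The inner product of w with its neighbour v is at most 1/100, and moving from v to u changes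
    -- it by at most 1/10 · 2, so w stays below 4/10.
    have e3 : (inner ℝ (x u) (x w) : ℝ) = inner ℝ (x v) (x w) + inner ℝ (x u - x v) (x w) := by
      rw [inner_sub_left]; ring
    have e4 := abs_real_inner_le_norm (x u - x v) (x w)
    have e5 : ‖x u - x v‖ ≤ 1 / 10 := by
      have := norm_nonneg (x u - x v)
      nlinarith
    have e6 : ‖x w‖ ≤ 2 := by
      have := (abs_le.1 (hnorm w)).2
      nlinarith [norm_nonneg (x w)]
    have e7 : ‖x u - x v‖ * ‖x w‖ ≤ 1 / 10 * 2 :=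
      mul_le_mul e5 e6 (norm_nonneg _) (by norm_num)
    have e8 := (abs_le.1 e1).2
    have e9 := (abs_le.1 (e4.trans e7)).2
    linarith
  · obtain ⟨v, hvw, hd⟩ := hnear w hw
    refine ⟨v, h1 v ?_, hvw⟩
    have e1 := norm_sub_sq_real (x u) (x v)
    have e2 := (abs_le.1 (hnorm u)).1
    have e3 := (abs_le.1 (hnorm v)).1
    linarith

/-- The inner products between the two sides are small on average. -/
theorem sum_inner_boundary_le {S : Finset (Fin n)} {E : Set (Fin n × Fin n)} (hE : GoodEdges S E)
    {ι : Type*} [Fintype ι] (x : Fin n → EuclideanSpace ℝ ι) {C : ℝ} (hC : 0 ≤ C)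
    (hedge : ∀ u v, u ≠ v → (u, v) ∈ E → |(inner ℝ (x u) (x v) : ℝ)| ≤ C) :
    ∑ u ∈ S, ∑ v ∈ Sᶜ, (inner ℝ (x u) (x v) : ℝ) ≤
      26 * √n * (√(∑ u ∈ S, ‖x u‖ ^ 2) * √(∑ v ∈ Sᶜ, ‖x v‖ ^ 2)) + 2 * n ^ 2 * C := by
  classical
  -- Off E' the sign is 1; on E' the inner product is at most C in absolute value, so reversing its
  -- sign costs at most 2C.
  have h1 : ∀ u ∈ S, ∀ v ∈ Sᶜ, (inner ℝ (x u) (x v) : ℝ) ≤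
      sgn E (u, v) * inner ℝ (x u) (x v) + 2 * C := by
    intro u hu v hv
    unfold sgn
    split_ifs with h
    · have := (abs_le.1 (hedge u v (fun e => (Finset.mem_compl.1 hv) (e ▸ hu)) h)).2
      linarith
    · linarith
  have h2 : ∑ u ∈ S, ∑ v ∈ Sᶜ, sgn E (u, v) * (inner ℝ (x u) (x v) : ℝ) =
      ∑ j : ι, ∑ u ∈ S, ∑ v ∈ Sᶜ, sgn E (u, v) * (x u j * x v j) := by
    symm
    rw [Finset.sum_comm]
    refine Finset.sum_congr rfl fun u _ => ?_
    rw [Finset.sum_comm]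
    refine Finset.sum_congr rfl fun v _ => ?_
    rw [← Finset.mul_sum]
    congr 1
    simp [PiLp.inner_apply, mul_comm]
  have h3 : ∀ A : Finset (Fin n), ∑ u ∈ A, ‖x u‖ ^ 2 = ∑ j : ι, ∑ u ∈ A, x u j ^ 2 := by
    intro A
    rw [Finset.sum_comm]
    refine Finset.sum_congr rfl fun u _ => ?_
    rw [EuclideanSpace.norm_sq_eq]
    simp
  calc ∑ u ∈ S, ∑ v ∈ Sᶜ, (inner ℝ (x u) (x v) : ℝ)
      ≤ ∑ u ∈ S, ∑ v ∈ Sᶜ, (sgn E (u, v) * inner ℝ (x u) (x v) + 2 * C) :=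
        Finset.sum_le_sum fun u hu => Finset.sum_le_sum fun v hv => h1 u hu v hv
    _ = ∑ u ∈ S, ∑ v ∈ Sᶜ, sgn E (u, v) * (inner ℝ (x u) (x v) : ℝ) +
        (S.card : ℝ) * ((Sᶜ).card * (2 * C)) := by
        simp only [Finset.sum_add_distrib, Finset.sum_const, nsmul_eq_mul]
    _ ≤ _ := by
        refine add_le_add ?_ ?_
        · rw [h2, h3, h3]
          -- The scalar norm bound is applied in each coordinate of the vectors, and Cauchy-Schwarz
          -- recombines the coordinates.
          calc ∑ j : ι, ∑ u ∈ S, ∑ v ∈ Sᶜ, sgn E (u, v) * (x u j * x v j)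
              ≤ ∑ j : ι, 26 * √n * (√(∑ u ∈ S, x u j ^ 2) * √(∑ v ∈ Sᶜ, x v j ^ 2)) :=
                Finset.sum_le_sum fun j _ => hE.spectral (fun u => x u j) (fun v => x v j)
            _ = 26 * √n * ∑ j : ι, √(∑ u ∈ S, x u j ^ 2) * √(∑ v ∈ Sᶜ, x v j ^ 2) := by
                rw [Finset.mul_sum]
            _ ≤ _ := by
                refine mul_le_mul_of_nonneg_left ?_ (by positivity)
                exact Real.sum_sqrt_mul_sqrt_le _ (fun j => Finset.sum_nonneg fun _ _ => sq_nonneg _)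
                  (fun j => Finset.sum_nonneg fun _ _ => sq_nonneg _)
        · have a1 : (S.card : ℝ) ≤ n := by exact_mod_cast (by simpa using S.card_le_univ)
          have a2 : ((Sᶜ).card : ℝ) ≤ n := by exact_mod_cast (by simpa using (Sᶜ).card_le_univ)
          calc (S.card : ℝ) * ((Sᶜ).card * (2 * C)) ≤ n * (n * (2 * C)) := by gcongr
            _ = _ := by ring

/-- The size condition in a convenient form. -/
theorem size_condition {k : ℕ} (hn : 1 ≤ n) (hk : (10 : ℝ) ^ 4 * (n : ℝ) ^ (2 / 3 : ℝ) ≤ k)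
    (hkn : k ≤ n) :
    (10 : ℝ) ^ 6 * n ≤ k * √k ∧ (10 : ℝ) ^ 4 ≤ k ∧ (10 : ℝ) ^ 4 ≤ n := by
  have hn1 : (1 : ℝ) ≤ n := by exact_mod_cast hn
  have h1 : (1 : ℝ) ≤ (n : ℝ) ^ (2 / 3 : ℝ) := Real.one_le_rpow hn1 (by norm_num)
  have h2 : (10 : ℝ) ^ 4 ≤ k := by nlinarith
  have h3 : (k : ℝ) ≤ n := by exact_mod_cast hkn
  refine ⟨?_, h2, h2.trans h3⟩
  have h4 : ((10 : ℝ) ^ 4 * (n : ℝ) ^ (2 / 3 : ℝ)) ^ (3 / 2 : ℝ) ≤ (k : ℝ) ^ (3 / 2 : ℝ) := by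
    gcongr
  have h5 : ((10 : ℝ) ^ 4 * (n : ℝ) ^ (2 / 3 : ℝ)) ^ (3 / 2 : ℝ) = 10 ^ 6 * n := by
    rw [Real.mul_rpow (by positivity) (by positivity), ← Real.rpow_mul (by positivity),
      ← Real.rpow_natCast, ← Real.rpow_mul (by norm_num)]
    norm_num
  have h6 : (k : ℝ) ^ (3 / 2 : ℝ) = k * √k := by
    rw [Real.sqrt_eq_rpow, show (3 / 2 : ℝ) = 1 + 1 / 2 by norm_num,
      Real.rpow_add (by linarith), Real.rpow_one]
  rw [h5, h6] at h4
  exact h4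

/-- Clustering, from near optimality against the solution in which the vectors of `S` are merged. -/
theorem sum_norm_sub_sq_le {S : Finset (Fin n)} {E : Set (Fin n × Fin n)} (hE : GoodEdges S E)
    (hn : 1 ≤ n) (hk : (10 : ℝ) ^ 4 * (n : ℝ) ^ (2 / 3 : ℝ) ≤ S.card)
    {ι : Type*} [Fintype ι] (x : Fin n → EuclideanSpace ℝ ι) {C : ℝ} (hC : 0 ≤ C)
    (hCn : n ^ 2 * C ≤ n)
    (hnorm : ∀ u, |‖x u‖ ^ 2 - 1| ≤ 1 / 100)
    (hedge : ∀ u v, u ≠ v → (u, v) ∈ E → |(inner ℝ (x u) (x v) : ℝ)| ≤ C)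
    (hopt : S.card * ∑ u ∈ S, ‖x u‖ ^ 2 - ∑ u ∈ S, ∑ v ∈ S, (inner ℝ (x u) (x v) : ℝ) ≤
      2 * ∑ u ∈ S, ∑ v ∈ Sᶜ, (inner ℝ (x u) (x v) : ℝ) + 1) :
    ∑ u ∈ S, ∑ v ∈ S, ‖x u - x v‖ ^ 2 ≤ (S.card : ℝ) ^ 2 / 500 := by
  have hcard : S.card ≤ n := by simpa using S.card_le_univ
  obtain ⟨h1, h2, h3⟩ := size_condition hn hk hcard
  have hb := sum_inner_boundary_le hE x hC hedge
  have hA : ∀ A : Finset (Fin n), ∑ u ∈ A, ‖x u‖ ^ 2 ≤ 2 * A.card := by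
    intro A
    calc ∑ u ∈ A, ‖x u‖ ^ 2 ≤ ∑ _u ∈ A, (2 : ℝ) :=
          Finset.sum_le_sum fun u _ => by linarith [(abs_le.1 (hnorm u)).2]
      _ = _ := by simp [mul_comm]
  set k : ℝ := (S.card : ℝ) with hkdef
  have hk0 : 0 ≤ k := by positivity
  have hn0 : (0 : ℝ) ≤ n := by positivity
  have hsq : √(∑ u ∈ S, ‖x u‖ ^ 2) * √(∑ v ∈ Sᶜ, ‖x v‖ ^ 2) ≤ 2 * (√k * √n) := by
    have a1 : √(∑ u ∈ S, ‖x u‖ ^ 2) ≤ √(2 * k) := Real.sqrt_le_sqrt (hA S)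
    have a2 : √(∑ v ∈ Sᶜ, ‖x v‖ ^ 2) ≤ √(2 * n) := by
      refine Real.sqrt_le_sqrt ((hA Sᶜ).trans ?_)
      have : ((Sᶜ).card : ℝ) ≤ n := by exact_mod_cast (by simpa using (Sᶜ).card_le_univ)
      linarith
    calc _ ≤ √(2 * k) * √(2 * n) := mul_le_mul a1 a2 (Real.sqrt_nonneg _) (Real.sqrt_nonneg _)
      _ = √2 * √2 * (√k * √n) := by
        rw [Real.sqrt_mul (by norm_num), Real.sqrt_mul (by norm_num)]; ring
      _ = _ := by rw [Real.mul_self_sqrt (by norm_num)]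
  have hb2 : ∑ u ∈ S, ∑ v ∈ Sᶜ, (inner ℝ (x u) (x v) : ℝ) ≤ 52 * (n * √k) + 2 * n := by
    have : 26 * √n * (√(∑ u ∈ S, ‖x u‖ ^ 2) * √(∑ v ∈ Sᶜ, ‖x v‖ ^ 2)) ≤
        26 * √n * (2 * (√k * √n)) := mul_le_mul_of_nonneg_left hsq (by positivity)
    have e : 26 * √n * (2 * (√k * √n)) = 52 * (n * √k) := by
      nlinarith [Real.mul_self_sqrt hn0]
    linarith
  have hs1 : 100 ≤ √k := by
    apply Real.le_sqrt_of_sq_le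
    linarith
  have hss : √k * √k = k := Real.mul_self_sqrt hk0
  -- The decisive use of the size condition: the boundary sum is of order n√k, and n√k is small
  -- against k² exactly when k is large compared with n^{2/3}.
  have h4 : 10 ^ 6 * (n * √k) ≤ k ^ 2 := by
    have := mul_le_mul_of_nonneg_right h1 (Real.sqrt_nonneg k)
    nlinarith
  have h5 : (n : ℝ) * 100 ≤ n * √k := mul_le_mul_of_nonneg_left hs1 hn0
  rw [sum_norm_sub_sq]
  linarith

end Recovery

-- A vertex outside S is blocked by A from the beginning, and a vertex of S is never blocked because
-- the set built so far stays inside the independent set S. The order is therefore immaterial.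
open Classical in
theorem greedyExtend_eq {n : ℕ} {G : SimpleGraph (Fin n)} {S A : Finset (Fin n)}
    (hind : G.IsIndepSet (S : Set (Fin n))) (hA : A ⊆ S) (hdom : ∀ w ∉ S, ∃ v ∈ A, G.Adj v w)
    {l : List (Fin n)} (hl : ∀ v ∈ S, v ∈ l) : greedyExtend G l A = S := by
  have key : ∀ (l : List (Fin n)) (B : Finset (Fin n)), A ⊆ B → B ⊆ S →
      greedyExtend G l B ⊆ S ∧ B ⊆ greedyExtend G l B ∧ ∀ v ∈ S, v ∈ l → v ∈ greedyExtend G l B := by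
    intro l
    induction l with
    | nil => intro B _ hB; exact ⟨hB, subset_rfl, by simp⟩
    | cons a l ih =>
      intro B hAB hBS
      have hind' : ∀ v ∈ S, ∀ w ∈ B, ¬ G.Adj w v := by
        intro v hv w hw hadj
        exact hind (hBS hw) hv hadj.ne hadj
      by_cases ha : ∀ w ∈ B, ¬ G.Adj w a
      · have haS : a ∈ S := by
          by_contra haS
          obtain ⟨v, hv, hadj⟩ := hdom a haS
          exact ha v (hAB hv) hadj
        have e : greedyExtend G (a :: l) B = greedyExtend G l (insert a B) := by
          simp only [greedyExtend, List.foldl_cons, if_pos ha]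
        obtain ⟨i1, i2, i3⟩ := ih (insert a B) (hAB.trans (Finset.subset_insert _ _))
          (Finset.insert_subset haS hBS)
        rw [e]
        refine ⟨i1, (Finset.subset_insert _ _).trans i2, fun v hv hvl => ?_⟩
        rcases List.mem_cons.1 hvl with rfl | hvl
        · exact i2 (Finset.mem_insert_self _ _)
        · exact i3 v hv hvl
      · have e : greedyExtend G (a :: l) B = greedyExtend G l B := by
          simp only [greedyExtend, List.foldl_cons, if_neg ha]
        obtain ⟨i1, i2, i3⟩ := ih B hAB hBS
        rw [e]
        refine ⟨i1, i2, fun v hv hvl => ?_⟩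
        rcases List.mem_cons.1 hvl with rfl | hvl
        · exact absurd (hind' v hv) ha
        · exact i3 v hv hvl
  obtain ⟨i1, -, i3⟩ := key l A subset_rfl hA
  exact Finset.Subset.antisymm i1 fun v hv => i3 v hv (hl v hv)

theorem Admissible.adj {n : ℕ} {S : Finset (Fin n)} {E : Set (Fin n × Fin n)}
    {G : SimpleGraph (Fin n)} (h : Admissible S E G) {u v : Fin n} (huv : u ≠ v)
    (hE : (u, v) ∈ E) : G.Adj u v :=
  h.1 (by simp [graphOf, huv, hE])

theorem GoodEdges.exists_nbrs {n : ℕ} {S : Finset (Fin n)} {E : Set (Fin n × Fin n)}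
    (hE : GoodEdges S E) {G : SimpleGraph (Fin n)} (h : Admissible S E G) :
    ∀ w ∉ S, ∃ N ⊆ S, S.card < 4 * N.card ∧ ∀ v ∈ N, G.Adj v w := by
  classical
  intro w hw
  refine ⟨S.filter fun u => (u, w) ∈ E, Finset.filter_subset _ _, ?_, fun v hv => ?_⟩
  · convert hE.deg w hw
  · obtain ⟨h1, h2⟩ := Finset.mem_filter.1 hv
    exact h.adj (fun e => hw (e ▸ h1)) h2

end PlantedIndepSet

namespace PlantedIndepSet

open Matrix

/-! ### The crude semidefinite program -/

theorem sum_sum_split {n : ℕ} (S : Finset (Fin n)) (f : Fin n → Fin n → ℝ) :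
    ∑ u, ∑ v, f u v = ∑ u ∈ S, ∑ v ∈ S, f u v + ∑ u ∈ S, ∑ v ∈ Sᶜ, f u v +
      (∑ u ∈ Sᶜ, ∑ v ∈ S, f u v + ∑ u ∈ Sᶜ, ∑ v ∈ Sᶜ, f u v) := by
  rw [← Finset.sum_add_sum_compl S]
  simp only [← Finset.sum_add_distrib, Finset.sum_add_sum_compl]

theorem sum_sum_split_symm {n : ℕ} (S : Finset (Fin n)) (f : Fin n → Fin n → ℝ)
    (hf : ∀ u v, f u v = f v u) :
    ∑ u, ∑ v, f u v = ∑ u ∈ S, ∑ v ∈ S, f u v + 2 * ∑ u ∈ S, ∑ v ∈ Sᶜ, f u v +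
      ∑ u ∈ Sᶜ, ∑ v ∈ Sᶜ, f u v := by
  have h : ∑ u ∈ Sᶜ, ∑ v ∈ S, f u v = ∑ u ∈ S, ∑ v ∈ Sᶜ, f u v := by
    rw [Finset.sum_comm]
    exact Finset.sum_congr rfl fun u _ => Finset.sum_congr rfl fun v _ => hf v u
  rw [sum_sum_split S, h]
  ring

theorem continuous_cost (n : ℕ) :
    Continuous (cost : (Fin n → EuclideanSpace ℝ (Fin n)) → ℝ) := by
  unfold cost
  fun_prop

/-- The feasible set is compact, and the standard basis is feasible for every graph. -/
theorem exists_isOptimal (n : ℕ) (G : SimpleGraph (Fin n)) : ∃ x, IsOptimal G x := by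
  set K : Set (Fin n → EuclideanSpace ℝ (Fin n)) := {x | IsFeasible G x} with hK
  have hKeq : K = (⋂ u, {x | ‖x u‖ = 1}) ∩ ((⋂ u, ⋂ v, {x | (0 : ℝ) ≤ inner ℝ (x u) (x v)}) ∩
      ⋂ u, ⋂ v, ⋂ (_ : G.Adj u v), {x | (inner ℝ (x u) (x v) : ℝ) = 0}) := by
    ext x
    simp only [hK, Set.mem_inter_iff, Set.mem_iInter, Set.mem_ofPred_eq]
    exact ⟨fun h => ⟨h.1, h.2, h.3⟩, fun h => ⟨h.1, h.2.1, h.2.2⟩⟩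
  have hclosed : IsClosed K := by
    rw [hKeq]
    refine (isClosed_iInter fun u => isClosed_eq (by fun_prop) continuous_const).inter
      ((isClosed_iInter fun u => isClosed_iInter fun v =>
        isClosed_le continuous_const (by fun_prop)).inter
      (isClosed_iInter fun u => isClosed_iInter fun v => isClosed_iInter fun _ =>
        isClosed_eq (by fun_prop) continuous_const))
  have hcompact : IsCompact K := by
    refine (isCompact_closedBall (0 : Fin n → EuclideanSpace ℝ (Fin n)) 1).of_isClosed_subset
      hclosed fun x hx => ?_
    rw [mem_closedBall_zero_iff, pi_norm_le_iff_of_nonneg zero_le_one]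
    exact fun u => (hx.norm_eq_one u).le
  have hne : K.Nonempty := by
    refine ⟨fun u => EuclideanSpace.single u 1, fun u => by simp, fun u v => ?_, fun u v h => ?_⟩
    · simp only [EuclideanSpace.inner_single_left, PiLp.single_apply]
      split_ifs <;> simp
    · simp [EuclideanSpace.inner_single_left, h.ne]
  obtain ⟨x, hx, hmin⟩ := hcompact.exists_isMinOn hne (continuous_cost n).continuousOn
  exact ⟨x, hx, fun y hy => hmin hy⟩

/-- Fewer than n vectors do not span the space. This is why the merged solution fits in dimension n:
merging a nonempty S leaves at most n - 1 other vectors. -/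
theorem exists_unit_orthogonal {n : ℕ} {A : Finset (Fin n)} (hA : A.card < n)
    (x : Fin n → EuclideanSpace ℝ (Fin n)) :
    ∃ e : EuclideanSpace ℝ (Fin n), ‖e‖ = 1 ∧ ∀ v ∈ A, (inner ℝ (x v) e : ℝ) = 0 := by
  classical
  set K := Submodule.span ℝ ((A.image x : Finset _) : Set (EuclideanSpace ℝ (Fin n))) with hK
  have h1 : Module.finrank ℝ K ≤ A.card :=
    (finrank_span_finset_le_card (A.image x)).trans Finset.card_image_le
  have h2 := K.finrank_add_finrank_orthogonal
  rw [finrank_euclideanSpace_fin] at h2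
  have h3 : Kᗮ ≠ ⊥ := by
    intro h
    rw [h, finrank_bot] at h2
    omega
  obtain ⟨e, he, he0⟩ := Submodule.exists_mem_ne_zero_of_ne_bot h3
  refine ⟨(‖e‖⁻¹ : ℝ) • e, ?_, fun v hv => ?_⟩
  · rw [norm_smul, norm_inv, norm_norm, inv_mul_cancel₀ (norm_ne_zero_iff.2 he0)]
  · rw [inner_smul_right, (Submodule.mem_orthogonal K e).1 he (x v) (Submodule.subset_span (by
      simpa using ⟨v, hv, rfl⟩)), mul_zero]

theorem cost_eq {n : ℕ} {G : SimpleGraph (Fin n)} {x : Fin n → EuclideanSpace ℝ (Fin n)}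
    (hx : IsFeasible G x) :
    cost x = 2 * ((n : ℝ) * n - ∑ u, ∑ v, (inner ℝ (x u) (x v) : ℝ)) := by
  rw [cost, sum_norm_sub_sq]
  simp [hx.norm_eq_one]

section

variable {n : ℕ} {S : Finset (Fin n)} {E : Set (Fin n × Fin n)} {G : SimpleGraph (Fin n)}

/-- The competitor places all of S at one unit vector orthogonal to the rest. It is feasible for any
edges that an adversary may add, as S is independent, and the terms inside the complement of S
cancel in the comparison. -/
theorem IsOptimal.sum_le {x : Fin n → EuclideanSpace ℝ (Fin n)} (hx : IsOptimal G x)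
    (hS : S.Nonempty) (hind : G.IsIndepSet (S : Set (Fin n))) :
    (S.card : ℝ) * S.card - ∑ u ∈ S, ∑ v ∈ S, (inner ℝ (x u) (x v) : ℝ) ≤
      2 * ∑ u ∈ S, ∑ v ∈ Sᶜ, (inner ℝ (x u) (x v) : ℝ) := by
  classical
  have hc : (Sᶜ).card < n := by
    have h1 := S.card_add_card_compl
    have h2 := hS.card_pos
    rw [Fintype.card_fin] at h1
    omega
  obtain ⟨e, he, heo⟩ := exists_unit_orthogonal hc x
  set y : Fin n → EuclideanSpace ℝ (Fin n) := fun u => if u ∈ S then e else x u with hy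
  have hyS : ∀ u ∈ S, y u = e := fun u hu => by simp [hy, hu]
  have hyC : ∀ u ∉ S, y u = x u := fun u hu => by simp [hy, hu]
  have hee : (inner ℝ e e : ℝ) = 1 := by rw [real_inner_self_eq_norm_sq, he]; norm_num
  have heo' : ∀ v ∉ S, (inner ℝ e (x v) : ℝ) = 0 := fun v hv => by
    rw [real_inner_comm]; exact heo v (by simpa using hv)
  have hyf : IsFeasible G y := by
    refine ⟨fun u => ?_, fun u v => ?_, fun u v huv => ?_⟩
    · by_cases hu : u ∈ S
      · rw [hyS u hu, he]
      · rw [hyC u hu, hx.1.norm_eq_one]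
    · by_cases hu : u ∈ S <;> by_cases hv : v ∈ S
      · rw [hyS u hu, hyS v hv, hee]; norm_num
      · rw [hyS u hu, hyC v hv, heo' v hv]
      · rw [hyC u hu, hyS v hv, real_inner_comm, heo' u hu]
      · rw [hyC u hu, hyC v hv]; exact hx.1.inner_nonneg u v
    · by_cases hu : u ∈ S <;> by_cases hv : v ∈ S
      · exact absurd huv (hind hu hv huv.ne)
      · rw [hyS u hu, hyC v hv, heo' v hv]
      · rw [hyC u hu, hyS v hv, real_inner_comm, heo' u hu]
      · rw [hyC u hu, hyC v hv]; exact hx.1.inner_eq_zero u v huv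
  have hcost := hx.2 y hyf
  rw [cost_eq hx.1, cost_eq hyf,
    sum_sum_split_symm S (fun u v => (inner ℝ (x u) (x v) : ℝ)) fun u v => real_inner_comm _ _,
    sum_sum_split_symm S (fun u v => (inner ℝ (y u) (y v) : ℝ)) fun u v => real_inner_comm _ _]
    at hcost
  have e1 : ∑ u ∈ S, ∑ v ∈ S, (inner ℝ (y u) (y v) : ℝ) = S.card * S.card := by
    rw [Finset.sum_congr rfl fun u hu => Finset.sum_congr rfl fun v hv => by
      rw [hyS u hu, hyS v hv, hee]]
    simp
  have e2 : ∑ u ∈ S, ∑ v ∈ Sᶜ, (inner ℝ (y u) (y v) : ℝ) = 0 :=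
    Finset.sum_eq_zero fun u hu => Finset.sum_eq_zero fun v hv => by
      have hv' : v ∉ S := by simpa using hv
      rw [hyS u hu, hyC v hv', heo' v hv']
  have e3 : ∑ u ∈ Sᶜ, ∑ v ∈ Sᶜ, (inner ℝ (y u) (y v) : ℝ) =
      ∑ u ∈ Sᶜ, ∑ v ∈ Sᶜ, (inner ℝ (x u) (x v) : ℝ) :=
    Finset.sum_congr rfl fun u hu => Finset.sum_congr rfl fun v hv => by
      rw [hyC u (by simpa using hu), hyC v (by simpa using hv)]
  rw [e1, e2, e3] at hcost
  linarith

/-- Every optimal solution of the crude semidefinite program reveals `S`. -/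
theorem mem_candidates (hn : 1 ≤ n) (hk : (10 : ℝ) ^ 4 * (n : ℝ) ^ (2 / 3 : ℝ) ≤ S.card)
    (hE : GoodEdges S E) (hG : Admissible S E G) {x : Fin n → EuclideanSpace ℝ (Fin n)}
    (hx : IsOptimal G x) {l : List (Fin n)} (hl : ∀ v, v ∈ l) : S ∈ candidates G l x := by
  have hcard : S.card ≤ n := by simpa using S.card_le_univ
  obtain ⟨-, h2, -⟩ := size_condition hn hk hcard
  have hS : S.Nonempty := by
    rw [← Finset.card_pos]
    have : (0 : ℝ) < S.card := by linarith
    exact_mod_cast this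
  have hnorm : ∀ u, ‖x u‖ ^ 2 = 1 := fun u => by rw [hx.1.norm_eq_one]; norm_num
  -- An exact solution has orthogonal vectors on edges, hence C = 0 here; the approximate solution
  -- will need C = 1 / n.
  have hsum := sum_norm_sub_sq_le hE hn hk x (C := 0) le_rfl (by simp)
    (fun u => by rw [hnorm]; norm_num)
    (fun u v huv h => by rw [hx.1.inner_eq_zero u v (hG.adj huv h)]; simp)
    (by
      have := hx.sum_le hS hG.2
      simp only [hnorm, Finset.sum_const, nsmul_eq_mul, mul_one]
      linarith)
  obtain ⟨u, hu, hA⟩ := exists_center hS (hE.exists_nbrs hG)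
    (fun u => by rw [hnorm]; norm_num)
    (fun u v h => by rw [hx.1.inner_eq_zero u v h]; norm_num) hsum
  have hball : ∀ v, v ∈ unitBall x u ↔ 1 / 2 < (inner ℝ (x u) (x v) : ℝ) := by
    intro v
    have h1 := norm_sub_sq_real (x v) (x u)
    rw [hnorm, hnorm, real_inner_comm] at h1
    have h2 := norm_nonneg (x v - x u)
    simp only [unitBall, Finset.mem_filter, Finset.mem_univ, true_and]
    constructor
    · intro h; nlinarith
    · intro h; nlinarith
  obtain ⟨h3, h4⟩ := hA (unitBall x u)
    (fun v hv => (hball v).2 (by linarith)) (fun v hv => by have := (hball v).1 hv; linarith)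
  exact List.mem_map.2 ⟨u, List.mem_finRange u, greedyExtend_eq hG.2 h3 h4 fun v _ => hl v⟩

/-! ### The sets computed from the Frank-Wolfe solution -/

/-- The vertices whose vectors are close to that of `u`. -/
noncomputable def nearSet (G : SimpleGraph (Fin n)) (u : Fin n) : Finset (Fin n) :=
  Finset.univ.filter fun v => denom n < 2 * fwIter G (numIter n) u v

open Classical in
/-- The vertices without neighbours close to `u`. -/
noncomputable def candSet (G : SimpleGraph (Fin n)) (u : Fin n) : Finset (Fin n) :=
  Finset.univ.filter fun v => ∀ w ∈ nearSet G u, ¬ G.Adj w v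

open Classical in
/-- The candidate set, if it is independent. -/
noncomputable def outSet (G : SimpleGraph (Fin n)) (u : Fin n) : Finset (Fin n) :=
  if G.IsIndepSet (candSet G u : Set (Fin n)) then candSet G u else ∅

theorem isIndepSet_outSet (G : SimpleGraph (Fin n)) (u : Fin n) :
    G.IsIndepSet (outSet G u : Set (Fin n)) := by
  unfold outSet
  split_ifs with h
  · exact h
  · simp [SimpleGraph.IsIndepSet]

/-- The comparison solution, in which the vectors of `S` are merged. -/
theorem exists_merged (hS : S.Nonempty) {X : Matrix (Fin n) (Fin n) ℝ} (hX : IsDensity X) :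
    ∃ Z a, IsDensity Z ∧ (S.card : ℝ) * a = ∑ u ∈ S, X u u ∧ (∀ u ∈ S, ∀ v ∈ S, Z u v = a) ∧
      (∀ u ∈ S, ∀ v ∉ S, Z u v = 0) ∧ (∀ u ∉ S, ∀ v ∉ S, Z u v = X u v) := by
  classical
  have hk : (0 : ℝ) < S.card := by exact_mod_cast hS.card_pos
  -- The diagonal of X is only approximately 1, so the merged vector gets the average squared
  -- length; this keeps the trace equal to n.
  set a : ℝ := (∑ u ∈ S, X u u) / S.card with ha
  have ha0 : 0 ≤ a := div_nonneg (Finset.sum_nonneg fun u _ => hX.posSemidef.diag_nonneg) hk.le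
  have hka : (S.card : ℝ) * a = ∑ u ∈ S, X u u := by rw [ha]; field_simp
  set p : Fin n → ℝ := fun u => if u ∈ S then 0 else 1 with hp
  set s : Fin n → ℝ := fun u => if u ∈ S then 1 else 0 with hs
  -- Compression of X to the complement of S plus a rank one block on S: both summands are positive
  -- semidefinite.
  set Z : Matrix (Fin n) (Fin n) ℝ := diagonal p * X * (diagonal p)ᴴ + a • vecMulVec s (star s)
    with hZ
  have hZuv : ∀ u v, Z u v = p u * X u v * p v + a * (s u * s v) := by
    intro u v
    simp [hZ, Matrix.vecMulVec_apply]
  refine ⟨Z, a, ⟨?_, ?_⟩, hka, ?_, ?_, ?_⟩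
  · exact (hX.posSemidef.mul_mul_conjTranspose_same _).add
      ((posSemidef_vecMulVec_self_star s).smul ha0)
  · have h1 : Z.trace = ∑ u ∈ S, a + ∑ u ∈ Sᶜ, X u u := by
      rw [Matrix.trace, ← Finset.sum_add_sum_compl S]
      congr 1
      · exact Finset.sum_congr rfl fun u hu => by simp [hZuv, hp, hs, hu]
      · exact Finset.sum_congr rfl fun u hu => by
          have hu' : u ∉ S := by simpa using hu
          simp [hZuv, hp, hs, hu']
    rw [h1, Finset.sum_const, nsmul_eq_mul, hka, Finset.sum_add_sum_compl, ← hX.trace_eq]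
    rfl
  · intro u hu v hv
    simp [hZuv, hp, hs, hu, hv]
  · intro u hu v hv
    simp [hZuv, hp, hs, hu, hv]
  · intro u hu v hv
    simp [hZuv, hp, hs, hu, hv]

/-- Expand Σ ‖x_u - x_v‖² ≥ 0 for Gram vectors x with Σ ‖x_u‖² = n. -/
theorem sum_entries_le {X : Matrix (Fin n) (Fin n) ℝ} (hX : IsDensity X) :
    ∑ u, ∑ v, X u v ≤ (n : ℝ) ^ 2 := by
  obtain ⟨x, hx⟩ := exists_gram hX.posSemidef
  have h1 := sum_norm_sub_sq Finset.univ x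
  have h2 : 0 ≤ ∑ u, ∑ v, ‖x u - x v‖ ^ 2 :=
    Finset.sum_nonneg fun u _ => Finset.sum_nonneg fun v _ => sq_nonneg _
  have h3 : ∑ u, ‖x u‖ ^ 2 = n := by
    rw [← hX.trace_eq]
    exact Finset.sum_congr rfl fun u _ => by
      rw [Matrix.diag_apply, hx u u, real_inner_self_eq_norm_sq]
  simp only [← hx, h3, Finset.card_univ, Fintype.card_fin] at h1
  nlinarith

/-- A nearly optimal solution nearly satisfies the constraints. -/
theorem sq_violation_le (hn : 1 ≤ n) {X : Matrix (Fin n) (Fin n) ℝ} (hX : IsDensity X)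
    (hopt : ∀ Z, IsDensity Z → objective G Z - objective G X ≤ 1) {u v : Fin n}
    (huv : u = v ∨ G.Adj u v) : |X u v - if u = v then 1 else 0| ≤ 1 / n := by
  have hn1 : (1 : ℝ) ≤ n := by exact_mod_cast hn
  have h1 := hopt 1 isDensity_one
  -- The identity satisfies all constraints and has value n, while the entries of X sum to at most
  -- n². Near optimality thus leaves a total penalty of at most n² - n + 1 ≤ n², and the weight n⁴
  -- makes each squared violation at most 1/n².
  have h2 : objective G (1 : Matrix (Fin n) (Fin n) ℝ) = n := by
    unfold objective
    simp only [Matrix.one_apply, sub_self]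
    simp
  have hlam : (penWeight n : ℝ) = (n : ℝ) ^ 4 := by simp [penWeight]
  set t : Fin n → Fin n → ℝ := fun u v => mask G u v * (X u v - if u = v then 1 else 0) ^ 2 with ht
  have ht0 : ∀ u v, 0 ≤ t u v := fun u v => mul_nonneg (mask_nonneg G u v) (sq_nonneg _)
  have h3 : objective G X = ∑ u, ∑ v, X u v - (n : ℝ) ^ 4 * ∑ u, ∑ v, t u v := by
    unfold objective
    simp only [hlam, Finset.sum_sub_distrib, Finset.mul_sum, ht]
  have h4 := sum_entries_le hX
  have h5 : t u v ≤ ∑ u, ∑ v, t u v :=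
    (Finset.single_le_sum (f := fun v => t u v) (fun v _ => ht0 u v) (Finset.mem_univ v)).trans
      (Finset.single_le_sum (f := fun u => ∑ v, t u v)
        (fun u _ => Finset.sum_nonneg fun v _ => ht0 u v) (Finset.mem_univ u))
  have hmask : mask G u v = 1 := by
    unfold mask
    exact if_pos huv
  have h6 : t u v = (X u v - if u = v then 1 else 0) ^ 2 := by simp [ht, hmask]
  have hn4 : (0 : ℝ) ≤ (n : ℝ) ^ 4 := by positivity
  have h7 : (n : ℝ) ^ 4 * (X u v - if u = v then 1 else 0) ^ 2 ≤ (n : ℝ) ^ 2 := by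
    rw [← h6]
    have := mul_le_mul_of_nonneg_left h5 hn4
    linarith
  have h8 : ((X u v - if u = v then 1 else 0) * n) ^ 2 ≤ 1 := by
    have h9 : (0 : ℝ) < (n : ℝ) ^ 2 := by positivity
    refine le_of_mul_le_mul_left ?_ h9
    calc _ = (n : ℝ) ^ 4 * (X u v - if u = v then 1 else 0) ^ 2 := by ring
      _ ≤ _ := by linarith
  rw [le_div_iff₀ (by linarith)]
  have h10 : |(X u v - if u = v then 1 else 0) * n| ≤ 1 := (sq_le_one_iff_abs_le_one _).1 h8
  rwa [abs_mul, abs_of_nonneg (by linarith : (0 : ℝ) ≤ n)] at h10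

/-- Merging S does not increase the penalty: by independence only the diagonal is penalized inside
S, where averaging lowers the sum of squares; between S and its complement all constraints become
exact; and elsewhere nothing changes. The final 1 is the optimization error. -/
theorem IsDensity.sum_le (hS : S.Nonempty) (hind : G.IsIndepSet (S : Set (Fin n)))
    {X : Matrix (Fin n) (Fin n) ℝ} (hX : IsDensity X)
    (hopt : ∀ Z, IsDensity Z → objective G Z - objective G X ≤ 1) :
    S.card * ∑ u ∈ S, X u u - ∑ u ∈ S, ∑ v ∈ S, X u v ≤
      2 * ∑ u ∈ S, ∑ v ∈ Sᶜ, X u v + 1 := by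
  obtain ⟨Z, a, hZ, hka, h1, h2, h3⟩ := exists_merged hS hX
  have h := hopt Z hZ
  set f : Matrix (Fin n) (Fin n) ℝ → Fin n → Fin n → ℝ := fun X u v =>
    X u v - penWeight n * (mask G u v * (X u v - if u = v then 1 else 0) ^ 2) with hf
  have hfs : ∀ {Y}, IsDensity Y → ∀ u v, f Y u v = f Y v u := by
    intro Y hY u v
    simp only [hf, hY.symm u v, mask_comm G u v, eq_comm]
  have hobj : ∀ Y, objective G Y = ∑ u, ∑ v, f Y u v := fun Y => rfl
  rw [hobj, hobj, sum_sum_split_symm S _ (hfs hZ), sum_sum_split_symm S _ (hfs hX)] at h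
  have hlam := penWeight_nonneg n
  set lam : ℝ := Int.cast (penWeight n) with hlamdef
  have hmaskS : ∀ u ∈ S, ∀ v ∈ S, mask G u v = if u = v then 1 else 0 := by
    intro u hu v hv
    by_cases huv : u = v
    · simp [mask, huv]
    · have := hind hu hv huv
      simp [mask, huv, this]
  have eSS : ∀ Y : Matrix (Fin n) (Fin n) ℝ, ∑ u ∈ S, ∑ v ∈ S, f Y u v =
      ∑ u ∈ S, ∑ v ∈ S, Y u v - lam * ∑ u ∈ S, (Y u u - 1) ^ 2 := by
    intro Y
    have : ∀ u ∈ S, ∑ v ∈ S, f Y u v = ∑ v ∈ S, Y u v - lam * (Y u u - 1) ^ 2 := by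
      intro u hu
      have e : ∀ v ∈ S, f Y u v = Y u v - if u = v then lam * (Y u u - 1) ^ 2 else 0 := by
        intro v hv
        simp only [hf, hmaskS u hu v hv]
        split_ifs with huv
        · subst huv; simp
        · simp
      rw [Finset.sum_congr rfl e, Finset.sum_sub_distrib, Finset.sum_ite_eq, if_pos hu]
    rw [Finset.sum_congr rfl this, Finset.sum_sub_distrib, Finset.mul_sum]
  have eC : ∑ u ∈ Sᶜ, ∑ v ∈ Sᶜ, f Z u v = ∑ u ∈ Sᶜ, ∑ v ∈ Sᶜ, f X u v :=
    Finset.sum_congr rfl fun u hu => Finset.sum_congr rfl fun v hv => by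
      simp only [hf, h3 u (by simpa using hu) v (by simpa using hv)]
  have eB : ∑ u ∈ S, ∑ v ∈ Sᶜ, f Z u v = 0 :=
    Finset.sum_eq_zero fun u hu => Finset.sum_eq_zero fun v hv => by
      have hv' : v ∉ S := by simpa using hv
      have huv : u ≠ v := fun e => hv' (e ▸ hu)
      simp [hf, h2 u hu v hv', huv]
  have eB' : ∑ u ∈ S, ∑ v ∈ Sᶜ, f X u v ≤ ∑ u ∈ S, ∑ v ∈ Sᶜ, X u v :=
    Finset.sum_le_sum fun u _ => Finset.sum_le_sum fun v _ => by
      have := mul_nonneg hlam (mul_nonneg (mask_nonneg G u v)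
        (sq_nonneg (X u v - if u = v then 1 else 0)))
      simp only [hf]
      linarith
  have eZ1 : ∑ u ∈ S, ∑ v ∈ S, Z u v = S.card * ∑ u ∈ S, X u u := by
    rw [Finset.sum_congr rfl fun u hu => Finset.sum_congr rfl fun v hv => h1 u hu v hv, ← hka]
    simp
  -- Convexity of the square: replacing the diagonal entries on S by their mean a.
  have eZ2 : ∑ u ∈ S, (Z u u - 1) ^ 2 ≤ ∑ u ∈ S, (X u u - 1) ^ 2 := by
    have hk : (0 : ℝ) < S.card := by exact_mod_cast hS.card_pos
    have c1 : ∑ u ∈ S, (Z u u - 1) ^ 2 = S.card * (a - 1) ^ 2 := by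
      rw [Finset.sum_congr rfl fun u hu => by rw [h1 u hu u hu]]
      simp
    have c2 := sq_sum_le_card_mul_sum_sq (s := S) (f := fun u => X u u - 1)
    have c3 : ∑ u ∈ S, (X u u - 1) = S.card * (a - 1) := by
      rw [Finset.sum_sub_distrib, ← hka]; simp; ring
    rw [c3] at c2
    rw [c1]
    refine le_of_mul_le_mul_left ?_ hk
    calc _ = (S.card * (a - 1)) ^ 2 := by ring
      _ ≤ _ := c2
  have := mul_le_mul_of_nonneg_left eZ2 hlam
  rw [eSS, eSS, eC, eB, eZ1] at h
  linarith

/-- The sets computed from the Frank-Wolfe solution reveal `S`. -/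
theorem exists_outSet_eq (hn : 1 ≤ n) (hk : (10 : ℝ) ^ 4 * (n : ℝ) ^ (2 / 3 : ℝ) ≤ S.card)
    (hE : GoodEdges S E) (hG : Admissible S E G) : ∃ u, outSet G u = S := by
  have hcard : S.card ≤ n := by simpa using S.card_le_univ
  obtain ⟨-, h2, h3⟩ := size_condition hn hk hcard
  have hS : S.Nonempty := by
    rw [← Finset.card_pos]
    have : (0 : ℝ) < S.card := by linarith
    exact_mod_cast this
  obtain ⟨X, hX, hW, hopt⟩ := fwIter_optimal hn G
  obtain ⟨x, hx⟩ := exists_gram hX.posSemidef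
  have hn0 : (0 : ℝ) < n := by linarith
  have hinv : 1 / (n : ℝ) ≤ 1 / 100 := one_div_le_one_div_of_le (by norm_num) (by linarith)
  have hxn : ∀ u, ‖x u‖ ^ 2 = X u u := fun u => by rw [hx, real_inner_self_eq_norm_sq]
  have hnorm : ∀ u, |‖x u‖ ^ 2 - 1| ≤ 1 / 100 := fun u => by
    have := sq_violation_le hn hX hopt (u := u) (v := u) (Or.inl rfl)
    rw [if_pos rfl] at this
    rw [hxn]
    exact this.trans hinv
  have hadj : ∀ u v, G.Adj u v → |(inner ℝ (x u) (x v) : ℝ)| ≤ 1 / n := fun u v h => by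
    have := sq_violation_le hn hX hopt (u := u) (v := v) (Or.inr h)
    rwa [if_neg h.ne, sub_zero, hx] at this
  have hsum := sum_norm_sub_sq_le hE hn hk x (C := 1 / n) (by positivity)
    (by apply le_of_eq; field_simp) hnorm (fun u v huv h => hadj u v (hG.adj huv h)) (by
      have := hX.sum_le hS hG.2 hopt
      simpa only [hxn, ← hx] using this)
  obtain ⟨u, hu, hA⟩ := exists_center hS (hE.exists_nbrs hG) hnorm
    (fun u v h => (hadj u v h).trans hinv) hsum
  have hqv : (stepInv n : ℝ) = 64 * (n : ℝ) ^ 8 := by rw [stepInv]; push_cast; ring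
  have hDv : (denom n : ℝ) = 4096 * (n : ℝ) ^ 15 := by rw [denom]; push_cast; ring
  -- Rounding moves the threshold 1/2 by at most 1/20, well inside the allowed interval from 4/10 to
  -- 6/10.
  have hqD : (stepInv n : ℝ) ≤ denom n / 20 := by
    rw [hqv, hDv]
    have p : (n : ℝ) ^ 8 ≤ (n : ℝ) ^ 15 := pow_le_pow_right₀ (by linarith) (by norm_num)
    have : 0 ≤ (n : ℝ) ^ 8 := by positivity
    linarith
  have hD : (0 : ℝ) < denom n := by rw [hDv]; positivity
  have hnear : ∀ v, v ∈ nearSet G u ↔ (denom n : ℝ) < 2 * fwIter G (numIter n) u v := by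
    intro v
    simp only [nearSet, Finset.mem_filter, Finset.mem_univ, true_and]
    exact_mod_cast Iff.rfl
  obtain ⟨h4, h5⟩ := hA (nearSet G u)
    (fun v hv => by
      rw [hnear]
      have := (abs_le.1 (hW u v)).1
      rw [← hx] at hv
      nlinarith)
    (fun v hv => by
      rw [hnear] at hv
      have := (abs_le.1 (hW u v)).2
      rw [← hx]
      nlinarith)
  have hcand : candSet G u = S := by
    ext v
    simp only [candSet, Finset.mem_filter, Finset.mem_univ, true_and]
    constructor
    · intro h
      by_contra hv
      obtain ⟨w, hw, hadj⟩ := h5 v hv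
      exact h w hw hadj
    · intro hv w hw hadj
      exact hG.2 (h4 hw) hv hadj.ne hadj
  refine ⟨u, ?_⟩
  unfold outSet
  rw [hcand, if_pos hG.2]

/-- A preference order on the computed sets: larger sets first, then lower numbers. -/
noncomputable def rank (G : SimpleGraph (Fin n)) (u : Fin n) : ℤ :=
  (outSet G u).card * n - u

open Classical in
/-- The largest computed set. -/
noncomputable def largestSet (n : ℕ) (G : SimpleGraph (Fin n)) : Finset (Fin n) :=
  Finset.univ.filter fun v => ∃ u, (∀ w, rank G w ≤ rank G u) ∧ v ∈ outSet G u

/-- The vertex number lies between 0 and n - 1, so the rank determines the size and then the vertex,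
as in base n. -/
theorem rank_injective (G : SimpleGraph (Fin n)) : Function.Injective (rank G) := by
  intro u w h
  unfold rank at h
  have h1 := u.isLt
  have h2 := w.isLt
  rcases lt_trichotomy ((outSet G u).card : ℤ) (outSet G w).card with hlt | heq | hgt
  · nlinarith
  · rw [heq] at h
    ext
    omega
  · nlinarith

/-- The vertex of maximal rank is unique, so the union over all maximizers is a single computed set;
this makes the selection expressible by sums of indicators. -/
theorem exists_largestSet_eq (hn : 1 ≤ n) (G : SimpleGraph (Fin n)) :
    ∃ u, largestSet n G = outSet G u ∧ ∀ w, (outSet G w).card ≤ (outSet G u).card := by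
  have : Nonempty (Fin n) := ⟨⟨0, hn⟩⟩
  obtain ⟨u, hu⟩ := Finite.exists_max (rank G)
  refine ⟨u, ?_, fun w => ?_⟩
  · ext v
    simp only [largestSet, Finset.mem_filter, Finset.mem_univ, true_and]
    constructor
    · rintro ⟨u', hu', hv⟩
      rwa [rank_injective G (le_antisymm (hu u') (hu' u))] at hv
    · exact fun hv => ⟨u, hu, hv⟩
  · have h := hu w
    unfold rank at h
    have h1 := u.isLt
    have h2 := w.isLt
    by_contra! hcon
    have h3 : ((outSet G u).card : ℤ) + 1 ≤ (outSet G w).card := by exact_mod_cast hcon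
    nlinarith

theorem isIndepSet_largestSet (n : ℕ) (G : SimpleGraph (Fin n)) :
    G.IsIndepSet (largestSet n G : Set (Fin n)) := by
  rcases Nat.eq_zero_or_pos n with rfl | hn
  · intro u
    exact u.elim0
  · obtain ⟨u, hu, -⟩ := exists_largestSet_eq hn G
    rw [hu]
    exact isIndepSet_outSet G u

end

/-- The list of computed sets. -/
noncomputable def outList (n : ℕ) (G : SimpleGraph (Fin n)) : List (Finset (Fin n)) :=
  (List.finRange n).map (outSet G)

end PlantedIndepSet

namespace PlantedIndepSet

/-! ### Matrix programs -/

namespace Expr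

instance : Add Expr := ⟨op .add⟩
instance : Sub Expr := ⟨op .sub⟩
instance : Mul Expr := ⟨op .mul⟩
instance : Div Expr := ⟨op .div⟩

section Eval

variable (e e₁ e₂ : Expr) (v : ℕ → ℤ) (m : ℕ → ℤ → ℤ)

@[simp] theorem eval_add : (e₁ + e₂).eval v m = e₁.eval v m + e₂.eval v m := rfl
@[simp] theorem eval_sub : (e₁ - e₂).eval v m = e₁.eval v m - e₂.eval v m := rfl
@[simp] theorem eval_mul : (e₁ * e₂).eval v m = e₁.eval v m * e₂.eval v m := rfl
@[simp] theorem eval_div : (e₁ / e₂).eval v m = e₁.eval v m / e₂.eval v m := rfl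
@[simp] theorem eval_const (c : ℤ) : (const c).eval v m = c := rfl
@[simp] theorem eval_var (x : ℕ) : (var x).eval v m = v x := rfl
@[simp] theorem eval_cond : (cond e e₁ e₂).eval v m =
    if 0 < e.eval v m then e₁.eval v m else e₂.eval v m := rfl

end Eval

section Below

variable {e e₁ e₂ : Expr} {d : ℕ}

@[simp] theorem below_add : (e₁ + e₂).Below d ↔ e₁.Below d ∧ e₂.Below d := Iff.rfl
@[simp] theorem below_sub : (e₁ - e₂).Below d ↔ e₁.Below d ∧ e₂.Below d := Iff.rfl
@[simp] theorem below_mul : (e₁ * e₂).Below d ↔ e₁.Below d ∧ e₂.Below d := Iff.rfl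
@[simp] theorem below_div : (e₁ / e₂).Below d ↔ e₁.Below d ∧ e₂.Below d := Iff.rfl
@[simp] theorem below_const (c : ℤ) : (const c).Below d := trivial
@[simp] theorem below_var (x : ℕ) : (var x).Below d ↔ x < d := Iff.rfl
@[simp] theorem below_cond : (cond e e₁ e₂).Below d ↔ e.Below d ∧ e₁.Below d ∧ e₂.Below d := Iff.rfl
@[simp] theorem below_sum (x y : ℕ) : (sum x y e).Below d ↔ x < d ∧ y < d ∧ e.Below d := Iff.rfl

end Below

/-- A monomial in the variable `0`. -/
def monom (c : ℤ) : ℕ → Expr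
  | 0 => const c
  | k + 1 => monom c k * var 0

@[simp] theorem eval_monom (c : ℤ) (k : ℕ) (v : ℕ → ℤ) (m : ℕ → ℤ → ℤ) :
    (monom c k).eval v m = c * v 0 ^ k := by
  induction k with
  | zero => simp [monom]
  | succ k ih => simp [monom, ih, pow_succ, mul_assoc]

@[simp] theorem below_monom (c : ℤ) (k : ℕ) {d : ℕ} (hd : 0 < d) : (monom c k).Below d := by
  induction k with
  | zero => trivial
  | succ k ih => exact ⟨ih, hd⟩

/-- The indicator of the equality of two variables. -/
def delta (x y : ℕ) : Expr :=
  cond (var x - var y) (const 0) (cond (var y - var x) (const 0) (const 1))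

@[simp] theorem eval_delta (x y : ℕ) (v : ℕ → ℤ) (m : ℕ → ℤ → ℤ) :
    (delta x y).eval v m = if v x = v y then 1 else 0 := by
  simp only [delta, eval_cond, eval_sub, eval_var, eval_const]
  split_ifs <;> omega

@[simp] theorem below_delta (x y : ℕ) {d : ℕ} : (delta x y).Below d ↔ x < d ∧ y < d := by
  simp only [delta, below_cond, below_sub, below_var, below_const]
  tauto

/-- The entry, with row and column given by two variables, of the square matrix stored row by row
in an array; its size is the variable `0`. -/
def entry (b x y : ℕ) : Expr := load b (var x * var 0 + var y)

@[simp] theorem below_entry (b x y : ℕ) {d : ℕ} :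
    (entry b x y).Below d ↔ (x < d ∧ 0 < d) ∧ y < d := Iff.rfl

end Expr

/-- The square matrix stored in an array. -/
def mat (n : ℕ) (m : ℕ → ℤ → ℤ) (b : ℕ) : Matrix (Fin n) (Fin n) ℤ :=
  .of fun u v => m b ((u : ℤ) * n + v)

theorem Expr.eval_entry {n : ℕ} {b x y : ℕ} {v : ℕ → ℤ} (m : ℕ → ℤ → ℤ) (h0 : v 0 = n) {u w : Fin n}
    (hx : v x = u) (hy : v y = w) : (entry b x y).eval v m = mat n m b u w := by
  simp [entry, eval, Op.eval, h0, hx, hy, mat]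

theorem Expr.eval_sum_fin {n : ℕ} {x : ℕ} {v : ℕ → ℤ} (e : Expr) (m : ℕ → ℤ → ℤ) (h0 : v 0 = n) :
    (sum x 0 e).eval v m = ∑ l : Fin n, e.eval (Function.update v x (l : ℕ)) m := by
  simp only [eval, h0, Int.toNat_natCast]
  exact (Fin.sum_univ_eq_sum_range (fun l : ℕ => e.eval (Function.update v x (l : ℤ)) m) n).symm

theorem mul_add_inj {n u w u' w' : ℕ} (hw : w < n) (hw' : w' < n)
    (h : (u : ℤ) * n + w = u' * n + w') : u = u' ∧ w = w' := by
  have h : u * n + w = u' * n + w' := by exact_mod_cast h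
  have h1 : (u * n + w) / n = u := by
    rw [mul_comm, Nat.mul_add_div (by omega), Nat.div_eq_of_lt hw, add_zero]
  have h2 : (u' * n + w') / n = u' := by
    rw [mul_comm, Nat.mul_add_div (by omega), Nat.div_eq_of_lt hw', add_zero]
  have h3 : u = u' := by rw [← h1, h, h2]
  subst h3
  exact ⟨rfl, by omega⟩

namespace Cmd

/-- An invariant `I` for a loop. -/
theorem loop_spec {x y L : ℕ} {c : Cmd} {v : ℕ → ℤ} {m : ℕ → ℤ → ℤ}
    (I : ℕ → (ℕ → ℤ → ℤ) → Prop) (h0 : I 0 m)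
    (h : ∀ l < (v y).toNat, ∀ m, I l m →
      c.Safe L (Function.update v x l) m ∧ I (l + 1) (c.run (Function.update v x l) m)) :
    (loop x y c).Safe L v m ∧ I (v y).toNat ((loop x y c).run v m) := by
  have key : ∀ l ≤ (v y).toNat, I l (rounds (fun l => c.run (Function.update v x l)) l m) := by
    intro l
    induction l with
    | zero => exact fun _ => h0
    | succ l ih => exact fun hl => (h l (by omega) _ (ih (by omega))).2
  exact ⟨fun l hl => (h l hl _ (key l hl.le)).1, key _ le_rfl⟩

/-- The command that fills the matrix in array `b` with the values of an expression in the row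
variable `2` and the column variable `3`. -/
def fill (b : ℕ) (e : Expr) : Cmd :=
  loop 2 0 (loop 3 0 (store b (.var 2 * .var 0 + .var 3) e))

/-- The expression is evaluated while array b is partly overwritten, so its value must be known for
every memory that agrees with the initial one on the other matrices; a fill may not depend on the
array it writes. The loop invariant is lexicographic progress through the entries. -/
theorem fill_spec {n b L : ℕ} {e : Expr} {v : ℕ → ℤ} {m : ℕ → ℤ → ℤ}
    (M : Matrix (Fin n) (Fin n) ℤ) (h0 : v 0 = n)
    (he : ∀ m', (∀ b' ≠ b, mat n m' b' = mat n m b') → ∀ u w : Fin n,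
      e.eval (Function.update (Function.update v 2 (u : ℕ)) 3 (w : ℕ)) m' = M u w)
    (hL : ∀ u w, |M u w| ≤ 2 ^ L) :
    (fill b e).Safe L v m ∧ mat n ((fill b e).run v m) b = M ∧
      ∀ b' ≠ b, mat n ((fill b e).run v m) b' = mat n m b' := by
  have hn : (v 0).toNat = n := by rw [h0]; simp
  let J : ℕ → ℕ → (ℕ → ℤ → ℤ) → Prop := fun l k m' =>
    (∀ b' ≠ b, mat n m' b' = mat n m b') ∧
    ∀ u w : Fin n, (u < l ∨ (u : ℕ) = l ∧ w < k) → mat n m' b u w = M u w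
  have main := loop_spec (x := 2) (y := 0) (L := L) (v := v) (m := m)
    (c := loop 3 0 (store b (.var 2 * .var 0 + .var 3) e)) (fun l => J l 0)
    ⟨fun _ _ => rfl, fun u w h => by omega⟩ (by
      intro l hl m₁ hm₁
      have inner := loop_spec (x := 3) (y := 0) (L := L) (v := Function.update v 2 l) (m := m₁)
        (c := store b (.var 2 * .var 0 + .var 3) e) (J l) hm₁ (by
          intro k hk m₂ hm₂
          simp only [Function.update_of_ne (show (0 : ℕ) ≠ 2 by decide), hn] at hk
          rw [hn] at hl
          have hval := he m₂ hm₂.1 ⟨l, hl⟩ ⟨k, hk⟩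
          simp only at hval
          refine ⟨by simpa only [Safe, hval] using hL _ _, fun b' hb' => ?_, fun u w huw => ?_⟩
          · rw [← hm₂.1 b' hb']
            ext u w
            simp [mat, run, hb']
          · have ha : (Expr.var 2 * Expr.var 0 + Expr.var 3).eval
                (Function.update (Function.update v 2 (l : ℤ)) 3 (k : ℤ)) m₂ = (l : ℤ) * n + k := by
              simp [h0]
            simp only [mat, run, Matrix.of_apply, ha, hval, Function.update_self]
            by_cases hc : (u : ℕ) = l ∧ (w : ℕ) = k
            · obtain ⟨rfl, rfl⟩ := hc
              simp
            · rw [Function.update_of_ne fun h => hc (mul_add_inj w.isLt hk h)]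
              exact hm₂.2 u w (by omega))
      refine ⟨inner.1, inner.2.1, fun u w huw => inner.2.2 u w ?_⟩
      have : ((Function.update v 2 (l : ℤ)) 0).toNat = n := by simpa using hn
      rw [this]
      have := w.isLt
      omega)
  refine ⟨main.1, ?_, main.2.1⟩
  ext u w
  exact main.2.2 u w (Or.inl (by rw [hn]; exact u.isLt))

theorem below_fill {b d : ℕ} {e : Expr} (hd : 4 ≤ d) (he : e.Below d) : (fill b e).Below d := by
  have : ∀ k < 4, k < d := fun k hk => by omega
  simp [fill, Below, this, he]

end Cmd

end PlantedIndepSet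

namespace PlantedIndepSet

/-! ### Word length -/

/-- A bound for the entries of the scaled gradients. -/
def gradBound (n : ℕ) : ℕ :=
  4096 * n ^ 15 + 8 * n ^ 6 * (4096 * n ^ 15) +
    2 * n ^ 4 * (4096 * n ^ 15 * n + 64 * n ^ 8 + 4096 * n ^ 15)

/-- A bound for the number of binary digits of the numbers occurring in the computation. -/
def wordLen (n : ℕ) : ℕ :=
  n * gradBound n * numIter n + (4096 * n ^ 15 * n + 64 * n ^ 8) + gradBound n + n * n +
    (numIter n + n) + 1

theorem polyBounded_numIter : PolyBounded numIter :=
  (PolyBounded.const 1024).mul (PolyBounded.id.pow 11)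

theorem polyBounded_wordLen : PolyBounded wordLen := by
  have c := PolyBounded.const
  have p := PolyBounded.id.pow
  have hd := (c 4096).mul (p 15)
  have hw := (hd.mul PolyBounded.id).add ((c 64).mul (p 8))
  have hg : PolyBounded gradBound :=
    (hd.add (((c 8).mul (p 6)).mul hd)).add (((c 2).mul (p 4)).mul (hw.add hd))
  exact ((((((PolyBounded.id.mul hg).mul polyBounded_numIter).add hw).add hg).add
    (PolyBounded.id.mul PolyBounded.id)).add (polyBounded_numIter.add PolyBounded.id)).add (c 1)

theorem cast_le_two_pow {a L : ℕ} (h : a ≤ L) : (a : ℤ) ≤ 2 ^ L := by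
  have h1 : a < 2 ^ a := Nat.lt_two_pow_self
  have h2 : 2 ^ a ≤ 2 ^ L := Nat.pow_le_pow_right (by norm_num) h
  exact_mod_cast h1.le.trans h2

theorem abs_pow_apply_le {n : ℕ} {M : Matrix (Fin n) (Fin n) ℤ} {β : ℕ}
    (hM : ∀ u v, |M u v| ≤ β) (j : ℕ) (u v : Fin n) : |(M ^ j) u v| ≤ ((n * β) ^ j : ℕ) := by
  induction j generalizing v with
  | zero =>
    simp only [pow_zero, Matrix.one_apply]
    split_ifs <;> simp
  | succ j ih =>
    rw [pow_succ, Matrix.mul_apply]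
    calc |∑ w, (M ^ j) u w * M w v| ≤ ∑ w, |(M ^ j) u w * M w v| := Finset.abs_sum_le_sum_abs _ _
      _ ≤ ∑ _w : Fin n, (((n * β) ^ j : ℕ) : ℤ) * β := by
          refine Finset.sum_le_sum fun w _ => ?_
          rw [abs_mul]
          exact mul_le_mul (ih w) (hM w v) (abs_nonneg _) (by positivity)
      _ = ((n * β) ^ (j + 1) : ℕ) := by simp; ring

theorem abs_ite_le_two_pow {p : Prop} [Decidable p] (L : ℕ) :
    |(if p then 1 else 0 : ℤ)| ≤ 2 ^ L := by
  have : (1 : ℤ) ≤ 2 ^ L := one_le_pow₀ (by norm_num)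
  split_ifs <;> simp [this]

/-! ### Sizes of the numbers in the Frank-Wolfe method -/

section Bounds

variable {n : ℕ} (G : SimpleGraph (Fin n))

theorem abs_fwIter_le_cast (t : ℕ) (u v : Fin n) :
    |fwIter G t u v| ≤ (4096 * n ^ 15 * n + 64 * n ^ 8 : ℕ) := by
  refine (abs_fwIter_le u.pos G t u v).trans (le_of_eq ?_)
  simp [denom, stepInv]

theorem abs_fwIter_le_two_pow (t : ℕ) (u v : Fin n) : |fwIter G t u v| ≤ 2 ^ wordLen n :=
  (abs_fwIter_le_cast G t u v).trans (cast_le_two_pow (by unfold wordLen; omega))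

theorem abs_gradMat_fwIter_le (t : ℕ) (u v : Fin n) :
    |gradMat G (fwIter G t) u v| ≤ gradBound n := by
  have h1 := abs_fwIter_le_cast G t u v
  set ω := 4096 * n ^ 15 * n + 64 * n ^ 8 with hω
  have hD : denom n = (4096 * n ^ 15 : ℕ) := by simp [denom]
  have hD0 : (0 : ℤ) ≤ denom n := by rw [hD]; positivity
  have hs0 : (0 : ℤ) ≤ shiftWeight n := by simp [shiftWeight]
  have hp0 : (0 : ℤ) ≤ penWeight n := by simp [penWeight]
  have hδ : |(if u = v then 1 else 0 : ℤ)| ≤ 1 := by split_ifs <;> simp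
  have hm : |mask G u v| ≤ 1 := by unfold mask; split_ifs <;> simp
  have hx : |fwIter G t u v - denom n * (if u = v then 1 else 0)| ≤ ω + denom n := by
    refine (abs_sub _ _).trans (add_le_add h1 ?_)
    rw [abs_mul, abs_of_nonneg hD0]
    exact mul_le_of_le_one_right hD0 hδ
  have hy : |2 * penWeight n * (mask G u v * (fwIter G t u v -
      denom n * (if u = v then 1 else 0)))| ≤ 2 * penWeight n * (ω + denom n) := by
    rw [abs_mul, abs_of_nonneg (by positivity : (0 : ℤ) ≤ 2 * penWeight n), abs_mul]
    refine mul_le_mul_of_nonneg_left ?_ (by positivity)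
    calc _ ≤ 1 * (ω + denom n) := mul_le_mul hm hx (abs_nonneg _) zero_le_one
      _ = _ := one_mul _
  have hz : |denom n + shiftWeight n * denom n * (if u = v then 1 else 0)| ≤
      denom n + shiftWeight n * denom n := by
    refine (abs_add_le _ _).trans (add_le_add (abs_of_nonneg hD0).le ?_)
    rw [abs_mul, abs_of_nonneg (mul_nonneg hs0 hD0)]
    exact mul_le_of_le_one_right (mul_nonneg hs0 hD0) hδ
  have key := (abs_sub _ _).trans (add_le_add hz hy)
  refine key.trans (le_of_eq ?_)
  rw [hD]
  simp only [gradBound, hω, shiftWeight, penWeight]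
  push_cast
  ring

theorem abs_gradMat_le_two_pow (t : ℕ) (u v : Fin n) :
    |gradMat G (fwIter G t) u v| ≤ 2 ^ wordLen n :=
  (abs_gradMat_fwIter_le G t u v).trans (cast_le_two_pow (by unfold wordLen; omega))

/-- The dominant term of the word length: the entries are at most (nβ)^N ≤ 2^(nβN), where β is
`gradBound n`. These numbers are huge but have polynomially many digits. -/
theorem abs_gradMat_pow_le_two_pow (t : ℕ) {j : ℕ} (hj : j ≤ numIter n) (u v : Fin n) :
    |(gradMat G (fwIter G t) ^ j) u v| ≤ 2 ^ wordLen n := by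
  refine (abs_pow_apply_le (abs_gradMat_fwIter_le G t) j u v).trans ?_
  have h1 : n * gradBound n ≤ 2 ^ (n * gradBound n) := Nat.lt_two_pow_self.le
  have h2 : (n * gradBound n) ^ j ≤ 2 ^ wordLen n := by
    calc (n * gradBound n) ^ j ≤ (2 ^ (n * gradBound n)) ^ j := Nat.pow_le_pow_left h1 j
      _ = 2 ^ (n * gradBound n * j) := (pow_mul _ _ _).symm
      _ ≤ 2 ^ wordLen n := by
          refine Nat.pow_le_pow_right (by norm_num) ?_
          have := Nat.mul_le_mul_left (n * gradBound n) hj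
          unfold wordLen
          omega
  exact_mod_cast h2

end Bounds

/-! ### The programs -/

namespace Expr

/-- The entries of the scaled gradient, the iterate being in array `2`. -/
def grad : Expr :=
  monom 4096 15 + monom 8 6 * monom 4096 15 * delta 2 3 -
    const 2 * monom 1 4 *
      (cond (delta 2 3) (const 1) (entry 0 2 3) * (entry 2 2 3 - monom 4096 15 * delta 2 3))

/-- The entries of the next iterate, the iterate being in array `2` and the power of the scaled
gradient in array `4`. -/
def step : Expr :=
  ((monom 64 8 - const 1) * entry 2 2 3 * sum 4 0 (entry 4 4 4) +
      var 0 * monom 4096 15 * entry 4 2 3) /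
    (monom 64 8 * sum 4 0 (entry 4 4 4))

end Expr

namespace Cmd

/-- The command that replaces the matrix in array `4` by its product with that in array `3`. -/
def mulMat : Cmd :=
  seq (fill 5 (.sum 4 0 (.entry 4 2 4 * .entry 3 4 3))) (fill 4 (.entry 5 2 3))

/-- The command that puts a power of the matrix in array `3` into array `4`. -/
def powMat : Cmd := seq (fill 4 (.delta 2 3)) (loop 7 1 mulMat)

/-- One step of the Frank-Wolfe method on the matrix in array `2`. -/
def stepMat : Cmd :=
  seq (fill 3 .grad) (seq powMat (seq (fill 5 .step) (fill 2 (.entry 5 2 3))))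

/-- The Frank-Wolfe method. -/
def iterMat : Cmd := seq (fill 2 (.monom 4096 15 * .delta 2 3)) (loop 6 1 stepMat)

/-- The command that writes the computed sets into array `1`. -/
def listSets : Cmd :=
  -- Array 0 keeps the adjacency matrix and array 2 the final iterate. Rows of array 3 become the
  -- near sets, those of array 4 the candidate sets, and those of array 1 the output.
  seq iterMat
    (seq (fill 3 (.cond (.const 2 * .entry 2 2 3 - .monom 4096 15) (.const 1) (.const 0)))
      (seq (fill 4 (.cond (.sum 4 0 (.entry 3 2 4 * .entry 0 4 3)) (.const 0) (.const 1)))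
        (fill 1 (.cond (.sum 4 0 (.sum 5 0 (.entry 4 2 4 * .entry 4 2 5 * .entry 0 4 5)))
          (.const 0) (.entry 4 2 3)))))

/-- The command that writes the largest computed set into array `1`. -/
def bestSet : Cmd :=
  -- Array 3 gets the ranks, constant along rows, and array 4 the indicator of maximal rank. The
  -- result goes through array 5, because it is computed from array 1, which it replaces.
  seq listSets
    (seq (fill 3 (.sum 4 0 (.entry 1 2 4) * .var 0 - .var 2))
      (seq (fill 4 (.cond (.sum 4 0 (.cond (.entry 3 4 3 - .entry 3 2 3) (.const 1) (.const 0)))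
          (.const 0) (.const 1)))
        (seq (fill 5 (.cond (.sum 4 0 (.entry 4 4 3 * .entry 1 4 3)) (.const 1) (.const 0)))
          (fill 1 (.entry 5 2 3)))))

theorem below_listSets : listSets.Below 8 := by
  simp only [listSets, iterMat, stepMat, powMat, mulMat, Below]
  refine ⟨⟨below_fill ?_ ?_, ?_, ?_, below_fill ?_ ?_, ⟨below_fill ?_ ?_, ?_, ?_,
    below_fill ?_ ?_, below_fill ?_ ?_⟩, below_fill ?_ ?_, below_fill ?_ ?_⟩, below_fill ?_ ?_,
    below_fill ?_ ?_, below_fill ?_ ?_⟩ <;> simp [Expr.grad, Expr.step]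

theorem below_bestSet : bestSet.Below 8 := by
  refine ⟨below_listSets, below_fill ?_ ?_, below_fill ?_ ?_, below_fill ?_ ?_, below_fill ?_ ?_⟩ <;>
    simp

end Cmd

end PlantedIndepSet

namespace PlantedIndepSet

/-! ### Correctness of the programs -/

namespace Cmd

section Spec

variable {n : ℕ} {G : SimpleGraph (Fin n)} {v : ℕ → ℤ} {m : ℕ → ℤ → ℤ}

/-- Copying a matrix. -/
theorem copy_spec {b b' L : ℕ} (hb : b' ≠ b) (h0 : v 0 = n)
    (hL : ∀ u w, |mat n m b' u w| ≤ 2 ^ L) :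
    (fill b (.entry b' 2 3)).Safe L v m ∧
      mat n ((fill b (.entry b' 2 3)).run v m) b = mat n m b' ∧
      ∀ c ≠ b, mat n ((fill b (.entry b' 2 3)).run v m) c = mat n m c := by
  refine fill_spec _ h0 (fun m' hm' u w => ?_) hL
  rw [Expr.eval_entry m' (u := u) (w := w) (by simp [h0]) (by simp) (by simp), hm' _ hb]

/-- The product is formed in array 5 and copied back, since each entry needs a whole row of the old
array 4. -/
theorem mulMat_spec {L : ℕ} (h0 : v 0 = n)
    (hL : ∀ u w, |(mat n m 4 * mat n m 3) u w| ≤ 2 ^ L) :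
    mulMat.Safe L v m ∧ mat n (mulMat.run v m) 4 = mat n m 4 * mat n m 3 ∧
      ∀ b, b ≠ 4 → b ≠ 5 → mat n (mulMat.run v m) b = mat n m b := by
  have h1 := fill_spec (b := 5) (e := .sum 4 0 (.entry 4 2 4 * .entry 3 4 3)) (m := m)
    (mat n m 4 * mat n m 3) h0 (fun m' hm' u w => by
      rw [Expr.eval_sum_fin _ _ (n := n) (by simp [h0]), Matrix.mul_apply]
      refine Finset.sum_congr rfl fun l _ => ?_
      rw [Expr.eval_mul, Expr.eval_entry m' (u := u) (w := l) (by simp [h0]) (by simp) (by simp),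
        Expr.eval_entry m' (u := l) (w := w) (by simp [h0]) (by simp) (by simp),
        hm' 4 (by decide), hm' 3 (by decide)]) hL
  have h2 := copy_spec (b := 4) (b' := 5) (L := L)
    (m := (fill 5 (.sum 4 0 (.entry 4 2 4 * .entry 3 4 3))).run v m) (by decide) h0
    (by rwa [h1.2.1])
  exact ⟨⟨h1.1, h2.1⟩, h2.2.1.trans h1.2.1, fun b h4 h5 => (h2.2.2 b h4).trans (h1.2.2 b h5)⟩

theorem powMat_spec {L : ℕ} {M : Matrix (Fin n) (Fin n) ℤ} (h0 : v 0 = n) (hM : mat n m 3 = M)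
    (hL : ∀ j ≤ (v 1).toNat, ∀ u w, |(M ^ j) u w| ≤ 2 ^ L) :
    powMat.Safe L v m ∧ mat n (powMat.run v m) 4 = M ^ (v 1).toNat ∧
      ∀ b, b ≠ 4 → b ≠ 5 → mat n (powMat.run v m) b = mat n m b := by
  have h1 := fill_spec (b := 4) (e := .delta 2 3) (m := m) (L := L)
    (1 : Matrix (Fin n) (Fin n) ℤ) h0 (fun m' hm' u w => by
      simp [Matrix.one_apply, Fin.ext_iff]) (by simpa using hL 0 (Nat.zero_le _))
  have h2 := loop_spec (x := 7) (y := 1) (c := mulMat) (L := L) (v := v)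
    (m := (fill 4 (.delta 2 3)).run v m)
    (fun j m' => mat n m' 4 = M ^ j ∧ ∀ b, b ≠ 4 → b ≠ 5 → mat n m' b = mat n m b)
    ⟨by rw [h1.2.1, pow_zero], fun b h4 _ => h1.2.2 b h4⟩ (by
      rintro j hj m' ⟨h3, h4⟩
      have h5 : mat n m' 3 = M := (h4 3 (by decide) (by decide)).trans hM
      have h6 := mulMat_spec (n := n) (v := Function.update v 7 j) (m := m') (L := L) (by simp [h0])
        (by rw [h3, h5, ← pow_succ]; exact hL (j + 1) hj)
      exact ⟨h6.1, by rw [h6.2.1, h3, h5, pow_succ],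
        fun b hb hb' => (h6.2.2 b hb hb').trans (h4 b hb hb')⟩)
  exact ⟨⟨h1.1, h2.1⟩, h2.2⟩

open Classical in
theorem stepMat_spec {t : ℕ} (h0 : v 0 = n) (h1 : v 1 = numIter n)
    (hA : mat n m 0 = G.adjMatrix ℤ) (hW : mat n m 2 = fwIter G t) :
    stepMat.Safe (wordLen n) v m ∧ mat n (stepMat.run v m) 0 = G.adjMatrix ℤ ∧
      mat n (stepMat.run v m) 2 = fwIter G (t + 1) := by
  have g := fill_spec (b := 3) (e := .grad) (m := m) (gradMat G (fwIter G t)) h0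
    (fun m' hm' u w => by
      simp only [Expr.grad, Expr.eval_add, Expr.eval_sub, Expr.eval_mul, Expr.eval_cond,
        Expr.eval_monom, Expr.eval_delta, Expr.eval_const]
      rw [Expr.eval_entry m' (u := u) (w := w) (by simp [h0]) (by simp) (by simp),
        Expr.eval_entry m' (u := u) (w := w) (by simp [h0]) (by simp) (by simp),
        hm' 0 (by decide), hm' 2 (by decide), hA, hW]
      have hδ : (((u : ℕ) : ℤ) = ((w : ℕ) : ℤ)) = (u = w) := by simp [Fin.ext_iff]
      simp only [gradMat, Matrix.of_apply, mask, denom, shiftWeight, penWeight,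
        SimpleGraph.adjMatrix_apply, Function.update_self,
        Function.update_of_ne (show (0 : ℕ) ≠ 3 by decide),
        Function.update_of_ne (show (0 : ℕ) ≠ 2 by decide),
        Function.update_of_ne (show (2 : ℕ) ≠ 3 by decide), h0, hδ]
      by_cases huw : u = w <;> simp [huw])
    (abs_gradMat_le_two_pow G t)
  have hN : (v 1).toNat = numIter n := by rw [h1]; simp
  have p := powMat_spec (L := wordLen n) (m := (fill 3 .grad).run v m) h0 g.2.1
    (fun j hj => abs_gradMat_pow_le_two_pow G t (hN ▸ hj))
  rw [hN] at p
  set m₁ := (fill 3 .grad).run v m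
  set m₂ := powMat.run v m₁
  have s := fill_spec (b := 5) (e := .step) (m := m₂) (fwIter G (t + 1)) h0
    (fun m' hm' u w => by
      have e1 : mat n m' 4 = gradMat G (fwIter G t) ^ numIter n :=
        (hm' 4 (by decide)).trans p.2.1
      have e2 : mat n m' 2 = fwIter G t := by
        rw [hm' 2 (by decide), p.2.2 2 (by decide) (by decide), g.2.2 2 (by decide), hW]
      have e3 : (Expr.sum 4 0 (.entry 4 4 4)).eval
          (Function.update (Function.update v 2 (u : ℕ)) 3 (w : ℕ)) m' =
            (gradMat G (fwIter G t) ^ numIter n).trace := by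
        rw [Expr.eval_sum_fin _ _ (n := n) (by simp [h0])]
        refine Finset.sum_congr rfl fun l _ => ?_
        rw [Expr.eval_entry m' (u := l) (w := l) (by simp [h0]) (by simp) (by simp), e1]
        rfl
      simp only [Expr.step, Expr.eval_add, Expr.eval_sub, Expr.eval_mul, Expr.eval_div,
        Expr.eval_monom, Expr.eval_const, Expr.eval_var, e3]
      rw [Expr.eval_entry m' (u := u) (w := w) (by simp [h0]) (by simp) (by simp),
        Expr.eval_entry m' (u := u) (w := w) (by simp [h0]) (by simp) (by simp), e1, e2]
      simp only [fwIter, Function.iterate_succ_apply']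
      simp [fwStep, denom, stepInv, h0])
    (abs_fwIter_le_two_pow G (t + 1))
  have c := copy_spec (b := 2) (b' := 5) (L := wordLen n)
    (m := (fill 5 .step).run v m₂) (by decide) h0
    (by rw [s.2.1]; exact abs_fwIter_le_two_pow G (t + 1))
  refine ⟨⟨g.1, p.1, s.1, c.1⟩, ?_, c.2.1.trans s.2.1⟩
  exact (c.2.2 0 (by decide)).trans ((s.2.2 0 (by decide)).trans
    ((p.2.2 0 (by decide) (by decide)).trans ((g.2.2 0 (by decide)).trans hA)))

open Classical in
theorem iterMat_spec (h0 : v 0 = n) (h1 : v 1 = numIter n)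
    (hA : mat n m 0 = G.adjMatrix ℤ) :
    iterMat.Safe (wordLen n) v m ∧ mat n (iterMat.run v m) 0 = G.adjMatrix ℤ ∧
      mat n (iterMat.run v m) 2 = fwIter G (numIter n) := by
  have g := fill_spec (b := 2) (e := .monom 4096 15 * .delta 2 3) (m := m) (fwIter G 0) h0
    (fun m' hm' u w => by simp [fwIter, denom, h0, Fin.ext_iff])
    (abs_fwIter_le_two_pow G 0)
  have hN : (v 1).toNat = numIter n := by rw [h1]; simp
  set m₁ := (fill 2 (.monom 4096 15 * .delta 2 3)).run v m
  have hstart : mat n m₁ 0 = G.adjMatrix ℤ := (g.2.2 0 (by decide)).trans hA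
  have l := loop_spec (x := 6) (y := 1) (c := stepMat) (L := wordLen n) (v := v) (m := m₁)
    (fun t m' => mat n m' 0 = G.adjMatrix ℤ ∧ mat n m' 2 = fwIter G t) (And.intro hstart g.2.1)
    (fun t _ m' hm' => by
      have h0' : Function.update v 6 (t : ℤ) 0 = n := by simp [h0]
      have h1' : Function.update v 6 (t : ℤ) 1 = numIter n := by simp [h1]
      exact stepMat_spec h0' h1' hm'.1 hm'.2)
  rw [hN] at l
  exact ⟨⟨g.1, l.1⟩, l.2⟩

end Spec

end Cmd

end PlantedIndepSet

/-! ### Extraction of the sets and polynomial running time -/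

namespace PlantedIndepSet

theorem indicator_mul (p q : Prop) [Decidable p] [Decidable q] :
    (if p then 1 else 0 : ℤ) * (if q then 1 else 0) = if p ∧ q then 1 else 0 := by
  by_cases p <;> by_cases q <;> simp [*]

/-- Existential quantifiers over vertices are decided by the programs as positivity of sums of
indicators. -/
theorem sum_indicator_pos {ι : Type*} [Fintype ι] (p : ι → Prop) [DecidablePred p] :
    0 < ∑ i, (if p i then 1 else 0 : ℤ) ↔ ∃ i, p i := by
  rw [Finset.sum_pos_iff_of_nonneg fun i _ => by split_ifs <;> simp]
  refine ⟨fun ⟨i, _, h⟩ => ⟨i, ?_⟩, fun ⟨i, h⟩ => ⟨i, Finset.mem_univ _, by simp [h]⟩⟩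
  by_contra hi
  simp [hi] at h

open Classical in
/-- The matrix whose rows are the indicators of the members of a family of sets. -/
noncomputable def setMat {n : ℕ} (f : Fin n → Finset (Fin n)) : Matrix (Fin n) (Fin n) ℤ :=
  .of fun u v => if v ∈ f u then 1 else 0

theorem abs_setMat_le {n L : ℕ} (f : Fin n → Finset (Fin n)) (u v : Fin n) :
    |setMat f u v| ≤ 2 ^ L := abs_ite_le_two_pow L

namespace Cmd

section Spec

variable {n : ℕ} {G : SimpleGraph (Fin n)} {v : ℕ → ℤ} {m : ℕ → ℤ → ℤ}

open Classical in
theorem listSets_spec (h0 : v 0 = n) (h1 : v 1 = numIter n) (hA : mat n m 0 = G.adjMatrix ℤ) :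
    listSets.Safe (wordLen n) v m ∧ mat n (listSets.run v m) 1 = setMat (outSet G) := by
  have i := iterMat_spec h0 h1 hA
  set m₀ := iterMat.run v m
  have near := fill_spec (b := 3)
    (e := .cond (.const 2 * .entry 2 2 3 - .monom 4096 15) (.const 1) (.const 0)) (m := m₀)
    (L := wordLen n) (setMat (nearSet G)) h0 (fun m' hm' u w => by
      simp only [Expr.eval_cond, Expr.eval_sub, Expr.eval_mul, Expr.eval_const, Expr.eval_monom]
      rw [Expr.eval_entry m' (u := u) (w := w) (by simp [h0]) (by simp) (by simp),
        hm' 2 (by decide), i.2.2]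
      refine if_congr ?_ rfl rfl
      simp only [nearSet, Finset.mem_filter, Finset.mem_univ, true_and]
      simp [denom, h0]) (abs_setMat_le _)
  set m₁ := (fill 3 (.cond (.const 2 * .entry 2 2 3 - .monom 4096 15)
    (.const 1) (.const 0))).run v m₀
  have hA₁ : mat n m₁ 0 = G.adjMatrix ℤ := (near.2.2 0 (by decide)).trans i.2.1
  have cand := fill_spec (b := 4)
    (e := .cond (.sum 4 0 (.entry 3 2 4 * .entry 0 4 3)) (.const 0) (.const 1)) (m := m₁)
    (L := wordLen n) (setMat (candSet G)) h0 (fun m' hm' u w => by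
      have hs : (Expr.sum 4 0 (.entry 3 2 4 * .entry 0 4 3)).eval
          (Function.update (Function.update v 2 (u : ℕ)) 3 (w : ℕ)) m' =
            ∑ l, if l ∈ nearSet G u ∧ G.Adj l w then 1 else 0 := by
        rw [Expr.eval_sum_fin _ _ (n := n) (by simp [h0])]
        refine Finset.sum_congr rfl fun l _ => ?_
        rw [Expr.eval_mul, Expr.eval_entry m' (u := u) (w := l) (by simp [h0]) (by simp) (by simp),
          Expr.eval_entry m' (u := l) (w := w) (by simp [h0]) (by simp) (by simp),
          hm' 3 (by decide), hm' 0 (by decide), near.2.1, hA₁]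
        simp only [setMat, Matrix.of_apply, SimpleGraph.adjMatrix_apply, indicator_mul]
      simp only [Expr.eval_cond, Expr.eval_const, hs, sum_indicator_pos, setMat, Matrix.of_apply,
        candSet, Finset.mem_filter, Finset.mem_univ, true_and]
      by_cases hc : ∃ l, l ∈ nearSet G u ∧ G.Adj l w
      · rw [if_pos hc, if_neg (by push Not; exact hc)]
      · rw [if_neg hc, if_pos (by push Not at hc; exact hc)]) (abs_setMat_le _)
  set m₂ := (fill 4 (.cond (.sum 4 0 (.entry 3 2 4 * .entry 0 4 3))
    (.const 0) (.const 1))).run v m₁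
  have hA₂ : mat n m₂ 0 = G.adjMatrix ℤ := (cand.2.2 0 (by decide)).trans hA₁
  have out := fill_spec (b := 1)
    (e := .cond (.sum 4 0 (.sum 5 0 (.entry 4 2 4 * .entry 4 2 5 * .entry 0 4 5)))
      (.const 0) (.entry 4 2 3)) (m := m₂)
    (L := wordLen n) (setMat (outSet G)) h0 (fun m' hm' u w => by
      have hs : (Expr.sum 4 0 (.sum 5 0 (.entry 4 2 4 * .entry 4 2 5 * .entry 0 4 5))).eval
          (Function.update (Function.update v 2 (u : ℕ)) 3 (w : ℕ)) m' =
            ∑ p : Fin n × Fin n,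
              if (p.1 ∈ candSet G u ∧ p.2 ∈ candSet G u) ∧ G.Adj p.1 p.2 then 1 else 0 := by
        rw [Expr.eval_sum_fin _ _ (n := n) (by simp [h0]), Fintype.sum_prod_type]
        refine Finset.sum_congr rfl fun l _ => ?_
        rw [Expr.eval_sum_fin _ _ (n := n) (by simp [h0])]
        refine Finset.sum_congr rfl fun k _ => ?_
        rw [Expr.eval_mul, Expr.eval_mul,
          Expr.eval_entry m' (u := u) (w := l) (by simp [h0]) (by simp) (by simp),
          Expr.eval_entry m' (u := u) (w := k) (by simp [h0]) (by simp) (by simp),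
          Expr.eval_entry m' (u := l) (w := k) (by simp [h0]) (by simp) (by simp),
          hm' 4 (by decide), hm' 0 (by decide), cand.2.1, hA₂]
        simp only [setMat, Matrix.of_apply, SimpleGraph.adjMatrix_apply, indicator_mul]
      rw [Expr.eval_cond, hs, Expr.eval_const,
        Expr.eval_entry m' (u := u) (w := w) (by simp [h0]) (by simp) (by simp),
        hm' 4 (by decide), cand.2.1]
      simp only [sum_indicator_pos, setMat, Matrix.of_apply]
      by_cases hc : G.IsIndepSet (candSet G u : Set (Fin n))
      · have ho : outSet G u = candSet G u := if_pos hc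
        rw [ho, if_neg]
        rintro ⟨p, ⟨hp, hq⟩, h⟩
        exact hc hp hq h.ne h
      · have ho : outSet G u = ∅ := if_neg hc
        rw [ho, if_pos]
        · simp
        · simp only [SimpleGraph.IsIndepSet, Set.Pairwise] at hc
          push Not at hc
          obtain ⟨a, ha, b, hb, -, hab⟩ := hc
          exact ⟨(a, b), ⟨ha, hb⟩, hab⟩) (abs_setMat_le _)
  exact ⟨⟨i.1, near.1, cand.1, out.1⟩, out.2.1⟩

open Classical in
theorem bestSet_spec (h0 : v 0 = n) (h1 : v 1 = numIter n) (hA : mat n m 0 = G.adjMatrix ℤ) :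
    bestSet.Safe (wordLen n) v m ∧
      mat n (bestSet.run v m) 1 = setMat fun _ => largestSet n G := by
  have i := listSets_spec h0 h1 hA
  set m₀ := listSets.run v m
  -- Ranks are the only values stored after the iteration that are not 0 or 1; the summands n * n
  -- and n of the word length allow for them.
  have hrank : ∀ u, |rank G u| ≤ 2 ^ wordLen n := by
    intro u
    have h2 : ((outSet G u).card : ℤ) ≤ n := by exact_mod_cast card_finset_fin_le _
    have h3 := u.isLt
    have h4 : ((outSet G u).card : ℤ) * n ≤ n * n := by gcongr
    have h5 : (0 : ℤ) ≤ (outSet G u).card * n := by positivity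
    have h6 : ((n * n + n : ℕ) : ℤ) ≤ 2 ^ wordLen n :=
      cast_le_two_pow (by unfold wordLen; omega)
    push_cast at h6
    unfold rank
    rw [abs_le]
    constructor <;> nlinarith
  have key := fill_spec (b := 3) (e := .sum 4 0 (.entry 1 2 4) * .var 0 - .var 2) (m := m₀)
    (L := wordLen n) (.of fun u _ => rank G u) h0 (fun m' hm' u w => by
      have hs : (Expr.sum 4 0 (.entry 1 2 4)).eval
          (Function.update (Function.update v 2 (u : ℕ)) 3 (w : ℕ)) m' = (outSet G u).card := by
        rw [Expr.eval_sum_fin _ _ (n := n) (by simp [h0])]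
        have : ∀ l : Fin n, (Expr.entry 1 2 4).eval (Function.update (Function.update
            (Function.update v 2 (u : ℕ)) 3 (w : ℕ)) 4 (l : ℕ)) m' =
              if l ∈ outSet G u then 1 else 0 := by
          intro l
          rw [Expr.eval_entry m' (u := u) (w := l) (by simp [h0]) (by simp) (by simp),
            hm' 1 (by decide), i.2]
          rfl
        simp [this]
      simp [hs, rank, h0]) (fun u _ => hrank u)
  set m₁ := (fill 3 (.sum 4 0 (.entry 1 2 4) * .var 0 - .var 2)).run v m₀
  have hO₁ : mat n m₁ 1 = setMat (outSet G) := (key.2.2 1 (by decide)).trans i.2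
  have best := fill_spec (b := 4)
    (e := .cond (.sum 4 0 (.cond (.entry 3 4 3 - .entry 3 2 3) (.const 1) (.const 0)))
      (.const 0) (.const 1)) (m := m₁)
    (L := wordLen n) (.of fun u _ => if ∀ w, rank G w ≤ rank G u then 1 else 0) h0
    (fun m' hm' u w => by
      have hs : (Expr.sum 4 0 (.cond (.entry 3 4 3 - .entry 3 2 3) (.const 1) (.const 0))).eval
          (Function.update (Function.update v 2 (u : ℕ)) 3 (w : ℕ)) m' =
            ∑ l, if rank G u < rank G l then 1 else 0 := by
        rw [Expr.eval_sum_fin _ _ (n := n) (by simp [h0])]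
        refine Finset.sum_congr rfl fun l _ => ?_
        rw [Expr.eval_cond, Expr.eval_sub,
          Expr.eval_entry m' (u := l) (w := w) (by simp [h0]) (by simp) (by simp),
          Expr.eval_entry m' (u := u) (w := w) (by simp [h0]) (by simp) (by simp),
          hm' 3 (by decide), key.2.1]
        simp
      simp only [Expr.eval_cond, Expr.eval_const, hs, sum_indicator_pos, Matrix.of_apply]
      by_cases hc : ∃ l, rank G u < rank G l
      · rw [if_pos hc, if_neg (by push Not; exact hc)]
      · rw [if_neg hc, if_pos (by push Not at hc; exact hc)]) (fun u _ => abs_ite_le_two_pow _)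
  set m₂ := (fill 4 (.cond (.sum 4 0 (.cond (.entry 3 4 3 - .entry 3 2 3) (.const 1) (.const 0)))
      (.const 0) (.const 1))).run v m₁
  have hO₂ : mat n m₂ 1 = setMat (outSet G) := (best.2.2 1 (by decide)).trans hO₁
  have out := fill_spec (b := 5)
    (e := .cond (.sum 4 0 (.entry 4 4 3 * .entry 1 4 3)) (.const 1) (.const 0)) (m := m₂)
    (L := wordLen n) (setMat fun _ => largestSet n G) h0 (fun m' hm' u w => by
      have hs : (Expr.sum 4 0 (.entry 4 4 3 * .entry 1 4 3)).eval
          (Function.update (Function.update v 2 (u : ℕ)) 3 (w : ℕ)) m' =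
            ∑ l, if (∀ k, rank G k ≤ rank G l) ∧ w ∈ outSet G l then 1 else 0 := by
        rw [Expr.eval_sum_fin _ _ (n := n) (by simp [h0])]
        refine Finset.sum_congr rfl fun l _ => ?_
        rw [Expr.eval_mul, Expr.eval_entry m' (u := l) (w := w) (by simp [h0]) (by simp) (by simp),
          Expr.eval_entry m' (u := l) (w := w) (by simp [h0]) (by simp) (by simp),
          hm' 4 (by decide), hm' 1 (by decide), best.2.1, hO₂]
        simp only [setMat, Matrix.of_apply, indicator_mul]
      simp only [Expr.eval_cond, Expr.eval_const, hs, sum_indicator_pos, setMat, Matrix.of_apply,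
        largestSet, Finset.mem_filter, Finset.mem_univ, true_and]) (abs_setMat_le _)
  have c := copy_spec (b := 1) (b' := 5) (L := wordLen n)
    (m := (fill 5 (.cond (.sum 4 0 (.entry 4 4 3 * .entry 1 4 3)) (.const 1) (.const 0))).run v m₂)
    (by decide) h0 (by rw [out.2.1]; exact abs_setMat_le _)
  exact ⟨⟨i.1, key.1, best.1, out.1, c.1⟩, c.2.1.trans out.2.1⟩

end Spec

/-- A command that only uses the variables `0`, with value `n`, and `1`, with value `numIter n`,
in addition to its own loop variables, is executed in polynomial time. -/
theorem exists_polyTime (c : Cmd) (hc : c.Below 8)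
    (hsafe : ∀ (n : ℕ) (G : SimpleGraph (Fin n)) (v : ℕ → ℤ), v 0 = n → v 1 = numIter n →
      c.Safe (wordLen n) v (inputState G).mem) :
    ∃ (p : Prog) (q : Polynomial ℕ), ∀ (n : ℕ) (G : SimpleGraph (Fin n)),
      ∃ s t v, Exec p (inputState G) s t ∧ t ≤ q.eval n ∧ s.reg 0 = n ∧
        v 0 = (n : ℤ) ∧ v 1 = (numIter n : ℤ) ∧ s.mem = c.run v (inputState G).mem := by
  have hR : PolyBounded fun n => numIter n + n := polyBounded_numIter.add PolyBounded.id
  obtain ⟨q, hq⟩ := ((PolyBounded.exprTime (.monom 1024 11) hR polyBounded_wordLen).add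
    (polyBounded_wordLen.add (.const 2))).add (PolyBounded.cmdTime c hR polyBounded_wordLen)
  -- Loops take their length from a variable, so the number of iterations is first evaluated in
  -- scratch register 8 and then added to register 1, which is initially zero.
  refine ⟨.seq (.seq ((Expr.monom 1024 11).code 8) (.arith .add 1 8 1)) (c.code 8), q,
    fun n G => ?_⟩
  have hL : 1 ≤ wordLen n := by unfold wordLen; omega
  have hRL : numIter n + n ≤ 2 ^ wordLen n := by
    have : ((numIter n + n : ℕ) : ℤ) ≤ 2 ^ wordLen n := cast_le_two_pow (by unfold wordLen; omega)
    exact_mod_cast this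
  have hv : RegBound 8 (numIter n + n) (inputState G).reg := by
    intro r _
    simp only [inputState]
    split_ifs <;> constructor <;> omega
  have hm : MemBound (wordLen n) (inputState G).mem := by
    classical
    exact fun b i => abs_ite_le_two_pow _
  obtain ⟨s, t, e1, e2, e3, e4, e5⟩ :=
    (Expr.monom 1024 11).exec hL hRL (Expr.below_monom _ _ (by norm_num)) le_rfl hv hm
  have h1 : s.reg 1 = 0 := by rw [e4 1 (by norm_num)]; simp [inputState]
  have h8 : s.reg 8 = numIter n := by rw [e5]; simp [inputState, numIter]
  have e6 := Exec.arith .add 1 8 1 s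
  rw [h8, h1] at e6
  simp only [Op.eval, add_zero, bits_zero] at e6
  set s₁ := s.setReg 1 (numIter n) with hs₁
  have r0 : s₁.reg 0 = n := by simp [hs₁, e4 0, inputState]
  have r1 : s₁.reg 1 = numIter n := by simp [hs₁]
  have hm₁ : s₁.mem = (inputState G).mem := e3
  have hv₁ : RegBound 8 (numIter n + n) s₁.reg := by
    intro r hr
    by_cases hr1 : r = 1
    · subst hr1
      rw [r1]
      push_cast
      constructor <;> omega
    · have : s₁.reg r = (inputState G).reg r := by simp [hs₁, hr1, e4 r hr]
      rw [this]
      exact hv r hr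
  obtain ⟨s', t', f1, f2, f3, -, f5⟩ := c.exec hL hRL hc le_rfl hv₁ (by rwa [hm₁])
    (by rw [hm₁]; exact hsafe n G _ r0 r1)
  refine ⟨s', _, s₁.reg, (e1.seq e6).seq f1, le_trans ?_ (hq n), ?_, r0, r1, by rw [f3, hm₁]⟩
  · have := bits_natCast_le (show numIter n ≤ numIter n + n by omega) hRL
    dsimp only
    omega
  · rw [f5 0 (by norm_num), r0]

end Cmd

open Classical in
theorem mat_inputState {n : ℕ} (G : SimpleGraph (Fin n)) :
    mat n (inputState G).mem 0 = G.adjMatrix ℤ := by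
  ext u v
  simp only [mat, Matrix.of_apply, inputState, SimpleGraph.adjMatrix_apply, true_and]
  refine if_congr ⟨?_, fun h => ⟨u, v, rfl, h⟩⟩ rfl rfl
  rintro ⟨u', v', h, hadj⟩
  obtain ⟨h1, h2⟩ := mul_add_inj v.isLt v'.isLt h
  rwa [Fin.ext h1, Fin.ext h2]

theorem polyTimeComputable_outList : PolyTimeComputable outList := by
  classical
  obtain ⟨p, q, h⟩ := Cmd.listSets.exists_polyTime Cmd.below_listSets
    fun n G v h0 h1 => (Cmd.listSets_spec h0 h1 (mat_inputState G)).1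
  refine ⟨p, q, fun n G => ?_⟩
  obtain ⟨s, t, v, h1, h2, h3, h4, h5, h6⟩ := h n G
  refine ⟨s, t, h1, h2, by simp [h3, outList], fun i w => ?_⟩
  have hs := (Cmd.listSets_spec h4 h5 (mat_inputState G)).2
  rw [← h6] at hs
  have hi : (i : ℕ) < n := by simpa [outList] using i.isLt
  have := congrFun (congrFun hs ⟨i, hi⟩) w
  have hget : (outList n G).get i = outSet G ⟨i, hi⟩ := by
    change ((List.finRange n).map (outSet G))[(i : ℕ)]'_ = _
    rw [List.getElem_map, List.getElem_finRange]
    rfl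
  rw [hget]
  simpa [mat, setMat] using this

theorem polyTimeComputable_largestSet : PolyTimeComputable fun n G => [largestSet n G] := by
  classical
  obtain ⟨p, q, h⟩ := Cmd.bestSet.exists_polyTime Cmd.below_bestSet
    fun n G v h0 h1 => (Cmd.bestSet_spec h0 h1 (mat_inputState G)).1
  -- The command writes the same set in all n rows; setting the length in register 0 to 1 makes only
  -- row 0 the output, at the cost of 2 time units.
  refine ⟨.seq p (.const 0 1), q + 2, fun n G => ?_⟩
  obtain ⟨s, t, v, h1, h2, h3, h4, h5, h6⟩ := h n G
  refine ⟨_, _, h1.seq (.const 0 1 s), ?_, by simp, fun i w => ?_⟩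
  · simp only [Polynomial.eval_add, Polynomial.eval_ofNat, bits_one]
    omega
  · have hs := (Cmd.bestSet_spec h4 h5 (mat_inputState G)).2
    rw [← h6] at hs
    have := congrFun (congrFun hs ⟨0, w.pos⟩) w
    have hi : i = ⟨0, by simp⟩ := Fin.ext (by simp)
    subst hi
    simpa [mat, setMat] using this

end PlantedIndepSet

namespace PlantedIndepSet

/-! ### Success probability -/

/-- A bound for the probability that the algorithms fail. -/
noncomputable def failureBound (n : ℕ) : ℝ := Real.exp (-(n : ℝ)) + 6000 / n

theorem tendsto_failureBound : Filter.Tendsto failureBound Filter.atTop (nhds 0) := by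
  have h1 : Filter.Tendsto (fun n : ℕ => Real.exp (-(n : ℝ))) Filter.atTop (nhds 0) :=
    Real.tendsto_exp_neg_atTop_nhds_zero.comp tendsto_natCast_atTop_atTop
  have h2 := tendsto_const_div_atTop_nhds_zero_nat (6000 : ℝ)
  have h := h1.add h2
  rwa [add_zero] at h

/-- The size condition gives n² ≤ k³, and the cubic term of the exponential series gives (9/10)^k ≤
e^{-k/10} ≤ 6000/k³. -/
theorem mul_pow_le_div {n k : ℕ} (hn : 1 ≤ n) (hk : (n : ℝ) ^ (2 / 3 : ℝ) ≤ k) :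
    n * (9 / 10 : ℝ) ^ k ≤ 6000 / n := by
  have hn0 : (0 : ℝ) < n := by exact_mod_cast hn
  have hp : (0 : ℝ) < (n : ℝ) ^ (2 / 3 : ℝ) := Real.rpow_pos_of_pos hn0 _
  have hk0 : (0 : ℝ) < k := hp.trans_le hk
  have h1 : (n : ℝ) ^ 2 ≤ (k : ℝ) ^ 3 := by
    calc (n : ℝ) ^ 2 = ((n : ℝ) ^ (2 / 3 : ℝ)) ^ 3 := by
          rw [← Real.rpow_natCast, ← Real.rpow_natCast, ← Real.rpow_mul hn0.le]; norm_num
      _ ≤ (k : ℝ) ^ 3 := pow_le_pow_left₀ hp.le hk 3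
  have h2 : (9 / 10 : ℝ) ^ k ≤ Real.exp (-(k / 10)) := by
    calc (9 / 10 : ℝ) ^ k ≤ Real.exp (-(1 / 10)) ^ k := by
          refine pow_le_pow_left₀ (by norm_num) ?_ k
          have := Real.add_one_le_exp (-(1 / 10 : ℝ))
          linarith
      _ = Real.exp (-(k / 10)) := by rw [← Real.exp_nat_mul]; congr 1; ring
  have h3 : ((k : ℝ) / 10) ^ 3 / 6 ≤ Real.exp (k / 10) := by
    have := Real.pow_div_factorial_le_exp ((k : ℝ) / 10) (by positivity) 3
    simpa [Nat.factorial] using this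
  have h4 : Real.exp (-(k / 10)) * (n : ℝ) ^ 2 ≤ 6000 := by
    calc Real.exp (-(k / 10)) * (n : ℝ) ^ 2 ≤ Real.exp (-(k / 10)) * (6000 * Real.exp (k / 10)) :=
          mul_le_mul_of_nonneg_left (by nlinarith) (Real.exp_pos _).le
      _ = 6000 * (Real.exp (-(k / 10)) * Real.exp (k / 10)) := by ring
      _ = 6000 := by rw [← Real.exp_add]; simp
  rw [le_div_iff₀ hn0]
  calc n * (9 / 10 : ℝ) ^ k * n = (9 / 10 : ℝ) ^ k * (n : ℝ) ^ 2 := by ring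
    _ ≤ Real.exp (-(k / 10)) * (n : ℝ) ^ 2 := mul_le_mul_of_nonneg_right h2 (by positivity)
    _ ≤ 6000 := h4

/-- The event contains all good edge sets, and goodness of E alone forces the conclusion for every
admissible graph; so the adversary may choose the graph after seeing E. -/
theorem success_prob {n : ℕ} {S : Finset (Fin n)}
    (hk : (10 : ℝ) ^ 4 * (n : ℝ) ^ (2 / 3 : ℝ) ≤ S.card) :
    1 - failureBound n ≤ (boundaryLaw S).real {E | ∀ G : SimpleGraph (Fin n), Admissible S E G →
      S ∈ outList n G ∧ S.card ≤ (largestSet n G).card ∧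
        ∀ x, IsOptimal G x → ∀ l : List (Fin n), (∀ v, v ∈ l) → S ∈ candidates G l x} := by
  rcases Nat.eq_zero_or_pos n with rfl | hn
  -- For n = 0 the quotient 6000 / 0 is 0 and the failure bound is 1, so the claim is trivial.
  · simp [failureBound]
  have hp : (0 : ℝ) ≤ (n : ℝ) ^ (2 / 3 : ℝ) := by positivity
  have h1 := mul_pow_le_div hn (k := S.card) (by linarith)
  have h2 := goodEdges_prob hn S
  have : MeasureTheory.IsProbabilityMeasure (boundaryLaw S) := by
    unfold boundaryLaw; infer_instance
  calc 1 - failureBound n ≤ 1 - (Real.exp (-n) + n * (9 / 10) ^ S.card) := by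
        unfold failureBound; linarith
    _ ≤ (boundaryLaw S).real {E | GoodEdges S E} := h2
    _ ≤ _ := by
        refine MeasureTheory.measureReal_mono fun E hE G hG => ?_
        obtain ⟨u, hu⟩ := exists_outSet_eq hn hk hE hG
        obtain ⟨w, hw, hmax⟩ := exists_largestSet_eq hn G
        exact ⟨List.mem_map.2 ⟨u, List.mem_finRange u, hu⟩, hw ▸ hu ▸ hmax u,
          fun x hx l hl => mem_candidates hn hk hE hG hx hl⟩

end PlantedIndepSet

theorem theorem1 :
    -- the crude semidefinite program always has an optimal solution
    (∀ (n : ℕ) (G : SimpleGraph (Fin n)), ∃ x, PlantedIndepSet.IsOptimal G x) ∧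
    ∃ (c₁ : ℝ) (list : (n : ℕ) → SimpleGraph (Fin n) → List (Finset (Fin n)))
      (single : (n : ℕ) → SimpleGraph (Fin n) → Finset (Fin n)) (δ : ℕ → ℝ),
      0 < c₁ ∧
      Filter.Tendsto δ Filter.atTop (nhds 0) ∧
      -- two deterministic polynomial-time algorithms
      PlantedIndepSet.PolyTimeComputable list ∧
      PlantedIndepSet.PolyTimeComputable (fun n G => [single n G]) ∧
      -- on every graph the first one lists at most `n` independent sets,
      -- and the second one returns an independent set
      (∀ (n : ℕ) (G : SimpleGraph (Fin n)),
        (list n G).length ≤ n ∧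
        (∀ T ∈ list n G, G.IsIndepSet (T : Set (Fin n))) ∧
        G.IsIndepSet (single n G : Set (Fin n))) ∧
      -- with high probability over the random edges, whatever the adversary does
      ∀ (n k : ℕ) (S : Finset (Fin n)), S.card = k → c₁ * (n : ℝ) ^ (2 / 3 : ℝ) ≤ (k : ℝ) →
        1 - δ n ≤ (PlantedIndepSet.boundaryLaw S).real
          {E | ∀ G : SimpleGraph (Fin n), PlantedIndepSet.Admissible S E G →
            S ∈ list n G ∧
            k ≤ (single n G).card ∧
            -- `S` is a candidate for every optimal solution, in every order of the greedy step
            ∀ x, PlantedIndepSet.IsOptimal G x → ∀ l : List (Fin n), (∀ v, v ∈ l) →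
              S ∈ PlantedIndepSet.candidates G l x} := by
  refine ⟨PlantedIndepSet.exists_isOptimal, 10 ^ 4, PlantedIndepSet.outList,
    PlantedIndepSet.largestSet, PlantedIndepSet.failureBound, by norm_num,
    PlantedIndepSet.tendsto_failureBound, PlantedIndepSet.polyTimeComputable_outList,
    PlantedIndepSet.polyTimeComputable_largestSet, fun n G => ⟨?_, fun T hT => ?_, ?_⟩,
    fun n k S hS hk => ?_⟩
  · simp [PlantedIndepSet.outList]
  · obtain ⟨u, -, rfl⟩ := List.mem_map.1 hT
    exact PlantedIndepSet.isIndepSet_outSet G u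
  · exact PlantedIndepSet.isIndepSet_largestSet n G
  · subst hS
    exact PlantedIndepSet.success_prob hk
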